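/- Let $0\le m\le n$ and let $\mathcal D_0$ be the ring of germs at $0\in\mathbb R^n$ of linear differential operators with complex-valued real-analytic coefficients. For a distribution $u$ defined on a neighbourhood of $0$, let $\mathrm{Ann}_{\mathcal D_0}u$ be the set of $P\in\mathcal D_0$ such that $Pu=0$ on some neighbourhood of $0$. For a real-valued real-analytic function $f$ on an open set $V\subset\mathbb R^n$, let $f_+^\lambda$ be the distribution on $V$ given, for $\mathrm{Re}\,\lambda>0$, by the function equal to $f(x)^\lambda$ where $f(x)>0$ and to $0$ where $f(x)\le 0$, and, for other $\lambda$, by meromorphic continuation to $\lambda\in\mathbb C$. Theorem. Let $f_1,\dots,f_m$ be real-valued real-analytic functions on an open neighbourhood $U$ of the origin of $\mathbb R^n$ with $df_1\wedge\cdots\wedge df_m\neq 0$ at $0$. Let $v_1,\dots,v_n$ be real-analytic vector fields on $U$ which are linearly independent at $0$ and satisfy, on $U$, $v_i(f_j)=1$ if $i=j\le m$ and $v_i(f_j)=0$ otherwise. Then on some open neighbourhood $V\subset U$ of $0$ there is a Laurent expansion $$(f_1\cdots f_m)_+^\lambda=\sum_{j=-m}^{\infty}(\lambda+1)^j u_j$$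 for $\lambda\ne -1$ near $-1$, with distributions $u_j$ on $V$. Moreover, for every open neighbourhood $V\subset U$ of $0$ and every such expansion on $V$, and for each $k=0,1,\dots,m-1$, the set $\mathrm{Ann}_{\mathcal D_0}u_{-m+k}$ is the left ideal of $\mathcal D_0$ generated by $$f_{j_1}\cdots f_{j_{k+1}}\ (1\le j_1<\cdots<j_{k+1}\le m),\qquad f_1v_1-f_iv_i\ (2\le i\le m),\qquad v_j\ (m+1\le j\le n).$$ -/

import Mathlib

open Filter Topology TopologicalSpace MeasureTheory
open scoped Distributions

noncomputable section

namespace ComplexPower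

/-! ## Germs of analytic functions and differential operators at the origin of `ℝⁿ` -/

/-- The ring of germs at `0 ∈ ℝⁿ` of complex-valued real-analytic functions.
(`ℝⁿ` is `Fin n → ℝ`; the choice of norm plays no role here.) -/
def AnalyticGerm (n : ℕ) : Subring (Germ (𝓝 (0 : Fin n → ℝ)) ℂ) where
  carrier := {g | ∃ h : (Fin n → ℝ) → ℂ, AnalyticAt ℝ h 0 ∧ g = (h : Germ (𝓝 (0 : Fin n → ℝ)) ℂ)}
  mul_mem' := by
    rintro _ _ ⟨h, hh, rfl⟩ ⟨k, hk, rfl⟩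
    exact ⟨h * k, hh.mul hk, rfl⟩
  one_mem' := ⟨1, analyticAt_const, rfl⟩
  add_mem' := by
    rintro _ _ ⟨h, hh, rfl⟩ ⟨k, hk, rfl⟩
    exact ⟨h + k, hh.add hk, rfl⟩
  zero_mem' := ⟨0, analyticAt_const, rfl⟩
  neg_mem' := by
    rintro _ ⟨h, hh, rfl⟩
    exact ⟨-h, hh.neg, rfl⟩

/-- The germ at `0` of a function that is analytic at `0`. -/
def AnalyticGerm.mk {n : ℕ} (h : (Fin n → ℝ) → ℂ) (hh : AnalyticAt ℝ h 0) : AnalyticGerm n :=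
  ⟨(h : Germ (𝓝 (0 : Fin n → ℝ)) ℂ), h, hh, rfl⟩

/-- `∂h/∂xᵢ`. -/
def partialFun {n : ℕ} (i : Fin n) (h : (Fin n → ℝ) → ℂ) : (Fin n → ℝ) → ℂ :=
  fun x => fderiv ℝ h x (Pi.single i 1)

theorem partialFun_analyticAt {n : ℕ} (i : Fin n) {h : (Fin n → ℝ) → ℂ}
    (hh : AnalyticAt ℝ h 0) : AnalyticAt ℝ (partialFun i h) 0 :=
  ((ContinuousLinearMap.apply ℝ ℂ (Pi.single i (1 : ℝ) : Fin n → ℝ)).analyticAt _).comp hh.fderiv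

/-- `∂ᵢ` on arbitrary germs of functions at `0`. -/
def partialGerm {n : ℕ} (i : Fin n) :
    Germ (𝓝 (0 : Fin n → ℝ)) ℂ → Germ (𝓝 (0 : Fin n → ℝ)) ℂ :=
  Germ.map' (partialFun i) (by
    intro h k hhk
    filter_upwards [Filter.EventuallyEq.fderiv (𝕜 := ℝ) hhk] with x hx
    simp only [partialFun, hx])

/-- `∂ᵢ` as an additive endomorphism of the ring of analytic germs. -/
def partialOp {n : ℕ} (i : Fin n) : AddMonoid.End (AnalyticGerm n) where
  toFun g := ⟨partialGerm i g.1, by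
    obtain ⟨h, hh, hg⟩ := g.2
    exact ⟨partialFun i h, partialFun_analyticAt i hh, by rw [hg]; rfl⟩⟩
  map_zero' := by
    apply Subtype.ext
    change ((partialFun i (0 : (Fin n → ℝ) → ℂ) : (Fin n → ℝ) → ℂ) : Germ (𝓝 (0 : Fin n → ℝ)) ℂ)
      = ((0 : (Fin n → ℝ) → ℂ) : Germ (𝓝 (0 : Fin n → ℝ)) ℂ)
    congr 1
    funext x
    simp [partialFun]
  map_add' := by
    rintro ⟨_, h, hh, rfl⟩ ⟨_, k, hk, rfl⟩
    apply Subtype.ext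
    change ((partialFun i (h + k) : (Fin n → ℝ) → ℂ) : Germ (𝓝 (0 : Fin n → ℝ)) ℂ)
      = ((partialFun i h + partialFun i k : (Fin n → ℝ) → ℂ) : Germ (𝓝 (0 : Fin n → ℝ)) ℂ)
    rw [Germ.coe_eq]
    filter_upwards [hh.eventually_analyticAt, hk.eventually_analyticAt] with x hx kx
    simp [partialFun, fderiv_add hx.differentiableAt kx.differentiableAt]

/-- The ring `𝒟₀` of germs at `0` of linear differential operators with complex-valued
real-analytic coefficients, realised (faithfully) as the ring of operators on analytic germs
generated by the multiplications by analytic germs and by `∂₁, …, ∂ₙ`. Its elements are exactly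
the finite sums `∑ a_α ∂^α`. -/
def DiffOpGerm (n : ℕ) : Subring (AddMonoid.End (AnalyticGerm n)) :=
  Subring.closure
    (Set.range (AddMonoidHom.mulLeft : AnalyticGerm n → AddMonoid.End (AnalyticGerm n)) ∪
      Set.range partialOp)

/-- The operator of multiplication by (the germ of) a function. -/
def DiffOpGerm.ofFun {n : ℕ} (h : (Fin n → ℝ) → ℂ) (hh : AnalyticAt ℝ h 0) : DiffOpGerm n :=
  ⟨AddMonoidHom.mulLeft (AnalyticGerm.mk h hh), Subring.subset_closure (Or.inl ⟨_, rfl⟩)⟩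

/-- The operator `∂ᵢ`. -/
def DiffOpGerm.partialD {n : ℕ} (i : Fin n) : DiffOpGerm n :=
  ⟨partialOp i, Subring.subset_closure (Or.inr ⟨i, rfl⟩)⟩

/-- The operator of multiplication by a real-valued function. -/
def DiffOpGerm.ofRealFun {n : ℕ} (h : (Fin n → ℝ) → ℝ) (hh : AnalyticAt ℝ h 0) : DiffOpGerm n :=
  DiffOpGerm.ofFun (fun x => (h x : ℂ)) ((Complex.ofRealCLM.analyticAt _).comp hh)

/-- The first order operator `∑ₗ vₗ ∂ₗ` given by a real vector field `v`. -/
def DiffOpGerm.ofVectorField {n : ℕ} (v : (Fin n → ℝ) → (Fin n → ℝ)) (hv : AnalyticAt ℝ v 0) :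
    DiffOpGerm n :=
  ∑ l : Fin n, DiffOpGerm.ofRealFun (fun x => v x l)
    (((ContinuousLinearMap.proj (R := ℝ) (φ := fun _ : Fin n => ℝ) l).analyticAt _).comp hv) *
      DiffOpGerm.partialD l

/-! ## Differential operators on open sets and their action on distributions -/

/-- `D₀ ^ α₀ * ⋯ * Dₙ₋₁ ^ αₙ₋₁`. -/
def multiPow {n : ℕ} {M : Type*} [Monoid M] (D : Fin n → M) (α : Fin n → ℕ) : M :=
  (List.ofFn fun i => D i ^ α i).prod

/-- Complex distributions on `V`: continuous `ℂ`-linear forms on the space of complex-valued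
smooth functions with compact support in `V`. -/
abbrev Distr {n : ℕ} (V : Opens (Fin n → ℝ)) : Type := 𝓓(V, ℂ) →L[ℂ] ℂ

/-- A differential operator `∑_{α ∈ support} a_α ∂^α` with complex-valued real-analytic
coefficients on the open set `V`. -/
structure DiffOp {n : ℕ} (V : Opens (Fin n → ℝ)) where
  support : Finset (Fin n → ℕ)
  coeff : (Fin n → ℕ) → (Fin n → ℝ) → ℂ
  analytic : ∀ α, AnalyticOnNhd ℝ (coeff α) V

/-- The germ at `0` of a differential operator. -/
def DiffOp.germ {n : ℕ} {V : Opens (Fin n → ℝ)} (P : DiffOp V) (h0 : (0 : Fin n → ℝ) ∈ V) :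
    DiffOpGerm n :=
  ∑ α ∈ P.support,
    DiffOpGerm.ofFun (P.coeff α) (P.analytic α 0 h0) * multiPow DiffOpGerm.partialD α

/-- The product of a test function with a function analytic on `V`. -/
def mulTest {n : ℕ} {V : Opens (Fin n → ℝ)} (a : (Fin n → ℝ) → ℂ) (ha : AnalyticOnNhd ℝ a V)
    (φ : 𝓓(V, ℂ)) : 𝓓(V, ℂ) where
  toFun x := a x * φ x
  contDiff' := by
    rw [contDiff_iff_contDiffAt]
    intro x
    by_cases hx : x ∈ tsupport φ
    · exact (ha x (φ.tsupport_subset hx)).contDiffAt.mul φ.contDiff.contDiffAt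
    · have h0 : (fun y => a y * φ y) =ᶠ[𝓝 x] fun _ => (0 : ℂ) := by
        filter_upwards [(isClosed_tsupport (φ : (Fin n → ℝ) → ℂ)).isOpen_compl.mem_nhds hx] with y hy
        rw [image_eq_zero_of_notMem_tsupport hy, mul_zero]
      exact contDiffAt_const.congr_of_eventuallyEq h0
  hasCompactSupport' := φ.hasCompactSupport.mul_left
  tsupport_subset' := (tsupport_mul_subset_right).trans φ.tsupport_subset

/-- `∂ᵢ` on test functions. -/
def testPartial {n : ℕ} (V : Opens (Fin n → ℝ)) (i : Fin n) : Module.End ℂ 𝓓(V, ℂ) :=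
  (TestFunction.lineDerivCLM ℂ (Pi.single i 1) : 𝓓(V, ℂ) →L[ℂ] 𝓓(V, ℂ)).toLinearMap

/-- The transpose `φ ↦ ∑ (-1)^|α| ∂^α (a_α φ)` of `P = ∑ a_α ∂^α`, which defines the action of
`P` on distributions through `⟨P u, φ⟩ = ⟨u, ᵗP φ⟩`. -/
def DiffOp.transpose {n : ℕ} {V : Opens (Fin n → ℝ)} (P : DiffOp V) (φ : 𝓓(V, ℂ)) : 𝓓(V, ℂ) :=
  ∑ α ∈ P.support,
    ((-1 : ℂ) ^ (∑ i, α i)) • multiPow (testPartial V) α (mulTest (P.coeff α) (P.analytic α) φ)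

/-- The restriction of a distribution to a smaller open set. -/
def Distr.restrict {n : ℕ} {V V' : Opens (Fin n → ℝ)} (u : Distr V) (_h : V' ≤ V) : Distr V' :=
  u.comp (TestFunction.monoCLM ℂ : 𝓓(V', ℂ) →L[ℂ] 𝓓(V, ℂ))

/-- `P u = 0`. -/
def DiffOp.Annihilates {n : ℕ} {V : Opens (Fin n → ℝ)} (P : DiffOp V) (u : Distr V) : Prop :=
  ∀ φ : 𝓓(V, ℂ), u (P.transpose φ) = 0

/-- The annihilator of a distribution `u` in `𝒟₀`: the germs at `0` of the differential operators
on some open neighbourhood of `0` that annihilate `u` there. -/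
def annihilator {n : ℕ} {V : Opens (Fin n → ℝ)} (u : Distr V) : Set (DiffOpGerm n) :=
  {P | ∃ (V' : Opens (Fin n → ℝ)) (h0 : (0 : Fin n → ℝ) ∈ V') (hV : V' ≤ V) (Q : DiffOp V'),
    Q.germ h0 = P ∧ Q.Annihilates (u.restrict hV)}

/-! ## The complex power and its Laurent expansions -/

/-- `f₊ˢ(x) = f(x)ˢ` if `f(x) > 0`, and `0` otherwise. -/
def plusPow {n : ℕ} (f : (Fin n → ℝ) → ℝ) (s : ℂ) (x : Fin n → ℝ) : ℂ :=
  if 0 < f x then (f x : ℂ) ^ s else 0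

/-- The family `T` of distributions on `V` is the complex power `f₊ˢ`: it is meromorphic in `s` on
the whole complex plane and is given by the locally integrable function `f₊ˢ` for `Re s > 0`. -/
def IsComplexPower {n : ℕ} (V : Opens (Fin n → ℝ)) (f : (Fin n → ℝ) → ℝ) (T : ℂ → Distr V) :
    Prop :=
  (∀ φ : 𝓓(V, ℂ), MeromorphicOn (fun s => T s φ) Set.univ) ∧
    ∀ s : ℂ, 0 < s.re → ∀ φ : 𝓓(V, ℂ), T s φ = ∫ x, plusPow f s x * φ x

/-- On `V`, the complex power has the Laurent expansion
`f₊ˢ = ∑_{j ≥ -N} (s - s₀)ʲ uⱼ` about `s₀`, for all `s ≠ s₀` in a neighbourhood `W` of `s₀`. -/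
def IsLaurentExpansion {n : ℕ} (V : Opens (Fin n → ℝ)) (f : (Fin n → ℝ) → ℝ) (s₀ : ℂ) (N : ℕ)
    (u : ℤ → Distr V) : Prop :=
  ∃ T : ℂ → Distr V, IsComplexPower V f T ∧ ∃ W ∈ 𝓝 s₀, ∀ s ∈ W, s ≠ s₀ → ∀ φ : 𝓓(V, ℂ),
    HasSum (fun j : ℕ => (s - s₀) ^ ((j : ℤ) - N) * u ((j : ℤ) - N) φ) (T s φ)

/-- The generators: the products of `k + 1` distinct functions among `f₁, …, fₘ`, the operators
`f₁v₁ - fᵢvᵢ` with `2 ≤ i ≤ m`, and the operators `vⱼ` with `m < j ≤ n`. (Indices in `Fin` start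
at `0`, so that `f₁` is `f 0`.) -/
def generators {n m : ℕ} (hmn : m ≤ n) (f : Fin m → (Fin n → ℝ) → ℝ)
    (hf : ∀ j, AnalyticAt ℝ (f j) 0) (v : Fin n → (Fin n → ℝ) → (Fin n → ℝ))
    (hv : ∀ i, AnalyticAt ℝ (v i) 0) (k : ℕ) : Set (DiffOpGerm n) :=
  {P | ∃ J : Finset (Fin m), J.card = k + 1 ∧
      P = DiffOpGerm.ofRealFun (fun x => ∏ j ∈ J, f j x)
        (Finset.analyticAt_fun_prod J fun j _ => hf j)} ∪
  {P | ∃ i₁ i : Fin m, (i₁ : ℕ) = 0 ∧ 1 ≤ (i : ℕ) ∧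
      P = DiffOpGerm.ofRealFun (f i₁) (hf i₁) *
          DiffOpGerm.ofVectorField (v (Fin.castLE hmn i₁)) (hv _) -
        DiffOpGerm.ofRealFun (f i) (hf i) *
          DiffOpGerm.ofVectorField (v (Fin.castLE hmn i)) (hv _)} ∪
  {P | ∃ j : Fin n, m ≤ (j : ℕ) ∧ P = DiffOpGerm.ofVectorField (v j) (hv j)}

end ComplexPower

end

/-!
The functions `f₁, …, fₘ` are completed to an analytic chart of `ℝⁿ` at `0` whose last coordinates
come from the dual basis of the vectors `vᵢ(0)` (`DualFrame.chart`). In this chart each `vᵢ` is the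
coordinate field `wᵢ` (for `i ≤ m`) or `0` (for `i > m`), plus a combination of the last coordinate
fields, and the latter are combinations of the `vⱼ` with `j > m`. So the ideal of the theorem is
the ideal generated by the products of `k + 1` coordinates `xᵢ`, the operators `x₁w₁ - xᵢwᵢ` and
the last coordinate fields (`DualFrame.span_generators_eq`).

*Laurent expansion.* Write `f = f₁ ⋯ fₘ`, and `f_A` for the product over a set `A` of indices.
Integration by parts gives `vᵢ(f₊ˢ f_A) = (s + 1) f₊ˢ f_{A \ i}` for `i ∈ A`
(`DualFrame.powInt_tv`), hence the functional equation `v₁ ⋯ vₘ f₊ˢ⁺¹ = (s + 1)ᵐ f₊ˢ`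
(`DualFrame.powInt_tL`). It continues `f₊ˢ` to all `s`, with a pole of order at most `m` at `-1`,
and Cauchy's estimates show that the coefficients of the Laurent expansion are distributions
(`DualFrame.exists_isLaurentExpansion`).

*The ideal annihilates.* Since `f · f₊ˢ = f₊ˢ⁺¹` has no pole at `-1`, comparing coefficients in the
relation above, for smaller and smaller `A`, shows that `u_{k-m}` is killed by the products of more
than `k` of the `fᵢ` (`DualFrame.coeff_mulF`). The same relation shows that `fᵢ vᵢ u_{k-m} =
u_{k-1-m} - u_{k-m}` for all `i` (`DualFrame.I_le_annIdeal`).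

*Nothing else annihilates.* Let `e = w₁x₁`, which is congruent modulo the ideal to each `wᵢxᵢ`.
Modulo the ideal, every operator is a sum of terms `wᵃ c_a(e)`, where `wᵃ` is a monomial in the
`wᵢ` and `c_a` a polynomial with analytic coefficients independent of the `xᵢ` with `aᵢ ≠ 0`
(`LogFrame.exists_normal_form`). If such a sum annihilates `u_{k-m}`, its coefficients are
recovered one group at a time. Multiplying by `x_s ^ D`, where `D` is the degree in `w_s`, turns
`x_s ^ D w_s ^ D` into a polynomial in `e`, so removes `w_s`; restricting the result to `x_s = 0`
isolates the terms of degree `D` (`LogFrame.x_pow_mul_real_sub_mem`, `LogFrame.rho_coeff_lower`).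
This reduces the question to a single polynomial `∑ g_p eᵖ`. Multiplication by a product of `k`
coordinates kills the terms with `p ≥ 1`, so leaves the function `g₀`; once `g₀` is known to lie in
the right ideal it can be removed, and `e u_{k-m} = u_{k-1-m}` allows an induction on `k`
(`LogFrame.coeff_mem_X_of_ev_mem`, `DualFrame.mem_annIdeal_of_mul_eul_mem`).

It remains to see that if `a` times a product of `k` of the `fᵢ` annihilates `u_{k-m}`, then `a`
vanishes where the other `m - k` functions vanish (`DualFrame.vanishesOn_of_mem_annIdeal`). Near a
point where exactly these vanish, the integral of `f₊ˢ` against a product test function is a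
product of one-dimensional Mellin transforms, and has a pole of order `m - k` at `-1`
(`DualFrame.exists_test_powInt`): in `f₊ˢ = |f|ˢ (1 + sgn f) / 2` the term with the sign has an odd
factor, so integrates to `0`. A function that vanishes wherever `m - k` of the coordinates vanish
is, by repeated division, in the ideal generated by the products of `k + 1` coordinates
(`LogFrame.IsVanishing.mem_span`), which is where such coefficients have to be. The algebraic
argument is assembled in `LogFrame.le_I`.
-/

noncomputable section

namespace ComplexPower

section

/-! ### Operators with logarithmic coordinates: the algebra -/

/-- A ring `R` of differential operators over a commutative ring `O` of functions, with commuting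
derivations `w i` and `y j`. The `x i` are coordinates dual to the `w i`, and `rho i a` is the
restriction of `a` to `x i = 0` (extended so as not to depend on `x i`). When `x i` is a unit this
locus is empty, and `rho i = 0` is allowed. -/
structure LogFrame (R O α κ : Type*) [Ring R] [CommRing O] [DecidableEq α] where
  ι : O →+* R
  x : α → O
  w : α → R
  y : κ → R
  dw : α → O →+ O
  dy : κ → O →+ O
  rho : α → O →+ O
  w_mul : ∀ i a, w i * ι a = ι a * w i + ι (dw i a)
  y_mul : ∀ j a, y j * ι a = ι a * y j + ι (dy j a)
  w_comm : ∀ i j, Commute (w i) (w j)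
  y_w_comm : ∀ j i, Commute (y j) (w i)
  dw_x : ∀ i j, dw i (x j) = if i = j then 1 else 0
  dy_x : ∀ j i, dy j (x i) = 0
  rho_x_self : ∀ i a, rho i (x i * a) = 0
  rho_x : ∀ i j a, i ≠ j → rho i (x j * a) = x j * rho i a
  rho_div : ∀ i a, ∃ b, a - rho i a = x i * b
  dw_rho_self : ∀ i a, dw i (rho i a) = 0
  dw_rho : ∀ i j a, i ≠ j → dw i (rho j a) = rho j (dw i a)
  dy_rho : ∀ j i a, dy j (rho i a) = rho i (dy j a)
  rho_comm : ∀ i j a, rho i (rho j a) = rho j (rho i a)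
  x_reg : ∀ i a, x i * a = 0 → a = 0
  natCast_isUnit : ∀ d : ℕ, d ≠ 0 → IsUnit (d : O)
  generates : ∀ S : AddSubgroup R, 1 ∈ S → (∀ a, ∀ P ∈ S, ι a * P ∈ S) →
    (∀ i, ∀ P ∈ S, w i * P ∈ S) → (∀ j, ∀ P ∈ S, y j * P ∈ S) → ∀ P, P ∈ S

namespace LogFrame

open Polynomial

variable {R O α κ : Type*} [Ring R] [CommRing O] [DecidableEq α] (L : LogFrame R O α κ)

/-- The operator `w i * x i`. -/
def eul (i : α) : R := L.w i * L.ι (L.x i)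

/-- The ideal generated by the products of `k` distinct coordinates `x i`. -/
def X (k : ℕ) : Ideal O := Ideal.span {a | ∃ J : Finset α, J.card = k ∧ a = ∏ j ∈ J, L.x j}

/-- The left ideal generated by the products of `k + 1` distinct coordinates, the operators
`x o * w o - x i * w i` and the operators `y j`. -/
def I (o : α) (k : ℕ) : Ideal R :=
  Ideal.span ({P | ∃ J : Finset α, J.card = k + 1 ∧ P = L.ι (∏ j ∈ J, L.x j)} ∪
    {P | ∃ i, P = L.ι (L.x o) * L.w o - L.ι (L.x i) * L.w i} ∪ Set.range L.y)

theorem ι_comm (a b : O) : Commute (L.ι a) (L.ι b) := by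
  rw [commute_iff_eq, ← map_mul, ← map_mul, mul_comm]

theorem eul_eq (i : α) : L.eul i = L.ι (L.x i) * L.w i + 1 := by
  rw [eul, L.w_mul, L.dw_x]; simp

theorem commute_w_x {i j : α} (h : i ≠ j) : Commute (L.w i) (L.ι (L.x j)) := by
  rw [commute_iff_eq, L.w_mul, L.dw_x, if_neg h]; simp

theorem commute_y_x (j : κ) (i : α) : Commute (L.y j) (L.ι (L.x i)) := by
  rw [commute_iff_eq, L.y_mul, L.dy_x]; simp

theorem commute_w_of_dw {i : α} {a : O} (h : L.dw i a = 0) : Commute (L.w i) (L.ι a) := by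
  rw [commute_iff_eq, L.w_mul, h]; simp

theorem commute_eul_eul (i j : α) : Commute (L.eul i) (L.eul j) := by
  rcases eq_or_ne i j with rfl | h
  · exact Commute.refl _
  · unfold eul
    refine Commute.mul_left (Commute.mul_right (L.w_comm _ _) (L.commute_w_x h))
      (Commute.mul_right (L.commute_w_x h.symm).symm (L.ι_comm _ _))

theorem commute_y_eul (j : κ) (i : α) : Commute (L.y j) (L.eul i) :=
  Commute.mul_right (L.y_w_comm _ _) (L.commute_y_x _ _)

theorem commute_w_prod {i : α} {J : Finset α} (h : i ∉ J) :
    Commute (L.w i) (L.ι (∏ j ∈ J, L.x j)) := by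
  induction J using Finset.induction_on with
  | empty => simp
  | insert j J hj ih =>
    rw [Finset.prod_insert hj, map_mul]
    simp only [Finset.mem_insert, not_or] at h
    exact Commute.mul_right (L.commute_w_x h.1) (ih h.2)

theorem eul_comm_prod_of_notMem {i : α} {J : Finset α} (h : i ∉ J) :
    L.ι (∏ j ∈ J, L.x j) * L.eul i = L.w i * L.ι (∏ j ∈ insert i J, L.x j) := by
  rw [eul, ← mul_assoc, ← (L.commute_w_prod h).eq, mul_assoc, ← map_mul,
    Finset.prod_insert h, mul_comm]

theorem sub_mem (o : α) (k : ℕ) (i j : α) : L.eul i - L.eul j ∈ L.I o k := by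
  have h : ∀ i, L.eul o - L.eul i ∈ L.I o k := fun i => by
    rw [eul_eq, eul_eq, add_sub_add_right_eq_sub]
    exact Ideal.subset_span (Or.inl (Or.inr ⟨i, rfl⟩))
  have := (L.I o k).sub_mem (h j) (h i)
  simpa using this

theorem y_mem (o : α) (k : ℕ) (j : κ) : L.y j ∈ L.I o k :=
  Ideal.subset_span (Or.inr ⟨j, rfl⟩)

theorem prod_mem_of_le (o : α) {k : ℕ} {J : Finset α} (h : k + 1 ≤ J.card) :
    L.ι (∏ j ∈ J, L.x j) ∈ L.I o k := by
  obtain ⟨J', hJ', hc⟩ := Finset.exists_subset_card_eq h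
  rw [← Finset.prod_sdiff hJ', map_mul]
  exact Ideal.mul_mem_left _ _ (Ideal.subset_span (Or.inl (Or.inl ⟨J', hc, rfl⟩)))

theorem mul_eul_mem {o : α} {k : ℕ} {P : R} (hP : P ∈ L.I o k) : P * L.eul o ∈ L.I o k := by
  induction hP using Submodule.span_induction with
  | zero => simp
  | add P Q _ _ hP hQ => rw [add_mul]; exact Ideal.add_mem _ hP hQ
  | smul a P _ hP => rw [smul_eq_mul, mul_assoc]; exact Ideal.mul_mem_left _ _ hP
  | mem P hP =>
    rcases hP with (⟨J, hJ, rfl⟩ | ⟨i, rfl⟩) | ⟨j, rfl⟩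
    · by_cases ho : o ∈ J
      · have h : L.ι (∏ j ∈ J, L.x j) * L.eul o =
            L.ι (L.x o) * L.w o * L.ι (∏ j ∈ J, L.x j) := by
          rw [← Finset.mul_prod_erase _ _ ho, map_mul, eul,
            (L.ι_comm (L.x o) (∏ j ∈ J.erase o, L.x j)).eq]
          simp only [← mul_assoc]
          rw [(L.ι_comm (L.x o) _).symm.eq, mul_assoc (L.ι (L.x o)) _ (L.w o),
            ← (L.commute_w_prod (Finset.notMem_erase o J)).eq, ← mul_assoc]
        rw [h]
        exact Ideal.mul_mem_left _ _ (L.prod_mem_of_le o hJ.ge)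
      · rw [L.eul_comm_prod_of_notMem ho]
        exact Ideal.mul_mem_left _ _ (L.prod_mem_of_le o
          (by rw [Finset.card_insert_of_notMem ho]; omega))
    · have h : L.ι (L.x o) * L.w o - L.ι (L.x i) * L.w i = L.eul o - L.eul i := by
        rw [eul_eq, eul_eq, add_sub_add_right_eq_sub]
      rw [h, ((L.commute_eul_eul o o).sub_left (L.commute_eul_eul i o)).eq]
      exact Ideal.mul_mem_left _ _ (L.sub_mem o k o i)
    · rw [(L.commute_y_eul j o).eq]
      exact Ideal.mul_mem_left _ _ (L.y_mem o k j)

theorem mul_eul_pow_mem {o : α} {k : ℕ} {P : R} (hP : P ∈ L.I o k) (p : ℕ) :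
    P * L.eul o ^ p ∈ L.I o k := by
  induction p with
  | zero => simpa
  | succ p ih => rw [pow_succ, ← mul_assoc]; exact L.mul_eul_mem ih

theorem X_mono {k l : ℕ} (h : k ≤ l) : L.X l ≤ L.X k := by
  refine Ideal.span_le.2 ?_
  rintro _ ⟨J, hJ, rfl⟩
  obtain ⟨J', hJ', hc⟩ := Finset.exists_subset_card_eq (hJ.symm ▸ h)
  rw [← Finset.prod_sdiff hJ']
  exact Ideal.mul_mem_left _ _ (Ideal.subset_span ⟨J', hc, rfl⟩)

theorem X_zero : L.X 0 = ⊤ :=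
  (Ideal.eq_top_iff_one _).2 (Ideal.subset_span ⟨∅, rfl, by simp⟩)

theorem rho_prod_mul {s : α} {J : Finset α} (h : s ∉ J) (a : O) :
    L.rho s ((∏ j ∈ J, L.x j) * a) = (∏ j ∈ J, L.x j) * L.rho s a := by
  induction J using Finset.induction_on with
  | empty => simp
  | insert j J hj ih =>
    simp only [Finset.mem_insert, not_or] at h
    rw [Finset.prod_insert hj, mul_assoc, L.rho_x _ _ _ h.1, ih h.2, mul_assoc]

theorem rho_mem_X {k : ℕ} {a : O} (ha : a ∈ L.X k) (s : α) : L.rho s a ∈ L.X k := by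
  suffices h : ∀ b, L.rho s (b * a) ∈ L.X k by simpa using h 1
  induction ha using Submodule.span_induction with
  | zero => simp
  | add P Q _ _ hP hQ =>
    intro b; rw [mul_add, map_add]; exact Ideal.add_mem _ (hP b) (hQ b)
  | mem a ha =>
    intro b
    obtain ⟨J, hJ, rfl⟩ := ha
    rw [mul_comm]
    by_cases hs : s ∈ J
    · rw [← Finset.mul_prod_erase _ _ hs, mul_assoc, L.rho_x_self]
      exact Ideal.zero_mem _
    · rw [L.rho_prod_mul hs]
      exact Ideal.mul_mem_right _ _ (Ideal.subset_span ⟨J, hJ, rfl⟩)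
  | smul a P _ hP => intro b; rw [smul_eq_mul, ← mul_assoc]; exact hP _

/-- Multiplication by `eul o` turns a product of `j` coordinates into a product of `j + 1`. -/
theorem mul_eul_pow_mem_of_mem_X [Fintype α] {o : α} {k : ℕ} (hk : k < Fintype.card α) (p : ℕ) {a : O}
    (ha : a ∈ L.X (k + 1 - p)) : L.ι a * L.eul o ^ p ∈ L.I o k := by
  have key : ∀ p (J : Finset α), k + 1 ≤ J.card + p →
      L.ι (∏ j ∈ J, L.x j) * L.eul o ^ p ∈ L.I o k := by
    intro p
    induction p with
    | zero => intro J hJ; simpa using L.prod_mem_of_le o hJ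
    | succ p ih =>
      intro J hJ
      by_cases h : k + 1 ≤ J.card
      · exact L.mul_eul_pow_mem (L.prod_mem_of_le o h) _
      · obtain ⟨i, hi⟩ : ∃ i, i ∉ J := by
          by_contra! hc
          have : J = Finset.univ := Finset.eq_univ_iff_forall.2 hc
          rw [this, Finset.card_univ] at h; omega
        have e : L.ι (∏ j ∈ J, L.x j) * L.eul o ^ (p + 1) =
            L.w i * (L.ι (∏ j ∈ insert i J, L.x j) * L.eul o ^ p) +
              L.ι (∏ j ∈ J, L.x j) * ((L.eul o - L.eul i) * L.eul o ^ p) := by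
          rw [← mul_assoc, ← L.eul_comm_prod_of_notMem hi, sub_mul, mul_sub, pow_succ', mul_assoc,
            add_sub_cancel]
        rw [e]
        refine Ideal.add_mem _ (Ideal.mul_mem_left _ _ (ih _ ?_))
          (Ideal.mul_mem_left _ _ (L.mul_eul_pow_mem (L.sub_mem _ _ _ _) _))
        rw [Finset.card_insert_of_notMem hi]; omega
  induction ha using Submodule.span_induction with
  | zero => simp
  | add P Q _ _ hP hQ => rw [map_add, add_mul]; exact Ideal.add_mem _ hP hQ
  | mem a ha => obtain ⟨J, hJ, rfl⟩ := ha; exact key p J (by omega)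
  | smul a P _ hP => rw [smul_eq_mul, map_mul, mul_assoc]; exact Ideal.mul_mem_left _ _ hP

end LogFrame

end

section

namespace LogFrame

open Polynomial

variable {R O α κ : Type*} [Ring R] [CommRing O] [DecidableEq α] (L : LogFrame R O α κ)

/-! ### Normal forms modulo the left ideal -/

/-- The polynomial `∑ gₚ Xᵖ` evaluated at the operator `eul o`, as `∑ gₚ (eul o)ᵖ`. -/
def ev (o : α) (g : O[X]) : R := g.eval₂ L.ι (L.eul o)

theorem ev_add (o : α) (g h : O[X]) : L.ev o (g + h) = L.ev o g + L.ev o h := eval₂_add _ _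

@[simp] theorem ev_zero (o : α) : L.ev o 0 = 0 := eval₂_zero _ _

@[simp] theorem ev_monomial (o : α) (p : ℕ) (a : O) :
    L.ev o (monomial p a) = L.ι a * L.eul o ^ p := eval₂_monomial _ _

theorem ev_eq_sum (o : α) (g : O[X]) :
    L.ev o g = ∑ p ∈ g.support, L.ι (g.coeff p) * L.eul o ^ p := by
  rw [ev, eval₂_eq_sum, Polynomial.sum]

theorem ev_C_mul (o : α) (a : O) (g : O[X]) : L.ev o (C a * g) = L.ι a * L.ev o g := by
  induction g using Polynomial.induction_on' with
  | add p q hp hq => rw [mul_add, ev_add, hp, hq, ev_add, mul_add]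
  | monomial p b => rw [C_mul_monomial, ev_monomial, ev_monomial, map_mul, mul_assoc]

/-- The polynomials whose coefficients do not depend on the coordinate `x i`. -/
def Fix (i : α) : AddSubgroup O[X] where
  carrier := {g | ∀ p, L.rho i (g.coeff p) = g.coeff p}
  add_mem' := fun {g h} hg hh p => by rw [coeff_add, map_add, hg, hh]
  zero_mem' := fun p => by simp
  neg_mem' := fun {g} hg p => by rw [coeff_neg, map_neg, hg]

theorem monomial_mem_Fix {i : α} {a : O} (h : L.rho i a = a) (p : ℕ) : monomial p a ∈ L.Fix i := by
  intro q
  rw [coeff_monomial]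
  split_ifs
  · exact h
  · simp

theorem X_mul_mem_Fix {i : α} {g : O[X]} (hg : g ∈ L.Fix i) : Polynomial.X * g ∈ L.Fix i := by
  rintro (_ | p)
  · simp
  · rw [coeff_X_mul]; exact hg p

theorem X_sub_mul_mem_Fix {i : α} {g : O[X]} (hg : g ∈ L.Fix i) (r : ℕ) :
    (Polynomial.X - (r : O[X])) * g ∈ L.Fix i := by
  rw [sub_mul, ← nsmul_eq_mul]
  exact (L.Fix i).sub_mem (L.X_mul_mem_Fix hg) ((L.Fix i).nsmul_mem hg r)

theorem C_x_pow_mul_mem_Fix {i s : α} (h : i ≠ s) {g : O[X]} (hg : g ∈ L.Fix i) (e : ℕ) :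
    C (L.x s ^ e) * g ∈ L.Fix i := by
  induction e with
  | zero => simpa
  | succ e ih =>
    intro p
    have := ih p
    rw [coeff_C_mul] at this ⊢
    rw [pow_succ', mul_assoc, L.rho_x _ _ _ h, this]

/-- `∏_{r = 1}^l (X - r)`, the polynomial with `x ^ l * w ^ l = cc l (w * x)`. -/
def cc : ℕ → O[X]
  | 0 => 1
  | l + 1 => cc l * (Polynomial.X - ((l + 1 : ℕ) : O[X]))

theorem cc_mul_mem_Fix {i : α} (l : ℕ) : ∀ {g : O[X]}, g ∈ L.Fix i → cc l * g ∈ L.Fix i := by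
  induction l with
  | zero => intro g hg; simpa [cc]
  | succ l ih => intro g hg; rw [cc, mul_assoc]; exact ih (L.X_sub_mul_mem_Fix hg _)

theorem eul_mul_ev_sub_mem {o s : α} (k : ℕ) {g : O[X]} (hg : g ∈ L.Fix s) :
    L.eul s * L.ev o g - L.ev o (Polynomial.X * g) ∈ L.I o k := by
  have hX : L.ev o (Polynomial.X * g) =
      ∑ p ∈ g.support, L.ι (g.coeff p) * (L.eul o * L.eul o ^ p) := by
    rw [X_mul, ev, eval₂_mul_X, ← ev, ev_eq_sum, Finset.sum_mul]
    simp only [mul_assoc, ← pow_succ, ← pow_succ']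
  rw [hX, ev_eq_sum, Finset.mul_sum, ← Finset.sum_sub_distrib]
  refine Ideal.sum_mem _ fun p _ => ?_
  have hc : Commute (L.eul s) (L.ι (g.coeff p)) := by
    refine Commute.mul_left (L.commute_w_of_dw ?_) (L.ι_comm _ _)
    rw [← hg p, L.dw_rho_self]
  rw [← mul_assoc, hc.eq, mul_assoc, ← mul_sub, ← sub_mul]
  exact Ideal.mul_mem_left _ _ (L.mul_eul_pow_mem (L.sub_mem _ _ _ _) _)

/-- The operator `x s ^ l * w s ^ l` is the polynomial `cc l` in `eul s`. If the coefficients of `g`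
do not depend on `x s`, then `eul s` commutes with them, and can be replaced by `eul o` modulo the
left ideal. -/
theorem x_pow_mul_w_pow_mul_ev_sub_mem {o s : α} (k l : ℕ) :
    ∀ {g : O[X]}, g ∈ L.Fix s →
      L.ι (L.x s) ^ l * L.w s ^ l * L.ev o g - L.ev o (cc l * g) ∈ L.I o k := by
  induction l with
  | zero => intro g _; simp [cc]
  | succ l ih =>
    intro g hg
    have hw : ∀ l : ℕ, L.ι (L.x s) * L.w s * L.w s ^ l = L.w s ^ l * (L.eul s - ((l + 1 : ℕ) : R)) := by
      intro l
      induction l with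
      | zero => rw [eul_eq]; simp
      | succ l ih =>
        rw [pow_succ, ← mul_assoc, ih, mul_assoc, mul_assoc]
        congr 1
        have := L.eul_eq s
        rw [eul] at this
        have e1 : L.w s * (L.ι (L.x s) * L.w s) = L.w s * (L.w s * L.ι (L.x s)) - L.w s := by
          rw [eq_sub_of_add_eq this.symm, mul_sub, mul_one]
        rw [sub_mul, mul_sub, eul, mul_assoc, e1]
        push_cast
        have hn := (Nat.cast_commute l (L.w s)).eq
        simp only [add_mul, mul_add, one_mul, mul_one, hn]
        abel
    have e : L.ι (L.x s) ^ (l + 1) * L.w s ^ (l + 1) * L.ev o g =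
        L.ι (L.x s) ^ l * L.w s ^ l * ((L.eul s - ((l + 1 : ℕ) : R)) * L.ev o g) := by
      rw [pow_succ, pow_succ' (L.w s)]
      simp only [← mul_assoc]
      rw [mul_assoc (L.ι (L.x s) ^ l) _ (L.w s), mul_assoc (L.ι (L.x s) ^ l) _ (L.w s ^ l), hw]
      simp only [← mul_assoc]
    have hn : L.ev o (((l + 1 : ℕ) : O[X]) * g) = ((l + 1 : ℕ) : R) * L.ev o g := by
      rw [← map_natCast C, ev_C_mul, map_natCast]
    have h1 : (L.eul s - ((l + 1 : ℕ) : R)) * L.ev o g -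
        L.ev o ((Polynomial.X - ((l + 1 : ℕ) : O[X])) * g) ∈ L.I o k := by
      have h2 : L.ev o ((Polynomial.X - ((l + 1 : ℕ) : O[X])) * g) =
          L.ev o (Polynomial.X * g) - ((l + 1 : ℕ) : R) * L.ev o g := by
        rw [eq_sub_iff_add_eq, ← hn, ← ev_add, sub_mul, sub_add_cancel]
      rw [h2, sub_mul, sub_sub_sub_cancel_right]
      exact L.eul_mul_ev_sub_mem k hg
    rw [e, cc, mul_assoc (cc l)]
    have := Ideal.add_mem _ (Ideal.mul_mem_left _ (L.ι (L.x s) ^ l * L.w s ^ l) h1)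
      (ih (L.X_sub_mul_mem_Fix hg (l + 1)))
    rwa [mul_sub, sub_add_sub_cancel] at this

variable [Fintype α]

/-- The monomial `∏ (w i) ^ (a i)`. -/
def W (a : α → ℕ) : R :=
  Finset.univ.noncommProd (fun i => L.w i ^ a i)
    fun i _ j _ _ => (L.w_comm i j).pow_pow _ _

theorem commute_W {a : α → ℕ} {P : R} (h : ∀ i, a i ≠ 0 → Commute P (L.w i)) :
    Commute P (L.W a) := by
  refine Finset.noncommProd_commute _ _ _ _ fun i _ => ?_
  by_cases hi : a i = 0
  · simp [hi]
  · exact (h i hi).pow_right _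

@[simp] theorem W_zero : L.W 0 = 1 := by
  have := Finset.noncommProd_eq_pow_card (Finset.univ : Finset α) (fun i => L.w i ^ (0 : ℕ))
    (fun i _ j _ _ => (L.w_comm i j).pow_pow _ _) 1 (by simp)
  rw [one_pow] at this
  exact this

theorem W_eq_pow_mul (a : α → ℕ) (s : α) :
    L.W a = L.w s ^ a s * L.W (Function.update a s 0) := by
  have key : ∀ b : α → ℕ, L.W b = L.w s ^ b s * (Finset.univ.erase s).noncommProd
      (fun i => L.w i ^ b i) fun i _ j _ _ => (L.w_comm i j).pow_pow _ _ := by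
    intro b
    have := Finset.noncommProd_insert_of_notMem (Finset.univ.erase s) s (fun i => L.w i ^ b i)
      (fun i _ j _ _ => (L.w_comm i j).pow_pow _ _) (Finset.notMem_erase _ _)
    rw [← this]
    exact Finset.noncommProd_congr (by simp) (fun _ _ => rfl) _
  rw [key a, key (Function.update a s 0)]
  simp only [Function.update_self, pow_zero, one_mul]
  congr 1
  refine Finset.noncommProd_congr rfl (fun i hi => ?_) _
  rw [Function.update_of_ne (Finset.ne_of_mem_erase hi)]

theorem commute_w_W (s : α) (a : α → ℕ) : Commute (L.w s) (L.W a) :=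
  L.commute_W fun i _ => L.w_comm s i

theorem w_mul_W (s : α) (a : α → ℕ) :
    L.w s * L.W a = L.W (Function.update a s (a s + 1)) := by
  rw [L.W_eq_pow_mul a s, L.W_eq_pow_mul (Function.update a s (a s + 1)) s]
  simp [pow_succ', mul_assoc]

/-- The operator `∑ W a * (c a)(eul o)`. -/
def real (o : α) : ((α → ℕ) →₀ O[X]) →+ R :=
  Finsupp.liftAddHom fun a =>
    { toFun := fun g => L.W a * L.ev o g
      map_zero' := by simp
      map_add' := fun g h => by rw [ev_add, mul_add] }

@[simp] theorem real_single (o : α) (a : α → ℕ) (g : O[X]) :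
    L.real o (Finsupp.single a g) = L.W a * L.ev o g := by simp [real]

/-- The families `c` such that the coefficients of `c a` depend on no `x i` with `a i ≠ 0`. -/
def Norm : AddSubgroup ((α → ℕ) →₀ O[X]) where
  carrier := {c | ∀ a i, a i ≠ 0 → c a ∈ L.Fix i}
  add_mem' := by
    intro c d hc hd a i h
    exact (L.Fix i).add_mem (hc a i h) (hd a i h)
  zero_mem' := by
    intro a i _
    exact (L.Fix i).zero_mem
  neg_mem' := by
    intro c hc a i h
    exact (L.Fix i).neg_mem (hc a i h)

theorem single_mem_Norm {a : α → ℕ} {g : O[X]} (h : ∀ i, a i ≠ 0 → g ∈ L.Fix i) :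
    Finsupp.single a g ∈ L.Norm := by
  intro b i hb
  rw [Finsupp.single_apply]
  split_ifs with hab
  · exact h i (hab ▸ hb)
  · exact (L.Fix i).zero_mem

/-- The operators that are congruent modulo the left ideal to a normal form. -/
def NF (o : α) (k : ℕ) : AddSubgroup R :=
  (L.Norm.map (L.real o)) ⊔ (L.I o k).toAddSubgroup

theorem term_mem_NF {o : α} {k : ℕ} {a : α → ℕ} {b : O} {p : ℕ}
    (h : ∀ i, a i ≠ 0 → L.rho i b = b) : L.W a * (L.ι b * L.eul o ^ p) ∈ L.NF o k := by
  refine AddSubgroup.mem_sup_left ⟨Finsupp.single a (monomial p b),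
    L.single_mem_Norm fun i hi => L.monomial_mem_Fix (h i hi) p, ?_⟩
  simp

theorem I_mem_NF {o : α} {k : ℕ} {P : R} (h : P ∈ L.I o k) : P ∈ L.NF o k :=
  AddSubgroup.mem_sup_right h

theorem mul_mem_NF {o : α} {k : ℕ} {Q : R}
    (h : ∀ (a : α → ℕ) (b : O) (p : ℕ), (∀ i, a i ≠ 0 → L.rho i b = b) →
      Q * (L.W a * (L.ι b * L.eul o ^ p)) ∈ L.NF o k) {P : R} (hP : P ∈ L.NF o k) :
    Q * P ∈ L.NF o k := by
  obtain ⟨_, ⟨c, hc, rfl⟩, P', hP', rfl⟩ := AddSubgroup.mem_sup.1 hP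
  rw [mul_add]
  refine AddSubgroup.add_mem _ ?_ (L.I_mem_NF (Ideal.mul_mem_left _ _ hP'))
  have : L.real o c = ∑ a ∈ c.support, L.W a * L.ev o (c a) := by
    simp [real, Finsupp.liftAddHom, Finsupp.sum]
  rw [this, Finset.mul_sum]
  refine AddSubgroup.sum_mem _ fun a _ => ?_
  rw [ev_eq_sum, Finset.mul_sum, Finset.mul_sum]
  exact AddSubgroup.sum_mem _ fun p _ => h _ _ _ fun i hi => hc a i hi p

theorem w_mul_mem_NF {o : α} {k : ℕ} (i : α) {P : R} (hP : P ∈ L.NF o k) :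
    L.w i * P ∈ L.NF o k := by
  refine L.mul_mem_NF (fun a b p h => ?_) hP
  rw [← mul_assoc, w_mul_W]
  by_cases hi : a i = 0
  · obtain ⟨b', hb'⟩ := L.rho_div i b
    have hb : b = L.rho i b + L.x i * b' := by rw [← hb']; ring
    have hfix : ∀ j, a j ≠ 0 → L.rho j b' = b' := by
      intro j hj
      have hij : j ≠ i := fun e => hj (e ▸ hi)
      have := congrArg (L.rho j) hb'
      rw [map_sub, L.rho_comm, h j hj, L.rho_x _ _ _ hij, hb', ← sub_eq_zero, ← mul_sub] at this
      exact (sub_eq_zero.1 (L.x_reg _ _ this)).symm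
    rw [hb, map_add, add_mul, mul_add]
    refine AddSubgroup.add_mem _ (L.term_mem_NF fun j hj => ?_) ?_
    · rcases eq_or_ne j i with rfl | hij
      · have := congrArg (L.rho j) hb'
        rw [map_sub, L.rho_x_self, sub_eq_zero] at this
        exact this.symm
      · rw [Function.update_of_ne hij] at hj
        rw [L.rho_comm, h j hj]
    · have e : L.w i * (L.ι (L.x i * b') * L.eul o ^ p) =
          L.ι b' * L.eul o ^ (p + 1) + L.ι b' * ((L.eul i - L.eul o) * L.eul o ^ p) +
            L.ι (L.x i * L.dw i b') * L.eul o ^ p := by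
        have e1 : L.w i * L.ι (L.x i * b') = L.ι b' * L.eul i + L.ι (L.x i * L.dw i b') := by
          rw [mul_comm (L.x i) b', map_mul, ← mul_assoc, L.w_mul, add_mul, mul_assoc,
            mul_comm (L.x i), map_mul, eul]
        rw [← mul_assoc, e1, add_mul, ← mul_add, sub_mul, ← pow_succ', add_sub_cancel, mul_assoc]
      rw [← w_mul_W, (L.commute_w_W i a).eq, mul_assoc, e, mul_add, mul_add]
      refine AddSubgroup.add_mem _ (AddSubgroup.add_mem _ (L.term_mem_NF hfix) ?_)
        (L.term_mem_NF fun j hj => ?_)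
      · exact L.I_mem_NF (Ideal.mul_mem_left _ _ (Ideal.mul_mem_left _ _
          (L.mul_eul_pow_mem (L.sub_mem _ _ _ _) _)))
      · have hij : j ≠ i := fun e => hj (e ▸ hi)
        rw [L.rho_x _ _ _ hij, ← L.dw_rho _ _ _ hij.symm, hfix j hj]
  · refine L.term_mem_NF fun j hj => ?_
    rcases eq_or_ne j i with rfl | hij
    · exact h _ hi
    · rw [Function.update_of_ne hij] at hj
      exact h j hj

theorem ι_mul_mem_NF {o : α} {k : ℕ} (f : O) {P : R} (hP : P ∈ L.NF o k) :
    L.ι f * P ∈ L.NF o k := by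
  refine L.mul_mem_NF (fun a b p h => ?_) hP
  induction hn : ∑ i, a i generalizing a f with
  | zero =>
    have ha : a = 0 := by
      funext i
      exact Finset.sum_eq_zero_iff.1 hn i (Finset.mem_univ i)
    subst ha
    rw [W_zero, one_mul, ← mul_assoc, ← map_mul]
    have := L.term_mem_NF (o := o) (k := k) (a := 0) (b := f * b) (p := p) (by simp)
    rwa [W_zero, one_mul] at this
  | succ d ih =>
    obtain ⟨i, hi⟩ : ∃ i, a i ≠ 0 := by
      by_contra! hc
      simp [hc] at hn
    set a' := Function.update a i (a i - 1) with ha'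
    have haa : a = Function.update a' i (a' i + 1) := by
      simp [ha', Nat.sub_add_cancel (Nat.pos_of_ne_zero hi)]
    have hle : ∀ j, a' j ≠ 0 → a j ≠ 0 := by
      intro j hj
      rcases eq_or_ne j i with rfl | hij
      · exact hi
      · rwa [ha', Function.update_of_ne hij] at hj
    have hsum : ∑ i, a' i = d := by
      have h1 := Finset.add_sum_erase Finset.univ a (Finset.mem_univ i)
      have h2 := Finset.add_sum_erase Finset.univ a' (Finset.mem_univ i)
      have h3 : ∑ j ∈ Finset.univ.erase i, a' j = ∑ j ∈ Finset.univ.erase i, a j :=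
        Finset.sum_congr rfl fun j hj => by
          rw [ha', Function.update_of_ne (Finset.ne_of_mem_erase hj)]
      have h4 : a' i = a i - 1 := by simp [ha']
      omega
    have hfix : ∀ j, a' j ≠ 0 → L.rho j b = b := fun j hj => h j (hle j hj)
    rw [haa, ← w_mul_W, mul_assoc (L.w i), ← mul_assoc (L.ι f), eq_sub_of_add_eq (L.w_mul i f).symm, sub_mul,
      mul_assoc (L.w i)]
    exact AddSubgroup.sub_mem _ (L.w_mul_mem_NF i (ih f a' hfix hsum)) (ih _ a' hfix hsum)

theorem y_mul_mem_NF {o : α} {k : ℕ} (j : κ) {P : R} (hP : P ∈ L.NF o k) :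
    L.y j * P ∈ L.NF o k := by
  refine L.mul_mem_NF (fun a b p h => ?_) hP
  rw [← mul_assoc, (L.commute_W fun i _ => L.y_w_comm j i).eq, mul_assoc, ← mul_assoc (L.y j),
    L.y_mul, add_mul, mul_assoc (L.ι b), ((L.commute_y_eul j o).pow_right p).eq, mul_add]
  refine AddSubgroup.add_mem _ (L.I_mem_NF ?_) (L.term_mem_NF fun i hi => ?_)
  · exact Ideal.mul_mem_left _ _ (Ideal.mul_mem_left _ _ (Ideal.mul_mem_left _ _ (L.y_mem _ _ _)))
  · rw [← L.dy_rho, h i hi]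

/-- Every operator is congruent to a normal form: next to a factor `w i`, a coefficient is written
as `rho i b + x i * c`, and `w i * x i = eul i` is replaced by `eul o` modulo the ideal. -/
theorem exists_normal_form (o : α) (k : ℕ) (P : R) :
    ∃ c ∈ L.Norm, P - L.real o c ∈ L.I o k := by
  have h : P ∈ L.NF o k := by
    refine L.generates _ ?_ (fun a P hP => L.ι_mul_mem_NF a hP) (fun i P hP => L.w_mul_mem_NF i hP)
      (fun j P hP => L.y_mul_mem_NF j hP) P
    have := L.term_mem_NF (o := o) (k := k) (a := 0) (b := 1) (p := 0) (by simp)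
    simpa using this
  obtain ⟨_, ⟨c, hc, rfl⟩, P', hP', rfl⟩ := AddSubgroup.mem_sup.1 h
  exact ⟨c, hc, by simpa using hP'⟩

end LogFrame

end

section

namespace LogFrame

open Polynomial

variable {R O α κ : Type*} [Ring R] [CommRing O] [DecidableEq α] (L : LogFrame R O α κ)

/-! ### Vanishing on coordinate strata and the annihilators -/

/-- Abstract properties of the relation "`a` vanishes on the locus where all `x i`, `i ∈ K`,
vanish". -/
structure IsVanishing (Z : Finset α → O → Prop) : Prop where
  empty : ∀ a, Z ∅ a → a = 0
  sub : ∀ K a b, Z K a → Z K b → Z K (a - b)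
  rho : ∀ K s a, Z (insert s K) a → Z K (L.rho s a)
  mono : ∀ K s a, Z K a → Z (insert s K) a
  div : ∀ K s a, s ∉ K → Z K (L.x s * a) → Z K a

variable {L}

/-- A function that vanishes on all strata of codimension `|B| - k` belongs to the ideal generated
by the products of `k + 1` coordinates. -/
theorem IsVanishing.mem_span {Z : Finset α → O → Prop} (hZ : L.IsVanishing Z) (B : Finset α) :
    ∀ k ≤ B.card, ∀ a, (∀ K ⊆ B, K.card + k = B.card → Z K a) →
      a ∈ Ideal.span {a | ∃ J ⊆ B, J.card = k + 1 ∧ a = ∏ j ∈ J, L.x j} := by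
  induction B using Finset.induction_on with
  | empty =>
    intro k hk a ha
    rw [hZ.empty a (ha ∅ (by simp) (by simpa using hk))]
    exact Ideal.zero_mem _
  | insert s B hs ih =>
    intro k hk a ha
    rw [Finset.card_insert_of_notMem hs] at hk ha
    rcases hk.eq_or_lt with rfl | hk
    · rw [hZ.empty a (ha ∅ (by simp) (by simp))]
      exact Ideal.zero_mem _
    have hmono : ∀ l, Ideal.span {a | ∃ J ⊆ B, J.card = l ∧ a = ∏ j ∈ J, L.x j} ≤
        Ideal.span {a | ∃ J ⊆ insert s B, J.card = l ∧ a = ∏ j ∈ J, L.x j} := fun l =>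
      Ideal.span_mono fun _ ⟨J, hJ, h⟩ => ⟨J, hJ.trans (Finset.subset_insert _ _), h⟩
    obtain ⟨b, hb⟩ := L.rho_div s a
    have hab : a = L.rho s a + L.x s * b := by rw [← hb]; ring
    rw [hab]
    refine Ideal.add_mem _ (hmono _ (ih k (by omega) _ fun K hK hc => ?_)) ?_
    · refine hZ.rho _ _ _ (ha _ (Finset.insert_subset_insert _ hK) ?_)
      rw [Finset.card_insert_of_notMem fun h => hs (hK h)]
      omega
    · cases k with
      | zero => 
        exact Ideal.mul_mem_right _ _ (Ideal.subset_span ⟨{s}, by simp, by simp, by simp⟩)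
      | succ k =>
        have hbm := ih k (by omega) b fun K hK hc => by
          have hsK : s ∉ K := fun h => hs (hK h)
          have h1 : Z K a := ha K (hK.trans (Finset.subset_insert _ _)) (by omega)
          refine hZ.div K s b hsK ?_
          rw [← hb]
          exact hZ.sub _ _ _ h1 (hZ.rho _ _ _ (hZ.mono _ _ _ h1))
        clear hab hb
        induction hbm using Submodule.span_induction with
        | zero => simp
        | add P Q _ _ hP hQ => rw [mul_add]; exact Ideal.add_mem _ hP hQ
        | smul a P _ hP => rw [smul_eq_mul, mul_left_comm]; exact Ideal.mul_mem_left _ _ hP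
        | mem b hbm =>
          obtain ⟨J, hJ, hc, rfl⟩ := hbm
          have hsJ : s ∉ J := fun h => hs (hJ h)
          exact Ideal.subset_span ⟨insert s J, Finset.insert_subset_insert _ hJ,
            by rw [Finset.card_insert_of_notMem hsJ, hc], by rw [Finset.prod_insert hsJ]⟩

/-- Cancellation of the factor `cc l`, whose constant coefficient is a unit. -/
theorem coeff_mem_X_of_cc_mul {k : ℕ} (l : ℕ) : ∀ {g : O[X]},
    (∀ p, (cc l * g).coeff p ∈ L.X (k + 1 - p)) → ∀ p, g.coeff p ∈ L.X (k + 1 - p) := by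
  induction l with
  | zero => intro g h; simpa [cc] using h
  | succ l ih =>
    intro g h
    rw [cc, mul_assoc] at h
    have h1 := ih h
    obtain ⟨r, hr⟩ := L.natCast_isUnit (l + 1) (by omega)
    intro p
    induction p with
    | zero =>
      have := h1 0
      rw [← map_natCast C, sub_mul, coeff_sub, coeff_C_mul] at this
      simp only [mul_coeff_zero, coeff_X_zero, zero_mul, zero_sub, neg_mem_iff] at this
      rw [← hr] at this
      simpa using Ideal.mul_mem_left _ (↑r⁻¹ : O) this
    | succ p ihp =>
      have := h1 (p + 1)
      rw [← map_natCast C, sub_mul, coeff_sub, coeff_C_mul, coeff_X_mul] at this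
      have h2 := (Submodule.sub_mem_iff_right _ (L.X_mono (show k + 1 - (p + 1) ≤ k + 1 - p by omega) ihp)).1 this
      rw [← hr] at h2
      simpa using Ideal.mul_mem_left _ (↑r⁻¹ : O) h2

/-- The normal form of `x s ^ D * real o c`. -/
def lower (L : LogFrame R O α κ) (s : α) (D : ℕ) :
    ((α → ℕ) →₀ O[X]) →+ ((α → ℕ) →₀ O[X]) :=
  Finsupp.liftAddHom fun a =>
    { toFun := fun g =>
        Finsupp.single (Function.update a s 0) (C (L.x s ^ (D - a s)) * (cc (a s) * g))
      map_zero' := by simp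
      map_add' := fun g h => by rw [mul_add, mul_add, Finsupp.single_add] }

theorem lower_eq_sum (s : α) (D : ℕ) (c : (α → ℕ) →₀ O[X]) :
    L.lower s D c = ∑ a ∈ c.support, Finsupp.single (Function.update a s 0)
      (C (L.x s ^ (D - a s)) * (cc (a s) * c a)) := by
  simp [lower, Finsupp.liftAddHom, Finsupp.sum]

variable [Fintype α]

/-- The case `B = univ` of `IsVanishing.mem_span`, stated with the complementary sets of indices. -/
theorem IsVanishing.mem_X {Z : Finset α → O → Prop} (hZ : L.IsVanishing Z) {k : ℕ}
    (hk : k < Fintype.card α) {a : O} (h : ∀ J : Finset α, J.card = k → Z Jᶜ a) :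
    a ∈ L.X (k + 1) := by
  have := hZ.mem_span Finset.univ k (by rw [Finset.card_univ]; omega) a fun K _ hK => by
    have := h Kᶜ (by rw [Finset.card_compl, ← Finset.card_univ]; omega)
    rwa [compl_compl] at this
  refine Ideal.span_mono ?_ this
  rintro _ ⟨J, -, hJ, rfl⟩
  exact ⟨J, hJ, rfl⟩

variable {Z : Finset α → O → Prop} {N : ℕ → Ideal R} {o : α}

/-- The case of operators of the form `∑ gₚ (eul o)ᵖ`. -/
theorem coeff_mem_X_of_ev_mem (hZ : L.IsVanishing Z)
    (hI : ∀ k < Fintype.card α, L.I o k ≤ N k)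
    (hE : ∀ k P, k + 1 < Fintype.card α → P * L.eul o ∈ N (k + 1) → P ∈ N k)
    (hNZ : ∀ k < Fintype.card α, ∀ (J : Finset α) (a : O), J.card = k →
      L.ι (a * ∏ j ∈ J, L.x j) ∈ N k → Z Jᶜ a) :
    ∀ k < Fintype.card α, ∀ g : O[X], L.ev o g ∈ N k → ∀ p, g.coeff p ∈ L.X (k + 1 - p) := by
  have key : ∀ k < Fintype.card α, ∀ g : O[X], L.ev o g ∈ N k → g.coeff 0 ∈ L.X (k + 1) := by
    intro k hk g hg
    refine hZ.mem_X hk fun J hJ => hNZ k hk J _ hJ ?_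
    -- Multiplication by the product over `J` kills all the terms with `p ≥ 1`.
    have h1 : L.ι (∏ j ∈ J, L.x j) * L.ev o (g - C (g.coeff 0)) ∈ L.I o k := by
      rw [ev_eq_sum, Finset.mul_sum]
      refine Ideal.sum_mem _ fun p hp => ?_
      have hp0 : p ≠ 0 := by rintro rfl; simp at hp
      rw [← mul_assoc, ← map_mul]
      refine L.mul_eul_pow_mem_of_mem_X hk p (L.X_mono (show k + 1 - p ≤ k by omega) ?_)
      exact Ideal.mul_mem_right _ _ (Ideal.subset_span ⟨J, hJ, rfl⟩)
    have h2 : L.ev o g = L.ev o (g - C (g.coeff 0)) + L.ι (g.coeff 0) := by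
      have := L.ev_add o (g - C (g.coeff 0)) (C (g.coeff 0))
      rwa [sub_add_cancel, ← monomial_zero_left, ev_monomial, pow_zero, mul_one] at this
    have h3 := Ideal.mul_mem_left _ (L.ι (∏ j ∈ J, L.x j)) hg
    rw [h2, mul_add, ← map_mul] at h3
    rw [mul_comm]
    exact (Ideal.add_mem_iff_right _ (hI k hk h1)).1 h3
  intro k
  induction k with
  | zero =>
    intro hk g hg p
    rcases p with _ | p
    · exact key 0 hk g hg
    · simp [X_zero]
  | succ k ih =>
    intro hk g hg p
    rcases p with _ | p
    · exact key _ hk g hg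
    have h0 := L.mul_eul_pow_mem_of_mem_X (o := o) hk 0 (key _ hk g hg)
    rw [pow_zero, mul_one] at h0
    have h2 : L.ev o g = L.ev o g.divX * L.eul o + L.ι (g.coeff 0) := by
      conv_lhs => rw [← divX_mul_X_add g, ev_add, ← monomial_zero_left, ev_monomial, pow_zero, mul_one]
      rw [ev, eval₂_mul_X, ← ev]
    rw [h2] at hg
    have := ih (by omega) g.divX (hE k _ hk ((Ideal.add_mem_iff_left _ (hI _ hk h0)).1 hg)) p
    rw [coeff_divX] at this
    rwa [show k + 1 + 1 - (p + 1) = k + 1 - p by omega]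

theorem real_eq_sum (c : (α → ℕ) →₀ O[X]) :
    L.real o c = ∑ a ∈ c.support, L.W a * L.ev o (c a) := by
  simp [real, Finsupp.liftAddHom, Finsupp.sum]

/-- Multiplication by `x s ^ D` removes `w s` from a normal form of degree at most `D` in `w s`. -/
theorem x_pow_mul_real_sub_mem {s : α} {D k : ℕ} {c : (α → ℕ) →₀ O[X]} (hc : c ∈ L.Norm)
    (hD : ∀ a ∈ c.support, a s ≤ D) :
    L.ι (L.x s) ^ D * L.real o c - L.real o (L.lower s D c) ∈ L.I o k := by
  rw [lower_eq_sum, map_sum, real_eq_sum, Finset.mul_sum, ← Finset.sum_sub_distrib]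
  refine Ideal.sum_mem _ fun a ha => ?_
  rw [real_single, ev_C_mul, L.W_eq_pow_mul a s, (((L.commute_w_W s _).pow_left (a s))).eq]
  have hcomm : Commute (L.ι (L.x s) ^ D) (L.W (Function.update a s 0)) :=
    L.commute_W fun i hi => by
      have his : i ≠ s := by rintro rfl; simp at hi
      exact ((L.commute_w_x his).symm).pow_left D
  rw [mul_assoc, ← mul_assoc, hcomm.eq, mul_assoc, ← mul_sub]
  refine Ideal.mul_mem_left _ _ ?_
  have h1 : L.ι (L.x s) ^ D = L.ι (L.x s ^ (D - a s)) * L.ι (L.x s) ^ a s := by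
    rw [map_pow, ← pow_add, Nat.sub_add_cancel (hD a ha)]
  rw [h1, mul_assoc, ← mul_sub, ← mul_assoc]
  refine Ideal.mul_mem_left _ _ ?_
  by_cases h0 : a s = 0
  · simp [h0, cc]
  · exact L.x_pow_mul_w_pow_mul_ev_sub_mem k (a s) (hc a s h0)

theorem lower_mem_Norm {s : α} {D : ℕ} {c : (α → ℕ) →₀ O[X]} (hc : c ∈ L.Norm) :
    L.lower s D c ∈ L.Norm := by
  rw [lower_eq_sum]
  refine AddSubgroup.sum_mem _ fun a _ => L.single_mem_Norm fun i hi => ?_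
  have his : i ≠ s := by rintro rfl; simp at hi
  rw [Function.update_of_ne his] at hi
  exact L.C_x_pow_mul_mem_Fix his (L.cc_mul_mem_Fix _ (hc a i hi)) _

/-- Restricting `lower s D c` to `x s = 0` leaves the terms of top degree `D` in `w s`. -/
theorem rho_coeff_lower {s : α} {D : ℕ} (hD0 : D ≠ 0) {c : (α → ℕ) →₀ O[X]} (hc : c ∈ L.Norm)
    (hD : ∀ a ∈ c.support, a s ≤ D) {b : α → ℕ} (hb : b s = D) (p : ℕ) :
    L.rho s ((L.lower s D c (Function.update b s 0)).coeff p) = (cc D * c b).coeff p := by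
  rw [lower_eq_sum, Finsupp.finsetSum_apply, finsetSum_coeff, map_sum]
  rw [Finset.sum_eq_single b]
  · rw [Finsupp.single_eq_same, hb, Nat.sub_self, pow_zero, map_one, one_mul]
    exact L.cc_mul_mem_Fix _ (hc b s (by omega)) p
  · intro a ha hab
    rw [Finsupp.single_apply]
    split_ifs with h
    · have has : a s < D := by
        refine lt_of_le_of_ne (hD a ha) fun e => hab ?_
        funext i
        rcases eq_or_ne i s with rfl | hi
        · rw [e, hb]
        · have := congrFun h i
          rwa [Function.update_of_ne hi, Function.update_of_ne hi] at this
      obtain ⟨e, he⟩ : ∃ e, D - a s = e + 1 := ⟨D - a s - 1, by omega⟩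
      rw [coeff_C_mul, he, pow_succ', mul_assoc, L.rho_x_self]
    · simp
  · intro hb'
    rw [Finsupp.notMem_support_iff.1 hb']
    simp

/-- Normal forms with coefficients in the expected ideals belong to `I o k`; the converse, which is
the content of the criterion below, rests on the analytic hypotheses. -/
theorem real_mem_I {k : ℕ} (hk : k < Fintype.card α) {c : (α → ℕ) →₀ O[X]}
    (h : ∀ a p, (c a).coeff p ∈ L.X (k + 1 - p)) : L.real o c ∈ L.I o k := by
  rw [real_eq_sum]
  refine Ideal.sum_mem _ fun a _ => Ideal.mul_mem_left _ _ ?_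
  rw [ev_eq_sum]
  exact Ideal.sum_mem _ fun p _ => L.mul_eul_pow_mem_of_mem_X hk p (h a p)

/-- A normal form that belongs to `N k` has its coefficients in the expected ideals. The proof is by
induction on the set `A` of variables `w i` that occur, and on the degree in one of them. -/
theorem coeff_mem_X_of_real_mem (hZ : L.IsVanishing Z)
    (hI : ∀ k < Fintype.card α, L.I o k ≤ N k)
    (hE : ∀ k P, k + 1 < Fintype.card α → P * L.eul o ∈ N (k + 1) → P ∈ N k)
    (hNZ : ∀ k < Fintype.card α, ∀ (J : Finset α) (a : O), J.card = k →
      L.ι (a * ∏ j ∈ J, L.x j) ∈ N k → Z Jᶜ a) {k : ℕ} (hk : k < Fintype.card α) (A : Finset α) :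
    ∀ c : (α → ℕ) →₀ O[X], c ∈ L.Norm → (∀ a ∈ c.support, ∀ i, a i ≠ 0 → i ∈ A) →
      L.real o c ∈ N k → ∀ a p, (c a).coeff p ∈ L.X (k + 1 - p) := by
  induction A using Finset.induction_on with
  | empty =>
    intro c _ hA hN a p
    have h0 : c = Finsupp.single 0 (c 0) := by
      ext1 b
      rw [Finsupp.single_apply]
      split_ifs with hb
      · rw [hb]
      · by_contra hcb
        refine hb (funext fun i => ?_)
        by_contra hi
        exact absurd (hA b (Finsupp.mem_support_iff.2 hcb) i (Ne.symm hi)) (by simp)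
    rw [h0, real_single, W_zero, one_mul] at hN
    have := coeff_mem_X_of_ev_mem hZ hI hE hNZ k hk _ hN p
    rw [h0, Finsupp.single_apply]
    split_ifs
    · exact this
    · simp
  | insert s A hs ih =>
    suffices H : ∀ D, ∀ c : (α → ℕ) →₀ O[X], c ∈ L.Norm →
        (∀ a ∈ c.support, ∀ i, a i ≠ 0 → i ∈ insert s A) → (∀ a ∈ c.support, a s ≤ D) →
        L.real o c ∈ N k → ∀ a p, (c a).coeff p ∈ L.X (k + 1 - p) from
      fun c hc hA hN => H (c.support.sup fun a => a s) c hc hA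
        (fun a ha => Finset.le_sup (f := fun a : α → ℕ => a s) ha) hN
    intro D
    induction D with
    | zero =>
      intro c hc hA hD hN
      refine ih c hc (fun a ha i hi => ?_) hN
      refine Finset.mem_of_mem_insert_of_ne (hA a ha i hi) ?_
      rintro rfl
      exact hi (Nat.le_zero.1 (hD a ha))
    | succ D ihD =>
      intro c hc hA hD hN
      have hlow : L.real o (L.lower s (D + 1) c) ∈ N k := by
        have h1 := hI k hk (L.x_pow_mul_real_sub_mem (o := o) (k := k) hc hD)
        exact ((Submodule.sub_mem_iff_right _ (Ideal.mul_mem_left _ _ hN)).1 h1)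
      have hX := ih _ (lower_mem_Norm hc) (fun a ha i hi => ?_) hlow
      swap
      · rw [lower_eq_sum] at ha
        obtain ⟨b, hb, hab⟩ := Finset.mem_biUnion.1 (Finsupp.support_finsetSum ha)
        have := Finsupp.support_single_subset hab
        rw [Finset.mem_singleton] at this
        subst this
        have his : i ≠ s := by rintro rfl; simp at hi
        rw [Function.update_of_ne his] at hi
        exact Finset.mem_of_mem_insert_of_ne (hA b hb i hi) his
      have htop : ∀ b : α → ℕ, b s = D + 1 → ∀ p, (c b).coeff p ∈ L.X (k + 1 - p) := by
        intro b hb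
        refine coeff_mem_X_of_cc_mul (D + 1) fun p => ?_
        rw [← rho_coeff_lower (by omega) hc hD hb]
        exact L.rho_mem_X (hX _ _) s
      set c₁ := c.filter fun a => a s = D + 1 with hc₁
      set c₂ := c.filter fun a => ¬ a s = D + 1 with hc₂
      have hsum : c₁ + c₂ = c := Finsupp.filter_add_filter_not _ _
      have hN₁ : L.real o c₁ ∈ N k := hI k hk (real_mem_I hk fun a p => by
        rw [hc₁, Finsupp.filter_apply]
        split_ifs with h
        · exact htop a h p
        · simp)
      have hN₂ : L.real o c₂ ∈ N k := by
        rw [← hsum, map_add] at hN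
        exact (Ideal.add_mem_iff_right _ hN₁).1 hN
      have hsupp : ∀ a ∈ c₂.support, a ∈ c.support ∧ a s ≠ D + 1 := fun a ha => by
        rw [hc₂, Finsupp.support_filter, Finset.mem_filter] at ha
        exact ha
      have h₂ := ihD c₂ (fun a i hi => by
          rw [hc₂, Finsupp.filter_apply]
          split_ifs
          · exact (L.Fix i).zero_mem
          · exact hc a i hi)
        (fun a ha => hA a (hsupp a ha).1)
        (fun a ha => by have := hD a (hsupp a ha).1; have := (hsupp a ha).2; omega) hN₂
      intro a p
      by_cases h : a s = D + 1
      · exact htop a h p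
      · have := h₂ a p
        rwa [hc₂, Finsupp.filter_apply, if_pos h] at this

/-- **Algebraic criterion.** Left ideals that contain the ideals `I o k`, that are compatible with
right multiplication by the operator `eul o`, and in which the functions `a * ∏ x j` are only the
expected ones, are contained in the ideals `I o k`. -/
theorem le_I (hZ : L.IsVanishing Z)
    (hI : ∀ k < Fintype.card α, L.I o k ≤ N k)
    (hE : ∀ k P, k + 1 < Fintype.card α → P * L.eul o ∈ N (k + 1) → P ∈ N k)
    (hNZ : ∀ k < Fintype.card α, ∀ (J : Finset α) (a : O), J.card = k →
      L.ι (a * ∏ j ∈ J, L.x j) ∈ N k → Z Jᶜ a) {k : ℕ} (hk : k < Fintype.card α) :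
    N k ≤ L.I o k := by
  intro P hP
  obtain ⟨c, hc, hPc⟩ := L.exists_normal_form o k P
  have h1 : L.real o c ∈ N k := (Submodule.sub_mem_iff_right _ hP).1 (hI k hk hPc)
  have h2 := real_mem_I (o := o) hk (coeff_mem_X_of_real_mem hZ hI hE hNZ hk Finset.univ c hc
    (fun _ _ i _ => Finset.mem_univ i) h1)
  simpa using Ideal.add_mem _ hPc h2

end LogFrame

end

section

/-! ### Division of analytic functions -/

section Division

variable {E F : Type*} [NormedAddCommGroup E] [NormedSpace ℝ E] [NormedAddCommGroup F]
  [NormedSpace ℝ F]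

/-- The difference of a multilinear map on two diagonal arguments, as a telescoping sum. -/
theorem multilinear_diag_sub {d : ℕ} (p : ContinuousMultilinearMap ℝ (fun _ : Fin (d + 1) => E) F)
    (x z : E) : p (fun _ => x) - p (fun _ => z) =
      ∑ j : Fin (d + 1), p (j.insertNth (x - z) fun i => if i.castSucc < j then x else z) := by
  set G : ℕ → F := fun j => p fun i => if (i : ℕ) < j then x else z with hG
  have h1 : p (fun _ => x) - p (fun _ => z) = ∑ j ∈ Finset.range (d + 1), (G (j + 1) - G j) := by
    rw [Finset.sum_range_sub, hG]
    congr 1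
    congr 1
    funext i
    rw [if_pos i.isLt]
  rw [h1, Finset.sum_range]
  refine Finset.sum_congr rfl fun j _ => ?_
  have h2 : ∀ u : E, j.insertNth (α := fun _ => E) u (fun i => if i.castSucc < j then x else z) =
      Function.update (fun i : Fin (d + 1) => if (i : ℕ) < j then x else z) j u := by
    intro u
    funext i
    rcases eq_or_ne i j with rfl | hij
    · simp
    · obtain ⟨i, rfl⟩ := Fin.exists_succAbove_eq hij
      rw [Fin.insertNth_apply_succAbove, Function.update_of_ne hij]
      by_cases h : i.castSucc < j
      · rw [if_pos h, Fin.succAbove_of_castSucc_lt _ _ h, if_pos (by simpa [Fin.lt_def] using h)]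
      · rw [if_neg h, Fin.succAbove_of_le_castSucc _ _ (not_lt.1 h), if_neg]
        rw [not_lt, Fin.le_def] at h
        simp at h ⊢
        omega
  rw [h2, ContinuousMultilinearMap.map_update_sub]
  congr 1
  · refine congrArg p (funext fun i => ?_)
    rcases eq_or_ne i j with rfl | hij
    · simp
    · rw [Function.update_of_ne hij]
      have : (i : ℕ) ≠ j := fun h => hij (Fin.ext h)
      congr 1
      simp only [eq_iff_iff]
      omega
  · refine congrArg p (funext fun i => ?_)
    rcases eq_or_ne i j with rfl | hij
    · simp
    · rw [Function.update_of_ne hij]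

/-- **Division by a coordinate.** If `π` is the projection onto a hyperplane and `ℓ` the
complementary coordinate, then `a - a ∘ π` is divisible by `ℓ` in the ring of analytic germs. -/
theorem exists_analyticAt_div [CompleteSpace F] {a : E → F} (ha : AnalyticAt ℝ a 0) (π : E →L[ℝ] E)
    (ℓ : E →L[ℝ] ℝ) (e : E) (hπ : ∀ x, x - π x = ℓ x • e) :
    ∃ b : E → F, AnalyticAt ℝ b 0 ∧ ∀ᶠ x in 𝓝 0, a x - a (π x) = ℓ x • b x := by
  obtain ⟨p, hp⟩ := ha
  set L : ∀ d, Fin (d + 1) → Fin d → E →L[ℝ] E :=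
    fun d j i => if i.castSucc < j then ContinuousLinearMap.id ℝ E else π with hL
  set q : FormalMultilinearSeries ℝ E F := fun d => ∑ j : Fin (d + 1),
    ((p (d + 1)).curryMid j e).compContinuousLinearMap (L d j) with hq
  have hqx : ∀ d x, ℓ x • q d (fun _ => x) =
      p (d + 1) (fun _ => x) - p (d + 1) (fun _ => π x) := by
    intro d x
    rw [multilinear_diag_sub, hq]
    rw [sum_apply, Finset.smul_sum]
    refine Finset.sum_congr rfl fun j _ => ?_
    have h1 : ∀ u : E, ((p (d + 1)).curryMid j u).compContinuousLinearMap (L d j) (fun _ => x) =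
        p (d + 1) (j.insertNth u fun i => if i.castSucc < j then x else π x) := by
      intro u
      rw [ContinuousMultilinearMap.compContinuousLinearMap_apply]
      have : (fun i => L d j i x) = fun i => if i.castSucc < j then x else π x := by
        funext i
        simp only [hL]
        split_ifs <;> rfl
      rw [this]
      rfl
    rw [← h1, hπ, map_smul]
    rfl
  obtain ⟨r, hr0, hr⟩ : ∃ r : NNReal, 0 < r ∧ (r : ENNReal) < p.radius :=
    ENNReal.lt_iff_exists_nnreal_btwn.1 hp.radius_pos |>.imp fun r hr =>
      ⟨by exact_mod_cast hr.1, hr.2⟩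
  obtain ⟨C, hC, hpC⟩ := p.norm_le_div_pow_of_pos_of_lt_radius hr0 hr
  set M := max 1 ‖π‖ with hM
  have hM1 : 1 ≤ M := le_max_left _ _
  have hqn : ∀ d, ‖q d‖ ≤ (d + 1) * (C / r ^ (d + 1) * ‖e‖ * M ^ d) := by
    intro d
    have h1 : ∀ j : Fin (d + 1), ‖((p (d + 1)).curryMid j e).compContinuousLinearMap (L d j)‖ ≤
        C / r ^ (d + 1) * ‖e‖ * M ^ d := by
      intro j
      refine (ContinuousMultilinearMap.norm_compContinuousLinearMap_le _ _).trans ?_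
      have hprod : ∏ i, ‖L d j i‖ ≤ M ^ d := by
        have : ∏ i, ‖L d j i‖ ≤ ∏ _i : Fin d, M := by
          refine Finset.prod_le_prod (fun _ _ => norm_nonneg _) fun i _ => ?_
          simp only [hL]
          split_ifs
          · exact ContinuousLinearMap.norm_id_le.trans hM1
          · exact le_max_right _ _
        simpa using this
      have h2 : ‖(p (d + 1)).curryMid j e‖ ≤ C / r ^ (d + 1) * ‖e‖ := by
        refine (ContinuousLinearMap.le_opNorm _ _).trans ?_
        rw [ContinuousMultilinearMap.norm_curryMid]
        gcongr
        exact hpC _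
      gcongr
    calc ‖q d‖ ≤ ∑ j : Fin (d + 1), ‖((p (d + 1)).curryMid j e).compContinuousLinearMap (L d j)‖ :=
          norm_sum_le _ _
      _ ≤ ∑ _j : Fin (d + 1), C / r ^ (d + 1) * ‖e‖ * M ^ d := Finset.sum_le_sum fun j _ => h1 j
      _ = _ := by simp
  have hrad : 0 < q.radius := by
    set ρ : NNReal := r / (2 * ⟨M, by positivity⟩) with hρ
    have hρ' : (ρ : ℝ) = r / (2 * M) := by rw [hρ]; push_cast; rfl
    have hρ0 : (0 : ENNReal) < ρ := by
      have : (0 : ℝ) < ρ := by rw [hρ']; positivity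
      exact_mod_cast this
    refine hρ0.trans_le (q.le_radius_of_bound (C / r * ‖e‖) fun d => ?_)
    have h2 : ((d : ℝ) + 1) ≤ 2 ^ d := by exact_mod_cast Nat.lt_two_pow_self
    have hr0' : (0 : ℝ) < r := hr0
    calc ‖q d‖ * (ρ : ℝ) ^ d ≤ (2 ^ d * (C / r ^ (d + 1) * ‖e‖ * M ^ d)) * (r / (2 * M)) ^ d := by
          rw [hρ']
          gcongr
          exact (hqn d).trans (by gcongr)
      _ = C / r * ‖e‖ := by
          rw [div_pow, mul_pow]
          field_simp
          ring
  refine ⟨q.sum, (q.hasFPowerSeriesOnBall hrad).analyticAt, ?_⟩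
  have e1 := hp.eventually_hasSum
  have e2 : ∀ᶠ x in 𝓝 (0 : E), HasSum (fun n => p n fun _ => π x) (a (0 + π x)) :=
    (π.continuous.tendsto' 0 0 (map_zero _)).eventually e1
  have e3 := (q.hasFPowerSeriesOnBall hrad).hasFPowerSeriesAt.eventually_hasSum
  filter_upwards [e1, e2, e3] with x h1 h2 h3
  rw [zero_add] at h1 h2 h3
  have h4 := h1.sub h2
  have h5 := (hasSum_nat_add_iff' 1).2 h4
  have h6 := h3.const_smul (ℓ x)
  simp only [hqx] at h6
  have := h5.unique h6
  rw [← this]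
  have : p 0 (fun _ => x) = p 0 (fun _ => π x) := by congr 1; funext i; exact i.elim0
  simp [this]

end Division

end

section

/-! ### Germs of functions and first order operators -/

variable {n : ℕ}

theorem AnalyticGerm.mk_eq_iff {h k : (Fin n → ℝ) → ℂ} {hh : AnalyticAt ℝ h 0}
    {hk : AnalyticAt ℝ k 0} : AnalyticGerm.mk h hh = AnalyticGerm.mk k hk ↔ h =ᶠ[𝓝 0] k :=
   Subtype.ext_iff.trans Germ.coe_eq

theorem AnalyticGerm.exists_mk (a : AnalyticGerm n) :
    ∃ (h : (Fin n → ℝ) → ℂ) (hh : AnalyticAt ℝ h 0), a = AnalyticGerm.mk h hh := by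
  obtain ⟨_, h, hh, rfl⟩ := a
  exact ⟨h, hh, rfl⟩

theorem AnalyticGerm.mk_add {h k : (Fin n → ℝ) → ℂ} (hh : AnalyticAt ℝ h 0)
    (hk : AnalyticAt ℝ k 0) : AnalyticGerm.mk h hh + AnalyticGerm.mk k hk =
      AnalyticGerm.mk (fun x => h x + k x) (hh.add hk) := rfl

theorem AnalyticGerm.mk_mul {h k : (Fin n → ℝ) → ℂ} (hh : AnalyticAt ℝ h 0)
    (hk : AnalyticAt ℝ k 0) : AnalyticGerm.mk h hh * AnalyticGerm.mk k hk =
      AnalyticGerm.mk (fun x => h x * k x) (hh.mul hk) := rfl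

theorem AnalyticGerm.mk_prod {ι : Type*} (J : Finset ι) (h : ι → (Fin n → ℝ) → ℂ)
    (hh : ∀ i, AnalyticAt ℝ (h i) 0) : ∏ i ∈ J, AnalyticGerm.mk (h i) (hh i) =
      AnalyticGerm.mk (fun x => ∏ i ∈ J, h i x)
        (Finset.analyticAt_fun_prod J fun i _ => hh i) := by
  classical
  induction J using Finset.induction_on with
  | empty => simp; rfl
  | insert i J hi ih =>
    rw [Finset.prod_insert hi, ih, AnalyticGerm.mk_mul]
    simp only [Finset.prod_insert hi]

theorem AnalyticGerm.mk_sum {ι : Type*} (J : Finset ι) (h : ι → (Fin n → ℝ) → ℂ)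
    (hh : ∀ i, AnalyticAt ℝ (h i) 0) : ∑ i ∈ J, AnalyticGerm.mk (h i) (hh i) =
      AnalyticGerm.mk (fun x => ∑ i ∈ J, h i x)
        (Finset.analyticAt_fun_sum J fun i _ => hh i) := by
  classical
  induction J using Finset.induction_on with
  | empty => simp; rfl
  | insert i J hi ih =>
    rw [Finset.sum_insert hi, ih, AnalyticGerm.mk_add]
    simp only [Finset.sum_insert hi]

/-- The value at `0` of an analytic germ. -/
def AnalyticGerm.eval0 (n : ℕ) : AnalyticGerm n →+* ℂ :=
  Germ.valueRingHom.comp (AnalyticGerm n).subtype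

theorem AnalyticGerm.eval0_mk {h : (Fin n → ℝ) → ℂ} (hh : AnalyticAt ℝ h 0) :
    AnalyticGerm.eval0 n (AnalyticGerm.mk h hh) = h 0 := rfl

theorem AnalyticGerm.isUnit_of_eval0_ne_zero {a : AnalyticGerm n}
    (ha : AnalyticGerm.eval0 n a ≠ 0) : IsUnit a := by
  obtain ⟨h, hh, rfl⟩ := AnalyticGerm.exists_mk a
  rw [AnalyticGerm.eval0_mk] at ha
  refine IsUnit.of_mul_eq_one (AnalyticGerm.mk (fun x => (h x)⁻¹) (hh.inv ha)) ?_
  rw [AnalyticGerm.mk_mul]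
  change _ = AnalyticGerm.mk (fun _ => 1) analyticAt_const
  rw [AnalyticGerm.mk_eq_iff]
  filter_upwards [hh.continuousAt.eventually_ne ha] with x hx
  exact mul_inv_cancel₀ hx

/-- The action of differential operators on analytic germs. -/
def dact (P : DiffOpGerm n) : AnalyticGerm n →+ AnalyticGerm n := P.1

theorem DiffOpGerm.ext_act {P Q : DiffOpGerm n} (h : ∀ a, dact P a = dact Q a) : P = Q :=
  Subtype.ext (AddMonoidHom.ext h)

@[simp] theorem dact_mul (P Q : DiffOpGerm n) (a : AnalyticGerm n) :
    dact (P * Q) a = dact P (dact Q a) := rfl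

@[simp] theorem dact_add (P Q : DiffOpGerm n) (a : AnalyticGerm n) :
    dact (P + Q) a = dact P a + dact Q a := rfl

@[simp] theorem dact_one (a : AnalyticGerm n) : dact (1 : DiffOpGerm n) a = a := rfl

@[simp] theorem dact_zero (a : AnalyticGerm n) : dact (0 : DiffOpGerm n) a = 0 := rfl

theorem dact_sum {ι : Type*} (J : Finset ι) (P : ι → DiffOpGerm n) (a : AnalyticGerm n) :
    dact (∑ i ∈ J, P i) a = ∑ i ∈ J, dact (P i) a := by
  classical
  induction J using Finset.induction_on with
  | empty => simp
  | insert i J hi ih => rw [Finset.sum_insert hi, Finset.sum_insert hi, dact_add, ih]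

/-- Functions as operators of order zero. -/
def DiffOpGerm.ofGerm (n : ℕ) : AnalyticGerm n →+* DiffOpGerm n where
  toFun a := ⟨AddMonoidHom.mulLeft a, Subring.subset_closure (Or.inl ⟨a, rfl⟩)⟩
  map_one' := by apply DiffOpGerm.ext_act; intro b; exact one_mul b
  map_zero' := by apply DiffOpGerm.ext_act; intro b; exact zero_mul b
  map_add' a b := by apply DiffOpGerm.ext_act; intro c; exact add_mul a b c
  map_mul' a b := by apply DiffOpGerm.ext_act; intro c; exact mul_assoc a b c

@[simp] theorem dact_ofGerm (a b : AnalyticGerm n) : dact (DiffOpGerm.ofGerm n a) b = a * b := rfl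

theorem DiffOpGerm.ofFun_eq (h : (Fin n → ℝ) → ℂ) (hh : AnalyticAt ℝ h 0) :
    DiffOpGerm.ofFun h hh = ofGerm n (AnalyticGerm.mk h hh) := rfl

theorem dact_partialD (i : Fin n) {h : (Fin n → ℝ) → ℂ} (hh : AnalyticAt ℝ h 0) :
    dact (DiffOpGerm.partialD i) (AnalyticGerm.mk h hh) =
      AnalyticGerm.mk (partialFun i h) (partialFun_analyticAt i hh) := rfl

theorem analyticAt_clm_apply {D E F : Type*} [NormedAddCommGroup D] [NormedSpace ℝ D]
    [NormedAddCommGroup E] [NormedSpace ℝ E] [NormedAddCommGroup F] [NormedSpace ℝ F]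
    {A : D → E →L[ℝ] F} {x : D} (hA : AnalyticAt ℝ A x) {X : D → E} (hX : AnalyticAt ℝ X x) :
    AnalyticAt ℝ (fun x => A x (X x)) x :=
  AnalyticAt.comp (g := fun p : (E →L[ℝ] F) × E => p.1 p.2) (f := fun x => (A x, X x))
    ((ContinuousLinearMap.id ℝ (E →L[ℝ] F)).analyticAt_bilinear _) (hA.prod hX)

theorem analyticAt_fderiv_apply {E : Type*} [NormedAddCommGroup E] [NormedSpace ℝ E]
    {h : E → ℂ} {x : E} (hh : AnalyticAt ℝ h x) {X : E → E}
    (hX : AnalyticAt ℝ X x) : AnalyticAt ℝ (fun x => fderiv ℝ h x (X x)) x :=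
  analyticAt_clm_apply hh.fderiv hX

theorem dact_ofVectorField {X : (Fin n → ℝ) → (Fin n → ℝ)} (hX : AnalyticAt ℝ X 0)
    {h : (Fin n → ℝ) → ℂ} (hh : AnalyticAt ℝ h 0) :
    dact (DiffOpGerm.ofVectorField X hX) (AnalyticGerm.mk h hh) =
      AnalyticGerm.mk (fun x => fderiv ℝ h x (X x)) (analyticAt_fderiv_apply hh hX) := by
  rw [DiffOpGerm.ofVectorField, dact_sum]
  have hX' : ∀ i, AnalyticAt ℝ (fun x => (X x i : ℂ)) 0 := fun i =>
    (Complex.ofRealCLM.analyticAt _).comp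
      (((ContinuousLinearMap.proj (R := ℝ) (φ := fun _ : Fin n => ℝ) i).analyticAt _).comp hX)
  refine (Finset.sum_congr rfl fun i _ => (show _ = AnalyticGerm.mk
    (fun x => (X x i : ℂ) * partialFun i h x) ((hX' i).mul (partialFun_analyticAt i hh))
    from rfl)).trans ?_
  rw [AnalyticGerm.mk_sum, AnalyticGerm.mk_eq_iff]
  refine Eventually.of_forall fun x => ?_
  have : X x = ∑ i, X x i • (Pi.single i (1 : ℝ) : Fin n → ℝ) := by
    funext j
    simp [Finset.sum_apply, Pi.single_apply]
  beta_reduce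
  conv_rhs => rw [this]
  simp [partialFun]

/-! ### Analytic charts -/

/-- A germ at `0` of an analytic local isomorphism `F`, with inverse `G`. -/
structure GermChart (n : ℕ) where
  F : (Fin n → ℝ) → (Fin n → ℝ)
  G : (Fin n → ℝ) → (Fin n → ℝ)
  hF : AnalyticAt ℝ F 0
  hG : AnalyticAt ℝ G (F 0)
  hGF : ∀ᶠ x in 𝓝 0, G (F x) = x
  hFG : ∀ᶠ y in 𝓝 (F 0), F (G y) = y

namespace GermChart

variable (c : GermChart n)

theorem G_F_zero : c.G (c.F 0) = 0 := c.hGF.self_of_nhds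

/-- The germ of a function given in the coordinates `F`. -/
def mkF (k : (Fin n → ℝ) → ℂ) (hk : AnalyticAt ℝ k (c.F 0)) : AnalyticGerm n :=
  AnalyticGerm.mk (fun x => k (c.F x)) (hk.comp c.hF)

theorem tendsto_F : Tendsto c.F (𝓝 0) (𝓝 (c.F 0)) := c.hF.continuousAt

theorem tendsto_G : Tendsto c.G (𝓝 (c.F 0)) (𝓝 0) := by
  have := c.hG.continuousAt
  rwa [ContinuousAt, c.G_F_zero] at this

theorem mkF_eq_iff {k k' : (Fin n → ℝ) → ℂ} {hk : AnalyticAt ℝ k (c.F 0)}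
    {hk' : AnalyticAt ℝ k' (c.F 0)} : c.mkF k hk = c.mkF k' hk' ↔ k =ᶠ[𝓝 (c.F 0)] k' := by
  rw [mkF, mkF, AnalyticGerm.mk_eq_iff]
  constructor
  · intro h
    filter_upwards [c.tendsto_G.eventually h, c.hFG] with y h1 h2
    rwa [h2] at h1
  · intro h
    exact c.tendsto_F.eventually h

theorem mk_eq_mkF {h : (Fin n → ℝ) → ℂ} (hh : AnalyticAt ℝ h 0) :
    AnalyticGerm.mk h hh = c.mkF (fun y => h (c.G y))
      ((show AnalyticAt ℝ h (c.G (c.F 0)) from c.G_F_zero.symm ▸ hh).comp c.hG) := by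
  rw [mkF, AnalyticGerm.mk_eq_iff]
  filter_upwards [c.hGF] with x hx
  rw [hx]

theorem exists_mkF (a : AnalyticGerm n) :
    ∃ (k : (Fin n → ℝ) → ℂ) (hk : AnalyticAt ℝ k (c.F 0)), a = c.mkF k hk := by
  obtain ⟨h, hh, rfl⟩ := AnalyticGerm.exists_mk a
  exact ⟨_, _, c.mk_eq_mkF hh⟩

theorem mkF_sub {h k : (Fin n → ℝ) → ℂ} (hh : AnalyticAt ℝ h (c.F 0))
    (hk : AnalyticAt ℝ k (c.F 0)) : c.mkF h hh - c.mkF k hk =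
      c.mkF (fun x => h x - k x) (hh.sub hk) := rfl

theorem mkF_mul {h k : (Fin n → ℝ) → ℂ} (hh : AnalyticAt ℝ h (c.F 0))
    (hk : AnalyticAt ℝ k (c.F 0)) : c.mkF h hh * c.mkF k hk =
      c.mkF (fun x => h x * k x) (hh.mul hk) := rfl

theorem mkF_add {h k : (Fin n → ℝ) → ℂ} (hh : AnalyticAt ℝ h (c.F 0))
    (hk : AnalyticAt ℝ k (c.F 0)) : c.mkF h hh + c.mkF k hk =
      c.mkF (fun x => h x + k x) (hh.add hk) := rfl

/-- The coordinate vector fields of the chart. -/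
def field (i : Fin n) (x : Fin n → ℝ) : Fin n → ℝ := fderiv ℝ c.G (c.F x) (Pi.single i 1)

theorem field_analyticAt (i : Fin n) : AnalyticAt ℝ (c.field i) 0 :=
  (analyticAt_clm_apply c.hG.fderiv analyticAt_const).comp c.hF

/-- The derivation along a coordinate vector field. -/
def dop (i : Fin n) : DiffOpGerm n := DiffOpGerm.ofVectorField (c.field i) (c.field_analyticAt i)

theorem partial_analyticAt {k : (Fin n → ℝ) → ℂ} {y : Fin n → ℝ} (hk : AnalyticAt ℝ k y)
    (i : Fin n) : AnalyticAt ℝ (fun y => fderiv ℝ k y (Pi.single i 1)) y :=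
  analyticAt_fderiv_apply hk analyticAt_const

theorem fderiv_comp_F {k : (Fin n → ℝ) → ℂ} (hk : AnalyticAt ℝ k (c.F 0)) :
    ∀ᶠ x in 𝓝 0, fderiv ℝ (fun x => k (c.F x)) x = (fderiv ℝ k (c.F x)).comp (fderiv ℝ c.F x) := by
  filter_upwards [c.tendsto_F.eventually hk.eventually_analyticAt, c.hF.eventually_analyticAt]
    with x h1 h2
  exact fderiv_comp x h1.differentiableAt h2.differentiableAt

theorem fderiv_F_field (i : Fin n) :
    ∀ᶠ x in 𝓝 0, fderiv ℝ c.F x (c.field i x) = Pi.single i 1 := by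
  filter_upwards [c.tendsto_F.eventually c.hG.eventually_analyticAt, c.hF.eventually_analyticAt,
    c.tendsto_F.eventually c.hFG.eventually_nhds, c.hGF] with x h1 h2 h3 h4
  have h5 : HasFDerivAt (fun y => c.F (c.G y)) ((fderiv ℝ c.F x).comp (fderiv ℝ c.G (c.F x)))
      (c.F x) := by
    refine HasFDerivAt.comp (c.F x) ?_ h1.differentiableAt.hasFDerivAt
    rw [h4]
    exact h2.differentiableAt.hasFDerivAt
  have h6 : HasFDerivAt (fun y => c.F (c.G y)) (ContinuousLinearMap.id ℝ _) (c.F x) :=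
    (hasFDerivAt_id _).congr_of_eventuallyEq h3
  exact congrArg (fun A : (Fin n → ℝ) →L[ℝ] (Fin n → ℝ) => A (Pi.single i 1)) (h5.unique h6)

theorem dact_dop (i : Fin n) {k : (Fin n → ℝ) → ℂ} (hk : AnalyticAt ℝ k (c.F 0)) :
    dact (c.dop i) (c.mkF k hk) =
      c.mkF (fun y => fderiv ℝ k y (Pi.single i 1)) (partial_analyticAt hk i) := by
  rw [dop, mkF, dact_ofVectorField, mkF, AnalyticGerm.mk_eq_iff]
  filter_upwards [c.fderiv_comp_F hk, c.fderiv_F_field i] with x h1 h2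
  rw [h1, ContinuousLinearMap.comp_apply, h2]

theorem pi_eq_sum (u : Fin n → ℝ) : u = ∑ i, u i • (Pi.single i (1 : ℝ) : Fin n → ℝ) := by
  funext j
  simp [Finset.sum_apply, Pi.single_apply]

theorem coord_analyticAt {X : (Fin n → ℝ) → (Fin n → ℝ)} (hX : AnalyticAt ℝ X 0) (i : Fin n) :
    AnalyticAt ℝ (fun x => ((fderiv ℝ c.F x (X x) i : ℝ) : ℂ)) 0 :=
  (Complex.ofRealCLM.analyticAt _).comp
    (((ContinuousLinearMap.proj (R := ℝ) (φ := fun _ : Fin n => ℝ) i).analyticAt _).comp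
      (analyticAt_clm_apply c.hF.fderiv hX))

/-- An analytic vector field in terms of the coordinate vector fields. -/
theorem ofVectorField_eq {X : (Fin n → ℝ) → (Fin n → ℝ)} (hX : AnalyticAt ℝ X 0) :
    DiffOpGerm.ofVectorField X hX = ∑ i, DiffOpGerm.ofGerm n
      (AnalyticGerm.mk _ (c.coord_analyticAt hX i)) * c.dop i := by
  refine DiffOpGerm.ext_act fun a => ?_
  obtain ⟨k, hk, rfl⟩ := c.exists_mkF a
  rw [dact_sum]
  simp only [dact_mul, c.dact_dop, dact_ofGerm]
  simp only [mkF, AnalyticGerm.mk_mul]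
  rw [dact_ofVectorField, AnalyticGerm.mk_sum, AnalyticGerm.mk_eq_iff]
  filter_upwards [c.fderiv_comp_F hk] with x h1
  rw [h1, ContinuousLinearMap.comp_apply]
  conv_lhs => rw [pi_eq_sum (fderiv ℝ c.F x (X x))]
  simp

theorem dop_mul (i : Fin n) (a : AnalyticGerm n) : c.dop i * DiffOpGerm.ofGerm n a =
    DiffOpGerm.ofGerm n a * c.dop i + DiffOpGerm.ofGerm n (dact (c.dop i) a) := by
  refine DiffOpGerm.ext_act fun b => ?_
  obtain ⟨k, hk, rfl⟩ := c.exists_mkF a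
  obtain ⟨l, hl, rfl⟩ := c.exists_mkF b
  simp only [dact_add, dact_mul, dact_ofGerm, mkF_mul, dact_dop, mkF_add]
  rw [mkF_eq_iff]
  filter_upwards [hk.eventually_analyticAt, hl.eventually_analyticAt] with y h1 h2
  rw [fderiv_fun_mul h1.differentiableAt h2.differentiableAt]
  simp
  ring

theorem dop_comm (i j : Fin n) : Commute (c.dop i) (c.dop j) := by
  refine DiffOpGerm.ext_act fun a => ?_
  obtain ⟨k, hk, rfl⟩ := c.exists_mkF a
  simp only [dact_mul, dact_dop]
  rw [mkF_eq_iff]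
  filter_upwards [hk.eventually_analyticAt] with y h1
  have h2 : ∀ u v : Fin n → ℝ, fderiv ℝ (fun y => fderiv ℝ k y u) y v = fderiv ℝ (fderiv ℝ k) y v u := by
    intro u v
    rw [fderiv_clm_apply h1.fderiv.differentiableAt (differentiableAt_const _)]
    simp
  rw [h2, h2]
  have : IsSymmSndFDerivAt ℝ k y := by
    refine ContDiffAt.isSymmSndFDerivAt (n := 2) h1.contDiffAt (by simp)
  exact this _ _

/-- The projection onto the hyperplane where the coordinate `s` vanishes. -/
def proj0 (s : Fin n) : (Fin n → ℝ) →L[ℝ] (Fin n → ℝ) :=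
  ContinuousLinearMap.id ℝ _ -
    (ContinuousLinearMap.proj (R := ℝ) (φ := fun _ : Fin n => ℝ) s).smulRight (Pi.single s 1)

theorem proj0_apply (s : Fin n) (y : Fin n → ℝ) (j : Fin n) :
    proj0 s y j = if j = s then 0 else y j := by
  simp only [proj0, sub_apply, ContinuousLinearMap.id_apply, ContinuousLinearMap.smulRight_apply,
    ContinuousLinearMap.proj_apply, Pi.sub_apply, Pi.smul_apply, Pi.single_apply, smul_eq_mul]
  split_ifs with h
  · simp [h]
  · simp

theorem proj0_of_eq_zero {s : Fin n} {y : Fin n → ℝ} (h : y s = 0) : proj0 s y = y := by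
  funext j
  rw [proj0_apply]
  split_ifs with hj
  · rw [hj, h]
  · rfl

/-- The restriction of a germ to the hypersurface `F s = 0`, extended so as to be constant along the
coordinate field `s`; it is `0` if the hypersurface does not pass through the base point. -/
def rho (s : Fin n) : AnalyticGerm n →+ AnalyticGerm n :=
  open scoped Classical in
  if h : c.F 0 s = 0 then
    { toFun := fun a => ⟨a.1.compTendsto (fun x => c.G (proj0 s (c.F x))) (by
          have h1 : Tendsto (fun x => c.G (proj0 s (c.F x))) (𝓝 0) (𝓝 (c.G (proj0 s (c.F 0)))) := by
            rw [proj0_of_eq_zero h]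
            refine c.hG.continuousAt.tendsto.comp ?_
            have := ((proj0 s).continuous.tendsto (c.F 0)).comp c.tendsto_F
            rwa [proj0_of_eq_zero h] at this
          rwa [proj0_of_eq_zero h, c.G_F_zero] at h1), by
        obtain ⟨k, hk, rfl⟩ := c.exists_mkF a
        refine ⟨_, AnalyticAt.comp (g := fun x => k (c.F x)) (f := fun x => c.G (proj0 s (c.F x)))
          ?_ ?_, rfl⟩
        · rw [proj0_of_eq_zero h, c.G_F_zero]
          exact hk.comp c.hF
        · refine AnalyticAt.comp (g := c.G) (f := fun x => proj0 s (c.F x)) ?_ ?_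
          · rw [proj0_of_eq_zero h]
            exact c.hG
          · exact ((proj0 s).analyticAt _).comp c.hF⟩
      map_zero' := rfl
      map_add' := by
        intro a b
        obtain ⟨k, hk, rfl⟩ := c.exists_mkF a
        obtain ⟨l, hl, rfl⟩ := c.exists_mkF b
        rfl }
  else 0

theorem comp_proj0_analyticAt {s : Fin n} (h : c.F 0 s = 0) {k : (Fin n → ℝ) → ℂ}
    (hk : AnalyticAt ℝ k (c.F 0)) : AnalyticAt ℝ (fun y => k (proj0 s y)) (c.F 0) := by
  refine AnalyticAt.comp (g := k) (f := fun y => proj0 s y) ?_ ((proj0 s).analyticAt _)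
  rwa [proj0_of_eq_zero h]

theorem tendsto_proj0 {s : Fin n} (h : c.F 0 s = 0) :
    Tendsto (proj0 s) (𝓝 (c.F 0)) (𝓝 (c.F 0)) := by
  have := (proj0 s).continuous.tendsto (c.F 0)
  rwa [proj0_of_eq_zero h] at this

theorem rho_mkF {s : Fin n} (h : c.F 0 s = 0) {k : (Fin n → ℝ) → ℂ}
    (hk : AnalyticAt ℝ k (c.F 0)) :
    c.rho s (c.mkF k hk) = c.mkF (fun y => k (proj0 s y)) (c.comp_proj0_analyticAt h hk) := by
  rw [rho, dif_pos h]
  have h1 : (fun x => k (c.F (c.G (proj0 s (c.F x))))) =ᶠ[𝓝 0] fun x => k (proj0 s (c.F x)) := by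
    filter_upwards [c.tendsto_F.eventually ((c.tendsto_proj0 h).eventually c.hFG)] with x hx
    rw [hx]
  exact Subtype.ext (Germ.coe_eq.2 h1)

theorem rho_of_ne {s : Fin n} (h : c.F 0 s ≠ 0) : c.rho s = 0 := by
  rw [rho, dif_neg h]

theorem coordFun_analyticAt (i : Fin n) (q : Fin n → ℝ) :
    AnalyticAt ℝ (fun y : Fin n → ℝ => (y i : ℂ)) q :=
  (Complex.ofRealCLM.analyticAt _).comp
    ((ContinuousLinearMap.proj (R := ℝ) (φ := fun _ : Fin n => ℝ) i).analyticAt _)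

/-- The coordinate functions of the chart. -/
def coord (i : Fin n) : AnalyticGerm n :=
  c.mkF (fun y => (y i : ℂ)) (coordFun_analyticAt i _)

theorem coordFun_comp_analyticAt (i : Fin n) : AnalyticAt ℝ (fun x => (c.F x i : ℂ)) 0 :=
  (coordFun_analyticAt i (c.F 0)).comp c.hF

theorem isUnit_coord {i : Fin n} (h : c.F 0 i ≠ 0) : IsUnit (c.coord i) := by
  refine AnalyticGerm.isUnit_of_eval0_ne_zero ?_
  change ((c.F 0 i : ℝ) : ℂ) ≠ 0
  exact_mod_cast h

end GermChart

end

section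

variable {n : ℕ}

/-! ### Restriction to coordinate subspaces, and the frame of a chart -/

namespace GermChart

variable (c : GermChart n)

/-- A function continuous near `q` that vanishes where `y s ≠ 0`, on a coordinate subspace not
contained in `y s = 0`, vanishes on that subspace. -/
theorem eventually_eq_zero_of_coord_mul {q : Fin n → ℝ} {k : (Fin n → ℝ) → ℂ}
    (hk : AnalyticAt ℝ k q) {K : Set (Fin n)} {s : Fin n} (hs : s ∉ K)
    (h : ∀ᶠ y in 𝓝 q, (∀ i ∈ K, y i = 0) → (y s : ℂ) * k y = 0) :
    ∀ᶠ y in 𝓝 q, (∀ i ∈ K, y i = 0) → k y = 0 := by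
  filter_upwards [h.eventually_nhds, hk.eventually_analyticAt] with y h1 h2 hy
  by_cases hys : y s = 0
  · have h3 : Tendsto (fun t : ℝ => y + t • (Pi.single s 1 : Fin n → ℝ)) (𝓝[≠] 0) (𝓝 y) := by
      have : Continuous fun t : ℝ => y + t • (Pi.single s 1 : Fin n → ℝ) := by fun_prop
      have h4 := this.tendsto 0
      rw [zero_smul, add_zero] at h4
      exact h4.mono_left nhdsWithin_le_nhds
    have h4 : Tendsto (fun t : ℝ => k (y + t • (Pi.single s 1 : Fin n → ℝ))) (𝓝[≠] 0) (𝓝 (k y)) :=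
      h2.continuousAt.tendsto.comp h3
    refine tendsto_nhds_unique h4 (tendsto_const_nhds.congr' ?_)
    filter_upwards [h3.eventually h1, self_mem_nhdsWithin] with t h5 ht
    have h6 := h5 fun i hi => by
      have : i ≠ s := fun h => hs (h ▸ hi)
      simp [hy i hi, this]
    rw [mul_eq_zero] at h6
    rcases h6 with h6 | h6
    · simp [hys] at h6
      exact absurd h6 ht
    · exact h6.symm
  · exact (mul_eq_zero.1 (h1.self_of_nhds hy)).resolve_left (by exact_mod_cast hys)

theorem coord_mul (i : Fin n) {k : (Fin n → ℝ) → ℂ} (hk : AnalyticAt ℝ k (c.F 0)) :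
    c.coord i * c.mkF k hk = c.mkF (fun y => (y i : ℂ) * k y) ((coordFun_analyticAt i _).mul hk) :=
  rfl

theorem mkF_zero : c.mkF (fun _ => 0) analyticAt_const = 0 := rfl

theorem mkF_one : c.mkF (fun _ => 1) analyticAt_const = 1 := rfl

theorem dact_dop_coord (i j : Fin n) : dact (c.dop i) (c.coord j) = if i = j then 1 else 0 := by
  have h : ∀ y : Fin n → ℝ, fderiv ℝ (fun y : Fin n → ℝ => (y j : ℂ)) y (Pi.single i 1) =
      if i = j then 1 else 0 := by
    intro y
    have : (fun y : Fin n → ℝ => (y j : ℂ)) = Complex.ofRealCLM.comp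
      (ContinuousLinearMap.proj (R := ℝ) (φ := fun _ : Fin n => ℝ) j) := rfl
    rw [this, ContinuousLinearMap.fderiv]
    by_cases hij : i = j
    · simp [hij]
    · simp [hij, Ne.symm hij]
  rw [coord, dact_dop]
  split_ifs with hij
  · rw [← mkF_one, mkF_eq_iff]
    exact Eventually.of_forall fun y => by simp only [h, if_pos hij]
  · rw [← mkF_zero, mkF_eq_iff]
    exact Eventually.of_forall fun y => by simp only [h, if_neg hij]

theorem rho_coord_self (i : Fin n) (a : AnalyticGerm n) : c.rho i (c.coord i * a) = 0 := by
  by_cases h : c.F 0 i = 0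
  · obtain ⟨k, hk, rfl⟩ := c.exists_mkF a
    rw [coord_mul, c.rho_mkF h, ← mkF_zero, mkF_eq_iff]
    exact Eventually.of_forall fun y => by simp [proj0_apply]
  · rw [c.rho_of_ne h]; rfl

theorem rho_coord {i j : Fin n} (hij : i ≠ j) (a : AnalyticGerm n) :
    c.rho i (c.coord j * a) = c.coord j * c.rho i a := by
  by_cases h : c.F 0 i = 0
  · obtain ⟨k, hk, rfl⟩ := c.exists_mkF a
    rw [coord_mul, c.rho_mkF h, c.rho_mkF h, coord_mul, mkF_eq_iff]
    exact Eventually.of_forall fun y => by simp [proj0_apply, hij.symm]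
  · rw [c.rho_of_ne h]; simp

theorem rho_div (i : Fin n) (a : AnalyticGerm n) : ∃ b, a - c.rho i a = c.coord i * b := by
  by_cases h : c.F 0 i = 0
  · obtain ⟨k, hk, rfl⟩ := c.exists_mkF a
    have h1 : AnalyticAt ℝ (fun z => k (z + c.F 0)) 0 :=
      AnalyticAt.comp (g := k) (f := fun z => z + c.F 0) (by rwa [zero_add])
        (analyticAt_id.add analyticAt_const)
    obtain ⟨b, hb, hb'⟩ := exists_analyticAt_div h1 (proj0 i)
      (ContinuousLinearMap.proj (R := ℝ) (φ := fun _ : Fin n => ℝ) i) (Pi.single i 1)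
      (fun x => by simp [proj0])
    have h2 : AnalyticAt ℝ (fun y => b (y - c.F 0)) (c.F 0) :=
      AnalyticAt.comp (g := b) (f := fun z => z - c.F 0) (by rwa [sub_self])
        (analyticAt_id.sub analyticAt_const)
    refine ⟨c.mkF _ h2, ?_⟩
    rw [coord_mul, c.rho_mkF h, mkF_sub, mkF_eq_iff]
    have h3 : Tendsto (fun y : Fin n → ℝ => y - c.F 0) (𝓝 (c.F 0)) (𝓝 0) := by
      have : Continuous fun y : Fin n → ℝ => y - c.F 0 := by fun_prop
      simpa using this.tendsto (c.F 0)
    filter_upwards [h3.eventually hb'] with y hy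
    rw [map_sub, proj0_of_eq_zero h, sub_add_cancel, sub_add_cancel] at hy
    rw [hy]
    simp [h]
  · rw [c.rho_of_ne h]
    obtain ⟨u, hu⟩ := c.isUnit_coord h
    exact ⟨↑u⁻¹ * a, by rw [← mul_assoc, ← hu]; simp⟩

theorem dact_dop_rho (i s : Fin n) (a : AnalyticGerm n) :
    dact (c.dop i) (c.rho s a) = if i = s then 0 else c.rho s (dact (c.dop i) a) := by
  by_cases h : c.F 0 s = 0
  · obtain ⟨k, hk, rfl⟩ := c.exists_mkF a
    have h1 : ∀ᶠ y in 𝓝 (c.F 0), fderiv ℝ (fun y => k (proj0 s y)) y (Pi.single i 1) =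
        fderiv ℝ k (proj0 s y) (if i = s then 0 else Pi.single i 1) := by
      filter_upwards [(c.tendsto_proj0 h).eventually hk.eventually_analyticAt] with y hy
      rw [show (fun y => k (proj0 s y)) = k ∘ proj0 s from rfl, fderiv_comp _ hy.differentiableAt
        (proj0 s).differentiableAt, ContinuousLinearMap.fderiv, ContinuousLinearMap.comp_apply]
      congr 1
      funext j
      rw [proj0_apply]
      split_ifs with h1 h2 h2
      · rfl
      · rw [Pi.single_apply, if_neg (h1 ▸ Ne.symm h2)]
      · rw [Pi.single_apply, if_neg (h2 ▸ h1)]; rfl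
      · rfl
    rw [c.rho_mkF h, dact_dop, dact_dop, c.rho_mkF h]
    split_ifs with his
    · rw [← mkF_zero, mkF_eq_iff]
      filter_upwards [h1] with y hy
      rw [hy, if_pos his, map_zero]
    · rw [mkF_eq_iff]
      filter_upwards [h1] with y hy
      rw [hy, if_neg his]
  · rw [c.rho_of_ne h]; simp

theorem rho_comm (i j : Fin n) (a : AnalyticGerm n) :
    c.rho i (c.rho j a) = c.rho j (c.rho i a) := by
  by_cases hi : c.F 0 i = 0
  · by_cases hj : c.F 0 j = 0
    · obtain ⟨k, hk, rfl⟩ := c.exists_mkF a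
      rw [c.rho_mkF hi, c.rho_mkF hj, c.rho_mkF hj, c.rho_mkF hi, mkF_eq_iff]
      refine Eventually.of_forall fun y => congrArg k (funext fun l => ?_)
      simp only [proj0_apply]
      split_ifs <;> rfl
    · rw [c.rho_of_ne hj]; simp
  · rw [c.rho_of_ne hi]; simp

theorem coord_reg (i : Fin n) (a : AnalyticGerm n) (h : c.coord i * a = 0) : a = 0 := by
  obtain ⟨k, hk, rfl⟩ := c.exists_mkF a
  rw [coord_mul, ← mkF_zero, mkF_eq_iff] at h
  rw [← mkF_zero, mkF_eq_iff]
  have := eventually_eq_zero_of_coord_mul hk (Set.notMem_empty i) (h.mono fun y hy _ => hy)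
  exact this.mono fun y hy => hy (by simp)

theorem partialD_eq (i : Fin n) : DiffOpGerm.partialD i =
    DiffOpGerm.ofVectorField (fun _ : Fin n → ℝ => Pi.single i 1) analyticAt_const := by
  refine DiffOpGerm.ext_act fun a => ?_
  obtain ⟨h, hh, rfl⟩ := AnalyticGerm.exists_mk a
  rw [dact_ofVectorField, dact_partialD]
  rfl

theorem mem_of_closed (S : AddSubgroup (DiffOpGerm n)) (h1 : 1 ∈ S)
    (hO : ∀ a, ∀ P ∈ S, DiffOpGerm.ofGerm n a * P ∈ S) (hw : ∀ i, ∀ P ∈ S, c.dop i * P ∈ S)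
    (P : DiffOpGerm n) : P ∈ S := by
  have key : ∀ (Q : AddMonoid.End (AnalyticGerm n)) (hQ : Q ∈ DiffOpGerm n), ∀ P ∈ S,
      (⟨Q, hQ⟩ : DiffOpGerm n) * P ∈ S := by
    intro Q hQ
    induction hQ using Subring.closure_induction with
    | mem Q h =>
      rcases h with ⟨a, rfl⟩ | ⟨i, rfl⟩
      · exact hO a
      · intro P hP
        change DiffOpGerm.partialD i * P ∈ S
        rw [partialD_eq, c.ofVectorField_eq, Finset.sum_mul]
        refine S.sum_mem fun l _ => ?_
        rw [mul_assoc]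
        exact hO _ _ (hw _ _ hP)
    | zero =>
      intro P _
      convert S.zero_mem
      exact zero_mul P
    | one =>
      intro P hP
      convert hP
      exact one_mul P
    | add A B hA hB ihA ihB =>
      intro P hP
      convert S.add_mem (ihA P hP) (ihB P hP) using 1
      exact add_mul (⟨A, hA⟩ : DiffOpGerm n) ⟨B, hB⟩ P
    | neg A hA ih =>
      intro P hP
      convert S.neg_mem (ih P hP) using 1
      exact neg_mul (⟨A, hA⟩ : DiffOpGerm n) P
    | mul A B hA hB ihA ihB =>
      intro P hP
      convert ihA _ (ihB P hP) using 1
      exact mul_assoc (⟨A, hA⟩ : DiffOpGerm n) ⟨B, hB⟩ P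
  have := key P.1 P.2 1 h1
  rwa [mul_one] at this

/-- The operators `∂/∂yᵢ`, with the coordinates `yᵢ`, `i < m`, as logarithmic coordinates. -/
def frame {m : ℕ} (hmn : m ≤ n) :
    LogFrame (DiffOpGerm n) (AnalyticGerm n) (Fin m) {j : Fin n // m ≤ (j : ℕ)} where
  ι := DiffOpGerm.ofGerm n
  x i := c.coord (Fin.castLE hmn i)
  w i := c.dop (Fin.castLE hmn i)
  y j := c.dop j
  dw i := dact (c.dop (Fin.castLE hmn i))
  dy j := dact (c.dop j)
  rho i := c.rho (Fin.castLE hmn i)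
  w_mul i a := c.dop_mul _ a
  y_mul j a := c.dop_mul _ a
  w_comm i j := c.dop_comm _ _
  y_w_comm i j := c.dop_comm _ _
  dw_x i j := by rw [dact_dop_coord]; simp
  dy_x j i := by
    rw [dact_dop_coord, if_neg]
    rintro h
    have h1 := j.2
    rw [h] at h1
    simp at h1
    omega
  rho_x_self i a := c.rho_coord_self _ a
  rho_x i j a h := c.rho_coord (by simpa using h) a
  rho_div i a := c.rho_div _ a
  dw_rho_self i a := by rw [dact_dop_rho, if_pos rfl]
  dw_rho i j a h := by rw [dact_dop_rho, if_neg (by simpa using h)]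
  dy_rho j i a := by
    rw [dact_dop_rho, if_neg]
    rintro h
    have h1 := j.2
    rw [h] at h1
    simp at h1
    omega
  rho_comm i j a := c.rho_comm _ _ a
  x_reg i a h := c.coord_reg _ a h
  natCast_isUnit d hd := AnalyticGerm.isUnit_of_eval0_ne_zero (by simpa using hd)
  generates S h1 hO hw hy P := by
    refine c.mem_of_closed S h1 hO (fun i P hP => ?_) P
    by_cases h : m ≤ (i : ℕ)
    · exact hy ⟨i, h⟩ P hP
    · exact hw ⟨i, not_le.1 h⟩ P hP

/-- The germ `a` vanishes, near the base point, on the locus where the coordinates `yᵢ`, `i ∈ K`,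
vanish. -/
def VanishesOn {m : ℕ} (hmn : m ≤ n) (K : Finset (Fin m)) (a : AnalyticGerm n) : Prop :=
  ∃ (k : (Fin n → ℝ) → ℂ) (hk : AnalyticAt ℝ k (c.F 0)), a = c.mkF k hk ∧
    ∀ᶠ y in 𝓝 (c.F 0), (∀ i ∈ K, y (Fin.castLE hmn i) = 0) → k y = 0

theorem vanishesOn_mkF {m : ℕ} {hmn : m ≤ n} {K : Finset (Fin m)} {k : (Fin n → ℝ) → ℂ}
    {hk : AnalyticAt ℝ k (c.F 0)} : c.VanishesOn hmn K (c.mkF k hk) ↔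
    ∀ᶠ y in 𝓝 (c.F 0), (∀ i ∈ K, y (Fin.castLE hmn i) = 0) → k y = 0 := by
  constructor
  · rintro ⟨k', hk', h1, h2⟩
    rw [mkF_eq_iff] at h1
    filter_upwards [h1, h2] with y hy hy' h
    rw [hy, hy' h]
  · exact fun h => ⟨k, hk, rfl, h⟩

theorem isVanishing_vanishesOn {m : ℕ} (hmn : m ≤ n) :
    (c.frame hmn).IsVanishing (c.VanishesOn hmn) where
  empty a := by
    rintro ⟨k, hk, rfl, h⟩
    rw [← mkF_zero, mkF_eq_iff]
    exact h.mono fun y hy => hy (by simp)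
  sub K a b := by
    rintro ⟨k, hk, rfl, h⟩ ⟨k', hk', rfl, h'⟩
    rw [mkF_sub, vanishesOn_mkF]
    filter_upwards [h, h'] with y hy hy' hK
    rw [hy hK, hy' hK, sub_zero]
  rho K s a := by
    rintro ⟨k, hk, rfl, h⟩
    change c.VanishesOn hmn K (c.rho (Fin.castLE hmn s) _)
    by_cases hs : c.F 0 (Fin.castLE hmn s) = 0
    · rw [c.rho_mkF hs, vanishesOn_mkF]
      filter_upwards [(c.tendsto_proj0 hs).eventually h] with y hy hK
      refine hy fun i hi => ?_
      rw [proj0_apply]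
      split_ifs with his
      · rfl
      · exact hK i ((Finset.mem_insert.1 hi).resolve_left fun h => his (by rw [h]))
    · rw [c.rho_of_ne hs]
      exact ⟨_, analyticAt_const, c.mkF_zero.symm, Eventually.of_forall fun _ _ => rfl⟩
  mono K s a := by
    rintro ⟨k, hk, rfl, h⟩
    refine ⟨k, hk, rfl, h.mono fun y hy hK => hy fun i hi => hK i (Finset.mem_insert_of_mem hi)⟩
  div K s a hs := by
    obtain ⟨k, hk, rfl⟩ := c.exists_mkF a
    change c.VanishesOn hmn K (c.coord (Fin.castLE hmn s) * _) → _
    rw [coord_mul, vanishesOn_mkF, vanishesOn_mkF]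
    intro h
    have := eventually_eq_zero_of_coord_mul hk (K := Fin.castLE hmn '' (K : Set (Fin m)))
      (s := Fin.castLE hmn s) (by simpa using hs) (h.mono fun y hy h => hy (by simpa using h))
    exact this.mono fun y hy h => hy (by simpa using h)

end GermChart

end

section

/-! ### The chart adapted to the functions and vector fields -/

/-- Functions `f j`, `j < m`, on a neighbourhood `U` of `0`, and a frame of vector fields `v i`
with `v i (f j) = δᵢⱼ`. -/
structure DualFrame (n m : ℕ) where
  hmn : m ≤ n
  U : Opens (Fin n → ℝ)
  h0 : (0 : Fin n → ℝ) ∈ U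
  f : Fin m → (Fin n → ℝ) → ℝ
  hf : ∀ j, AnalyticOnNhd ℝ (f j) U
  v : Fin n → (Fin n → ℝ) → (Fin n → ℝ)
  hv : ∀ i, AnalyticOnNhd ℝ (v i) U
  hvli : LinearIndependent ℝ (fun i => v i 0)
  hvf : ∀ (i : Fin n) (j : Fin m), ∀ x ∈ U,
    fderiv ℝ (f j) x (v i x) = if (i : ℕ) = (j : ℕ) then 1 else 0

/-- The Jacobian determinant of an analytic map is analytic. -/
theorem analyticAt_det_fderiv {n : ℕ} {F : (Fin n → ℝ) → (Fin n → ℝ)} {x : Fin n → ℝ}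
    (hF : AnalyticAt ℝ F x) : AnalyticAt ℝ (fun x => (fderiv ℝ F x).det) x := by
  have h : (fun x => (fderiv ℝ F x).det) = fun x => ∑ σ : Equiv.Perm (Fin n),
      ((Equiv.Perm.sign σ : ℤ) : ℝ) * ∏ i, fderiv ℝ F x (Pi.single i 1) (σ i) := by
    funext x
    change LinearMap.det _ = _
    rw [← LinearMap.det_toMatrix', Matrix.det_apply']
    simp [LinearMap.toMatrix'_apply]
  rw [h]
  refine Finset.analyticAt_fun_sum _ fun σ _ => analyticAt_const.mul
    (Finset.analyticAt_fun_prod _ fun i _ => ?_)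
  exact ((ContinuousLinearMap.proj (R := ℝ) (φ := fun _ : Fin n => ℝ) (σ i)).analyticAt _).comp
    (analyticAt_clm_apply hF.fderiv analyticAt_const)

namespace DualFrame

variable {n m : ℕ} (D : DualFrame n m)

/-- The values at `0` of the vector fields, as a basis. -/
def basis : Module.Basis (Fin n) ℝ (Fin n → ℝ) :=
  Module.Basis.mk D.hvli (D.hvli.span_eq_top_of_card_eq_finrank' (by simp)).ge

/-- The functions `f j`, completed to a coordinate system by linear forms vanishing on `v j 0`,
`j < m`. -/
def F (x : Fin n → ℝ) : Fin n → ℝ := fun l =>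
  if h : (l : ℕ) < m then D.f ⟨l, h⟩ x else D.basis.equivFunL x l

theorem F_castLE (x : Fin n → ℝ) (j : Fin m) : D.F x (Fin.castLE D.hmn j) = D.f j x := by
  rw [F, dif_pos]; rfl

theorem F_analyticAt {x : Fin n → ℝ} (hx : x ∈ D.U) : AnalyticAt ℝ D.F x := by
  refine AnalyticAt.pi fun l => ?_
  unfold F
  split_ifs with h
  · exact D.hf _ x hx
  · exact ((ContinuousLinearMap.proj (R := ℝ) (φ := fun _ : Fin n => ℝ) l).comp
      (D.basis.equivFunL : (Fin n → ℝ) →L[ℝ] (Fin n → ℝ))).analyticAt x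

theorem fderiv_F_apply {x : Fin n → ℝ} (hx : x ∈ D.U) (u : Fin n → ℝ) (l : Fin n) :
    fderiv ℝ D.F x u l =
      if h : (l : ℕ) < m then fderiv ℝ (D.f ⟨l, h⟩) x u else D.basis.equivFunL u l := by
  have h1 : fderiv ℝ D.F x u l = fderiv ℝ (fun x => D.F x l) x u := by
    have h2 := (hasFDerivAt_pi'.1 (D.F_analyticAt hx).differentiableAt.hasFDerivAt) l
    rw [h2.fderiv]; rfl
  rw [h1]
  unfold F
  split_ifs with h
  · rfl
  · exact congrArg (fun A : (Fin n → ℝ) →L[ℝ] ℝ => A u)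
      ((ContinuousLinearMap.proj (R := ℝ) (φ := fun _ : Fin n => ℝ) l).comp
        (D.basis.equivFunL : (Fin n → ℝ) →L[ℝ] (Fin n → ℝ))).fderiv

theorem fderiv_F_v_of_lt {x : Fin n → ℝ} (hx : x ∈ D.U) (i : Fin n) {l : Fin n} (hl : (l : ℕ) < m) :
    fderiv ℝ D.F x (D.v i x) l = if i = l then 1 else 0 := by
  rw [D.fderiv_F_apply hx, dif_pos hl, D.hvf i _ x hx]
  simp [Fin.ext_iff]

theorem fderiv_F_zero_v (i : Fin n) : fderiv ℝ D.F 0 (D.v i 0) = Pi.single i 1 := by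
  funext l
  rw [Pi.single_apply]
  by_cases hl : (l : ℕ) < m
  · rw [D.fderiv_F_v_of_lt D.h0 i hl]
    simp [eq_comm]
  · rw [D.fderiv_F_apply D.h0, dif_neg hl]
    have : D.v i 0 = D.basis i := by simp [basis]
    rw [this]
    simp [Finsupp.single_apply, eq_comm]

theorem fderiv_F_zero :
    fderiv ℝ D.F 0 = (D.basis.equivFunL : (Fin n → ℝ) →L[ℝ] (Fin n → ℝ)) := by
  refine ContinuousLinearMap.coe_injective (D.basis.ext fun i => ?_)
  have : D.v i 0 = D.basis i := by simp [basis]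
  change fderiv ℝ D.F 0 (D.basis i) = _
  rw [← this, D.fderiv_F_zero_v, this]
  funext l
  simp [Pi.single_apply, Finsupp.single_apply, eq_comm]

theorem exists_homeo : ∃ e : OpenPartialHomeomorph (Fin n → ℝ) (Fin n → ℝ),
    (e : (Fin n → ℝ) → (Fin n → ℝ)) = D.F ∧ 0 ∈ e.source ∧ e.source ⊆ D.U ∧
      ∀ x ∈ e.source, (fderiv ℝ D.F x).det ≠ 0 := by
  have h1 : HasStrictFDerivAt D.F (D.basis.equivFunL : (Fin n → ℝ) →L[ℝ] (Fin n → ℝ)) 0 := by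
    rw [← D.fderiv_F_zero]
    exact (D.F_analyticAt D.h0).hasStrictFDerivAt
  have h2 : ContinuousOn (fun x => (fderiv ℝ D.F x).det) D.U := fun x hx =>
    (analyticAt_det_fderiv (D.F_analyticAt hx)).continuousAt.continuousWithinAt
  have h3 : IsOpen ((D.U : Set (Fin n → ℝ)) ∩ (fun x => (fderiv ℝ D.F x).det) ⁻¹' {0}ᶜ) :=
    h2.isOpen_inter_preimage D.U.isOpen isOpen_compl_singleton
  refine ⟨(h1.toOpenPartialHomeomorph D.F).restrOpen _ h3, rfl, ⟨?_, D.h0, ?_⟩, ?_, ?_⟩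
  · exact h1.mem_toOpenPartialHomeomorph_source
  · change (fderiv ℝ D.F 0).det ≠ 0
    rw [D.fderiv_F_zero]
    exact (LinearEquiv.isUnit_det' D.basis.equivFunL.toLinearEquiv).ne_zero
  · exact fun x hx => hx.2.1
  · exact fun x hx => hx.2.2

/-- The map `F` as a local homeomorphism near `0`. -/
def homeo : OpenPartialHomeomorph (Fin n → ℝ) (Fin n → ℝ) := D.exists_homeo.choose

theorem coe_homeo : (D.homeo : (Fin n → ℝ) → (Fin n → ℝ)) = D.F := D.exists_homeo.choose_spec.1

theorem zero_mem_source : 0 ∈ D.homeo.source := D.exists_homeo.choose_spec.2.1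

theorem source_subset : D.homeo.source ⊆ D.U := D.exists_homeo.choose_spec.2.2.1

theorem det_ne_zero {x : Fin n → ℝ} (hx : x ∈ D.homeo.source) : (fderiv ℝ D.F x).det ≠ 0 :=
  D.exists_homeo.choose_spec.2.2.2 x hx

/-- The germ at `0` of the chart `F`. -/
def chart : GermChart n where
  F := D.F
  G := D.homeo.symm
  hF := D.F_analyticAt D.h0
  hG := by
    have := D.homeo.analyticAt_symm' (i := D.basis.equivFunL) D.zero_mem_source
      (by rw [coe_homeo]; exact D.F_analyticAt D.h0) (by rw [coe_homeo]; exact D.fderiv_F_zero)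
    rwa [coe_homeo] at this
  hGF := by
    have := D.homeo.eventually_left_inverse D.zero_mem_source
    rwa [coe_homeo] at this
  hFG := by
    have := D.homeo.eventually_right_inverse' D.zero_mem_source
    rwa [coe_homeo] at this

/-- The operator `v i`. -/
def V (i : Fin n) : DiffOpGerm n := DiffOpGerm.ofVectorField (D.v i) (D.hv i 0 D.h0)

/-- The components of the vector fields `v i` in the chart. -/
def C (i l : Fin n) : AnalyticGerm n :=
  AnalyticGerm.mk _ (D.chart.coord_analyticAt (D.hv i 0 D.h0) l)

theorem C_of_lt (i : Fin n) {l : Fin n} (hl : (l : ℕ) < m) : D.C i l = if i = l then 1 else 0 := by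
  have h : ∀ᶠ x in 𝓝 0, ((fderiv ℝ D.F x (D.v i x) l : ℝ) : ℂ) = if i = l then 1 else 0 := by
    filter_upwards [D.U.isOpen.mem_nhds D.h0] with x hx
    rw [D.fderiv_F_v_of_lt hx i hl]
    split_ifs <;> simp
  split_ifs with hil
  · exact AnalyticGerm.mk_eq_iff (hk := analyticAt_const).2 (h.mono fun x hx => hx.trans (if_pos hil))
  · exact AnalyticGerm.mk_eq_iff (hk := analyticAt_const).2 (h.mono fun x hx => hx.trans (if_neg hil))

theorem eval0_C (i l : Fin n) : AnalyticGerm.eval0 n (D.C i l) = if i = l then 1 else 0 := by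
  change ((fderiv ℝ D.F 0 (D.v i 0) l : ℝ) : ℂ) = _
  rw [D.fderiv_F_zero_v, Pi.single_apply]
  simp only [eq_comm (a := l)]
  split_ifs <;> simp

/-- Since `v i (f j) = δᵢⱼ`, the field `v i` differs from a coordinate field, or from `0`, only by
the last coordinate fields. -/
theorem V_eq (i : Fin n) : D.V i = (if (i : ℕ) < m then D.chart.dop i else 0) +
    ∑ l : {j : Fin n // m ≤ (j : ℕ)}, DiffOpGerm.ofGerm n (D.C i l) * D.chart.dop l := by
  rw [V, D.chart.ofVectorField_eq]
  change ∑ l, DiffOpGerm.ofGerm n (D.C i l) * D.chart.dop l = _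
  rw [← Finset.sum_filter_add_sum_filter_not Finset.univ (fun l : Fin n => (l : ℕ) < m)]
  congr 1
  · rw [Finset.sum_congr rfl fun l hl => by rw [D.C_of_lt i (Finset.mem_filter.1 hl).2]]
    simp only [apply_ite (DiffOpGerm.ofGerm n), map_one, map_zero, ite_mul, one_mul, zero_mul]
    rw [Finset.sum_ite_eq]
    simp
  · simp only [not_lt]
    exact (Finset.sum_subtype _ (by simp) fun l => DiffOpGerm.ofGerm n (D.C i l) * D.chart.dop l)

/-- The `v j` with `j ≥ m` and the last coordinate fields span the same module: the matrix of
components is the identity at `0`, hence invertible. -/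
theorem exists_dop_eq : ∃ B : {j : Fin n // m ≤ (j : ℕ)} → {j : Fin n // m ≤ (j : ℕ)} →
    AnalyticGerm n, ∀ l : {j : Fin n // m ≤ (j : ℕ)},
      D.chart.dop l = ∑ j, DiffOpGerm.ofGerm n (B l j) * D.V j := by
  set M : Matrix {j : Fin n // m ≤ (j : ℕ)} {j : Fin n // m ≤ (j : ℕ)} (AnalyticGerm n) :=
    Matrix.of fun i l => D.C i l with hM
  have h1 : IsUnit M.det := by
    refine AnalyticGerm.isUnit_of_eval0_ne_zero ?_
    rw [RingHom.map_det]
    have : (AnalyticGerm.eval0 n).mapMatrix M = 1 := by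
      ext i l
      rw [RingHom.mapMatrix_apply, Matrix.map_apply, hM, Matrix.of_apply, D.eval0_C, Matrix.one_apply]
      simp only [Subtype.ext_iff]
    rw [this, Matrix.det_one]
    exact one_ne_zero
  refine ⟨fun l j => M⁻¹ l j, fun l => ?_⟩
  have h2 : ∀ j : {j : Fin n // m ≤ (j : ℕ)}, D.V j =
      ∑ l : {j : Fin n // m ≤ (j : ℕ)}, DiffOpGerm.ofGerm n (M j l) * D.chart.dop l := by
    intro j
    rw [D.V_eq, if_neg (not_lt.2 j.2), zero_add]
    rfl
  simp only [h2, Finset.mul_sum]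
  rw [Finset.sum_comm]
  simp only [← mul_assoc, ← map_mul, ← Finset.sum_mul, ← map_sum]
  have h3 : ∀ x, ∑ i, M⁻¹ l i * M i x = if l = x then 1 else 0 := by
    intro x
    have := congrFun (congrFun (Matrix.nonsing_inv_mul M h1) l) x
    rwa [Matrix.mul_apply, Matrix.one_apply] at this
  simp only [h3, apply_ite (DiffOpGerm.ofGerm n), map_one, map_zero, ite_mul, one_mul, zero_mul]
  rw [Finset.sum_ite_eq]
  simp

theorem f_analyticAt (j : Fin m) : AnalyticAt ℝ (fun x => (D.f j x : ℂ)) 0 :=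
  (Complex.ofRealCLM.analyticAt _).comp (D.hf j 0 D.h0)

theorem coord_chart (j : Fin m) : D.chart.coord (Fin.castLE D.hmn j) =
    AnalyticGerm.mk (fun x => (D.f j x : ℂ)) (D.f_analyticAt j) := by
  refine (AnalyticGerm.mk_eq_iff (hh := D.chart.coordFun_comp_analyticAt _)).2
    (Eventually.of_forall fun x => ?_)
  change ((D.F x (Fin.castLE D.hmn j) : ℝ) : ℂ) = ((D.f j x : ℝ) : ℂ)
  rw [D.F_castLE]

theorem ofRealFun_f (j : Fin m) : DiffOpGerm.ofRealFun (D.f j) (D.hf j 0 D.h0) =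
    DiffOpGerm.ofGerm n (D.chart.coord (Fin.castLE D.hmn j)) := by
  rw [coord_chart]
  rfl

theorem ofRealFun_prod (J : Finset (Fin m)) : DiffOpGerm.ofRealFun (fun x => ∏ j ∈ J, D.f j x)
    (Finset.analyticAt_fun_prod J fun j _ => D.hf j 0 D.h0) =
    DiffOpGerm.ofGerm n (∏ j ∈ J, D.chart.coord (Fin.castLE D.hmn j)) := by
  simp only [coord_chart]
  rw [AnalyticGerm.mk_prod]
  refine congrArg (DiffOpGerm.ofGerm n) ((AnalyticGerm.mk_eq_iff
    (hh := (Complex.ofRealCLM.analyticAt _).comp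
      (Finset.analyticAt_fun_prod J fun j _ => D.hf j 0 D.h0))).2
    (Eventually.of_forall fun x => ?_))
  simp

theorem mul_add_sum_sub {R κ : Type*} [Ring R] [Fintype κ] (a b w w' : R) (c d y : κ → R) :
    a * (w + ∑ l, c l * y l) - b * (w' + ∑ l, d l * y l) =
      (a * w - b * w') + ∑ l, (a * c l - b * d l) * y l := by
  simp only [mul_add, Finset.mul_sum, sub_mul, Finset.sum_sub_distrib, mul_assoc]
  abel

/-- The ideal of the theorem, in terms of the coordinate vector fields of the chart. -/
theorem span_generators_eq (o : Fin m) (ho : (o : ℕ) = 0) (k : ℕ) :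
    Ideal.span (generators D.hmn D.f (fun j => D.hf j 0 D.h0) D.v (fun i => D.hv i 0 D.h0) k) =
      (D.chart.frame D.hmn).I o k := by
  set A := Ideal.span (generators D.hmn D.f (fun j => D.hf j 0 D.h0) D.v
    (fun i => D.hv i 0 D.h0) k) with hA
  set L := D.chart.frame D.hmn with hL
  have hVi : ∀ i : Fin m, D.V (Fin.castLE D.hmn i) = L.w i +
      ∑ l : {j : Fin n // m ≤ (j : ℕ)}, DiffOpGerm.ofGerm n (D.C (Fin.castLE D.hmn i) l) * L.y l := by
    intro i
    rw [D.V_eq, if_pos (by simp)]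
    rfl
  have hdiff : ∀ i : Fin m, L.ι (L.x o) * D.V (Fin.castLE D.hmn o) -
      L.ι (L.x i) * D.V (Fin.castLE D.hmn i) = (L.ι (L.x o) * L.w o - L.ι (L.x i) * L.w i) +
      ∑ l : {j : Fin n // m ≤ (j : ℕ)}, (L.ι (L.x o) * DiffOpGerm.ofGerm n
        (D.C (Fin.castLE D.hmn o) l) - L.ι (L.x i) * DiffOpGerm.ofGerm n
        (D.C (Fin.castLE D.hmn i) l)) * L.y l := by
    intro i
    rw [hVi, hVi]
    exact mul_add_sum_sub _ _ _ _ _ _ _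
  apply le_antisymm
  · refine Ideal.span_le.2 ?_
    have hy : ∀ l : {j : Fin n // m ≤ (j : ℕ)}, L.y l ∈ L.I o k := fun l =>
      Ideal.subset_span (Or.inr ⟨l, rfl⟩)
    rintro P ((⟨J, hJ, rfl⟩ | ⟨i₁, i, hi₁, hi, rfl⟩) | ⟨j, hj, rfl⟩)
    · rw [D.ofRealFun_prod]
      exact Ideal.subset_span (Or.inl (Or.inl ⟨J, hJ, rfl⟩))
    · obtain rfl : i₁ = o := Fin.ext (hi₁.trans ho.symm)
      rw [D.ofRealFun_f, D.ofRealFun_f]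
      refine (hdiff i).symm ▸ (L.I i₁ k).add_mem ?_ (Ideal.sum_mem _ fun l _ =>
        Ideal.mul_mem_left _ _ (hy l))
      exact Ideal.subset_span (Or.inl (Or.inr ⟨i, rfl⟩))
    · change D.V j ∈ L.I o k
      rw [D.V_eq, if_neg (not_lt.2 hj), zero_add]
      exact Ideal.sum_mem _ fun l _ => Ideal.mul_mem_left _ _ (hy l)
  · have hy : ∀ l : {j : Fin n // m ≤ (j : ℕ)}, L.y l ∈ A := by
      obtain ⟨B, hB⟩ := D.exists_dop_eq
      intro l
      change D.chart.dop l ∈ A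
      rw [hB l]
      refine Ideal.sum_mem _ fun j _ => Ideal.mul_mem_left _ _ ?_
      exact Ideal.subset_span (Or.inr ⟨j, j.2, rfl⟩)
    refine Ideal.span_le.2 ?_
    rintro P ((⟨J, hJ, rfl⟩ | ⟨i, rfl⟩) | ⟨l, rfl⟩)
    · refine Ideal.subset_span (Or.inl (Or.inl ⟨J, hJ, ?_⟩))
      rw [D.ofRealFun_prod]
      rfl
    · rcases eq_or_ne i o with rfl | hio
      · rw [sub_self]
        exact A.zero_mem
      · rw [SetLike.mem_coe, ← (A.add_mem_iff_left (Ideal.sum_mem _ fun l _ =>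
          Ideal.mul_mem_left _ _ (hy l))), ← hdiff i]
        refine Ideal.subset_span (Or.inl (Or.inr ⟨o, i, ho, ?_, ?_⟩))
        · have : (i : ℕ) ≠ o := fun h => hio (Fin.ext h)
          omega
        · rw [D.ofRealFun_f, D.ofRealFun_f]
          rfl
    · exact hy l

end DualFrame

end

section

/-! ### Operations on test functions -/

variable {n : ℕ} {V V' : Opens (Fin n → ℝ)}

theorem testPartial_apply (i : Fin n) (φ : 𝓓(V, ℂ)) (x : Fin n → ℝ) :
    testPartial V i φ x = fderiv ℝ φ x (Pi.single i 1) := by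
  change (TestFunction.lineDerivCLM ℂ (Pi.single i 1) : 𝓓(V, ℂ) →L[ℂ] 𝓓(V, ℂ)) φ x = _
  rw [TestFunction.lineDerivCLM_eq_fderivCLM, TestFunction.fderivCLM_apply_of_le _ (by simp)]

@[simp] theorem mulTest_apply {a : (Fin n → ℝ) → ℂ} (ha : AnalyticOnNhd ℝ a V) (φ : 𝓓(V, ℂ))
    (x : Fin n → ℝ) : mulTest a ha φ x = a x * φ x := rfl

theorem testFunction_eq_zero (φ : 𝓓(V, ℂ)) {x : Fin n → ℝ} (hx : x ∉ V) : φ x = 0 :=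
  image_eq_zero_of_notMem_tsupport fun h => hx (φ.tsupport_subset h)

theorem testFunction_ext_of_mem {φ ψ : 𝓓(V, ℂ)} (h : ∀ x ∈ V, φ x = ψ x) : φ = ψ := by
  refine DFunLike.ext _ _ fun x => ?_
  by_cases hx : x ∈ V
  · exact h x hx
  · rw [testFunction_eq_zero φ hx, testFunction_eq_zero ψ hx]

theorem mulTest_add {a : (Fin n → ℝ) → ℂ} (ha : AnalyticOnNhd ℝ a V) (φ ψ : 𝓓(V, ℂ)) :
    mulTest a ha (φ + ψ) = mulTest a ha φ + mulTest a ha ψ :=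
  DFunLike.ext _ _ fun x => by simp [mul_add]

theorem mulTest_smul {a : (Fin n → ℝ) → ℂ} (ha : AnalyticOnNhd ℝ a V) (c : ℂ) (φ : 𝓓(V, ℂ)) :
    mulTest a ha (c • φ) = c • mulTest a ha φ :=
  DFunLike.ext _ _ fun x => by simp [mul_left_comm]

theorem mulTest_neg {a : (Fin n → ℝ) → ℂ} (ha : AnalyticOnNhd ℝ a V) (φ : 𝓓(V, ℂ)) :
    mulTest a ha (-φ) = -mulTest a ha φ :=
  DFunLike.ext _ _ fun x => by simp

theorem mulTest_mulTest {a b : (Fin n → ℝ) → ℂ} (ha : AnalyticOnNhd ℝ a V)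
    (hb : AnalyticOnNhd ℝ b V) (φ : 𝓓(V, ℂ)) :
    mulTest a ha (mulTest b hb φ) = mulTest (fun x => a x * b x) (ha.mul hb) φ :=
  DFunLike.ext _ _ fun x => by simp [mul_assoc]

theorem analyticOnNhd_partialFun {a : (Fin n → ℝ) → ℂ} {s : Set (Fin n → ℝ)}
    (ha : AnalyticOnNhd ℝ a s) (i : Fin n) : AnalyticOnNhd ℝ (partialFun i a) s :=
  fun x hx => analyticAt_fderiv_apply (ha x hx) analyticAt_const

theorem testFunction_differentiableAt (φ : 𝓓(V, ℂ)) (x : Fin n → ℝ) : DifferentiableAt ℝ φ x :=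
  φ.contDiff.contDiffAt.differentiableAt (by simp)

theorem testPartial_mulTest {a : (Fin n → ℝ) → ℂ} (ha : AnalyticOnNhd ℝ a V) (i : Fin n)
    (φ : 𝓓(V, ℂ)) : testPartial V i (mulTest a ha φ) =
      mulTest (partialFun i a) (analyticOnNhd_partialFun ha i) φ +
        mulTest a ha (testPartial V i φ) := by
  refine testFunction_ext_of_mem fun x hx => ?_
  rw [add_apply, mulTest_apply, mulTest_apply, testPartial_apply, testPartial_apply]
  have h1 : (mulTest a ha φ : (Fin n → ℝ) → ℂ) = fun x => a x * φ x := rfl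
  rw [h1, fderiv_fun_mul (ha x hx).differentiableAt (testFunction_differentiableAt φ x)]
  simp [partialFun]
  ring

theorem testPartial_comm (i j : Fin n) : Commute (testPartial V i) (testPartial V j) := by
  refine LinearMap.ext fun φ => DFunLike.ext _ _ fun x => ?_
  change testPartial V i (testPartial V j φ) x = testPartial V j (testPartial V i φ) x
  have h2 : ∀ i j : Fin n, testPartial V i (testPartial V j φ) x =
      fderiv ℝ (fderiv ℝ φ) x (Pi.single i 1) (Pi.single j 1) := by
    intro i j
    have h3 : (testPartial V j φ : (Fin n → ℝ) → ℂ) = fun y => fderiv ℝ φ y (Pi.single j 1) :=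
      funext fun y => testPartial_apply j φ y
    have h4 : DifferentiableAt ℝ (fderiv ℝ φ) x :=
      ((contDiff_infty.1 φ.contDiff 2).fderiv_right (m := 1) (by norm_num)).differentiable one_ne_zero x
    rw [testPartial_apply, h3, fderiv_clm_apply h4 (differentiableAt_const _)]
    simp
  rw [h2, h2]
  exact ((contDiff_infty.1 φ.contDiff 2).contDiffAt.isSymmSndFDerivAt (by simp)) _ _

/-- Extension by zero of test functions to a larger open set. -/
def extTest (_h : V' ≤ V) : 𝓓(V', ℂ) →L[ℂ] 𝓓(V, ℂ) := TestFunction.monoCLM ℂ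

@[simp] theorem extTest_apply (h : V' ≤ V) (φ : 𝓓(V', ℂ)) (x : Fin n → ℝ) :
    extTest h φ x = φ x := by
  simp [extTest, h]

theorem coe_extTest (h : V' ≤ V) (φ : 𝓓(V', ℂ)) :
    (extTest h φ : (Fin n → ℝ) → ℂ) = φ := funext (extTest_apply h φ)

theorem restrict_apply (h : V' ≤ V) (u : Distr V) (φ : 𝓓(V', ℂ)) :
    u.restrict h φ = u (extTest h φ) := rfl

theorem extTest_mulTest (h : V' ≤ V) {a : (Fin n → ℝ) → ℂ} (ha : AnalyticOnNhd ℝ a V)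
    (ha' : AnalyticOnNhd ℝ a V') (φ : 𝓓(V', ℂ)) :
    extTest h (mulTest a ha' φ) = mulTest a ha (extTest h φ) :=
  DFunLike.ext _ _ fun x => by simp

theorem extTest_testPartial (h : V' ≤ V) (i : Fin n) (φ : 𝓓(V', ℂ)) :
    extTest h (testPartial V' i φ) = testPartial V i (extTest h φ) :=
  DFunLike.ext _ _ fun x => by rw [extTest_apply, testPartial_apply, testPartial_apply, coe_extTest]

theorem extTest_extTest {V'' : Opens (Fin n → ℝ)} (h : V' ≤ V) (h' : V'' ≤ V') (φ : 𝓓(V'', ℂ)) :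
    extTest h (extTest h' φ) = extTest (h'.trans h) φ :=
  DFunLike.ext _ _ fun x => by simp

/-! ### Monomials in commuting operators -/

section MultiPow

variable {M : Type*} [Monoid M]

theorem multiPow_succ {d : ℕ} (D : Fin (d + 1) → M) (α : Fin (d + 1) → ℕ) :
    multiPow D α = D 0 ^ α 0 * multiPow (fun i => D i.succ) fun i => α i.succ := by
  simp [multiPow, List.ofFn_succ]

theorem multiPow_zero {d : ℕ} (D : Fin d → M) : multiPow D 0 = 1 := by
  induction d with
  | zero => simp [multiPow]
  | succ d ih =>
    rw [multiPow_succ]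
    have := ih fun i => D i.succ
    rw [Pi.zero_apply, pow_zero, one_mul]
    exact this

theorem multiPow_add_single {d : ℕ} (D : Fin d → M) (hD : ∀ i j, Commute (D i) (D j))
    (α : Fin d → ℕ) (i : Fin d) : multiPow D (α + Pi.single i 1) = D i * multiPow D α := by
  induction d with
  | zero => exact i.elim0
  | succ d ih =>
    rw [multiPow_succ, multiPow_succ]
    refine Fin.cases ?_ (fun i => ?_) i
    · simp [pow_succ', mul_assoc]
    · have h1 := ih (fun i => D i.succ) (fun _ _ => hD _ _) (fun i => α i.succ) i
      have h2 : (fun j : Fin d => (α + Pi.single i.succ 1 : Fin (d + 1) → ℕ) j.succ) =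
          (fun j => α j.succ) + Pi.single i 1 := by
        funext j
        simp [Pi.single_apply]
      rw [h2, h1, ← mul_assoc, ← mul_assoc]
      congr 1
      have h3 : (α + Pi.single i.succ 1 : Fin (d + 1) → ℕ) 0 = α 0 := by
        simp [(Fin.succ_ne_zero i).symm]
      rw [h3]
      exact ((hD i.succ 0).pow_right (α 0)).eq.symm

theorem commute_multiPow {d : ℕ} {x : M} {D : Fin d → M} (hD : ∀ i, Commute x (D i))
    (α : Fin d → ℕ) : Commute x (multiPow D α) := by
  induction d with
  | zero => simp [multiPow]
  | succ d ih =>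
    rw [multiPow_succ]
    exact ((hD 0).pow_right _).mul_right (ih (fun i => hD i.succ) _)

end MultiPow

theorem map_multiPow {A B : Type*} [AddCommGroup A] [Module ℂ A] [AddCommGroup B] [Module ℂ B]
    (g : A → B) {d : ℕ} {D : Fin d → Module.End ℂ A} {D' : Fin d → Module.End ℂ B}
    (h : ∀ i a, g (D i a) = D' i (g a)) (α : Fin d → ℕ) (a : A) :
    g (multiPow D α a) = multiPow D' α (g a) := by
  induction d with
  | zero => simp [multiPow]
  | succ d ih =>
    have h1 : ∀ (k : ℕ) (a : A), g ((D 0 ^ k) a) = (D' 0 ^ k) (g a) := by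
      intro k
      induction k with
      | zero => simp
      | succ k ihk =>
        intro a
        rw [pow_succ', pow_succ', Module.End.mul_apply, Module.End.mul_apply, h, ihk]
    rw [multiPow_succ, multiPow_succ, Module.End.mul_apply, Module.End.mul_apply, h1,
      ih (fun i => h i.succ)]

end

section

/-! ### Differential operators and their transposes -/

variable {n : ℕ} {V V' : Opens (Fin n → ℝ)}

/-- The standard chart of `ℝⁿ`. -/
def idChart (n : ℕ) : GermChart n where
  F := id
  G := id
  hF := analyticAt_id
  hG := analyticAt_id
  hGF := Eventually.of_forall fun _ => rfl
  hFG := Eventually.of_forall fun _ => rfl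

theorem idChart_dop (i : Fin n) : (idChart n).dop i = DiffOpGerm.partialD i := by
  rw [GermChart.partialD_eq, GermChart.dop]
  congr 1
  funext x
  simp [GermChart.field, idChart]

theorem partialD_comm (i j : Fin n) :
    Commute (DiffOpGerm.partialD i) (DiffOpGerm.partialD j) := by
  rw [← idChart_dop, ← idChart_dop]
  exact (idChart n).dop_comm i j

theorem partialD_mul_ofFun (i : Fin n) {a : (Fin n → ℝ) → ℂ} (ha : AnalyticAt ℝ a 0) :
    DiffOpGerm.partialD i * DiffOpGerm.ofFun a ha = DiffOpGerm.ofFun a ha * DiffOpGerm.partialD i +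
      DiffOpGerm.ofFun (partialFun i a) (partialFun_analyticAt i ha) := by
  have := (idChart n).dop_mul i (AnalyticGerm.mk a ha)
  rw [idChart_dop] at this
  exact this

theorem ofFun_mul_ofFun {a b : (Fin n → ℝ) → ℂ} (ha : AnalyticAt ℝ a 0) (hb : AnalyticAt ℝ b 0) :
    DiffOpGerm.ofFun a ha * DiffOpGerm.ofFun b hb =
      DiffOpGerm.ofFun (fun x => a x * b x) (ha.mul hb) :=
  (map_mul (DiffOpGerm.ofGerm n) _ _).symm

/-- Induction principle: `𝒟₀` is spanned by `1` under left multiplication by functions and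
derivations. -/
theorem diffOpGerm_induction (S : AddSubgroup (DiffOpGerm n)) (h1 : 1 ∈ S)
    (hO : ∀ a ha, ∀ P ∈ S, DiffOpGerm.ofFun a ha * P ∈ S)
    (hw : ∀ i, ∀ P ∈ S, DiffOpGerm.partialD i * P ∈ S) (P : DiffOpGerm n) : P ∈ S := by
  refine (idChart n).mem_of_closed S h1 (fun a P hP => ?_) (fun i P hP => ?_) P
  · obtain ⟨h, hh, rfl⟩ := AnalyticGerm.exists_mk a
    exact hO h hh P hP
  · rw [idChart_dop]
    exact hw i P hP

/-- A left ideal criterion for additive subgroups of `𝒟₀`. -/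
theorem mul_mem_of_closed (S : AddSubgroup (DiffOpGerm n))
    (hO : ∀ a ha, ∀ P ∈ S, DiffOpGerm.ofFun a ha * P ∈ S)
    (hw : ∀ i, ∀ P ∈ S, DiffOpGerm.partialD i * P ∈ S) (P Q : DiffOpGerm n) (hQ : Q ∈ S) :
    P * Q ∈ S := by
  refine diffOpGerm_induction (S.comap (AddMonoidHom.mulRight Q)) ?_ ?_ ?_ P
  · change 1 * Q ∈ S
    rwa [one_mul]
  · intro a ha P hP
    change _ * P * Q ∈ S
    rw [mul_assoc]
    exact hO a ha _ hP
  · intro i P hP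
    change _ * P * Q ∈ S
    rw [mul_assoc]
    exact hw i _ hP

/-- On `V` there is a differential operator with germ `P` and transpose `τ`. -/
def Represents (V : Opens (Fin n → ℝ)) (P : DiffOpGerm n) (τ : 𝓓(V, ℂ) → 𝓓(V, ℂ)) : Prop :=
  ∃ (h0 : (0 : Fin n → ℝ) ∈ V) (Q : DiffOp V), Q.germ h0 = P ∧ ∀ φ, Q.transpose φ = τ φ

namespace Represents

/-- Families of coefficients, possibly with repeated multi-indices. -/
theorem of_sum (h0 : (0 : Fin n → ℝ) ∈ V) {ι : Type*} (J : Finset ι) (α : ι → Fin n → ℕ)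
    (a : ι → (Fin n → ℝ) → ℂ) (ha : ∀ j, AnalyticOnNhd ℝ (a j) V) :
    Represents V (∑ j ∈ J, DiffOpGerm.ofFun (a j) (ha j 0 h0) * multiPow DiffOpGerm.partialD (α j))
      (fun φ => ∑ j ∈ J, ((-1 : ℂ) ^ (∑ i, α j i)) •
        multiPow (testPartial V) (α j) (mulTest (a j) (ha j) φ)) := by
  classical
  have hb : ∀ β : Fin n → ℕ, AnalyticOnNhd ℝ (fun x => ∑ j ∈ J with α j = β, a j x) V :=
    fun β x hx => Finset.analyticAt_fun_sum _ fun j _ => ha j x hx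
  refine ⟨h0, ⟨J.image α, fun β x => ∑ j ∈ J with α j = β, a j x, hb⟩, ?_, fun φ => ?_⟩
  · rw [DiffOp.germ, ← Finset.sum_fiberwise_of_maps_to (g := α) (t := J.image α)
      (fun j hj => Finset.mem_image_of_mem _ hj)]
    refine Finset.sum_congr rfl fun β _ => ?_
    have h1 : DiffOpGerm.ofFun (fun x => ∑ j ∈ J with α j = β, a j x) (hb β 0 h0) =
        ∑ j ∈ J with α j = β, DiffOpGerm.ofFun (a j) (ha j 0 h0) := by
      simp only [DiffOpGerm.ofFun_eq]
      rw [← map_sum, AnalyticGerm.mk_sum]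
    refine (congrArg (· * multiPow DiffOpGerm.partialD β) h1).trans ?_
    rw [Finset.sum_mul]
    exact Finset.sum_congr rfl fun j hj => by rw [(Finset.mem_filter.1 hj).2]
  · beta_reduce
    rw [DiffOp.transpose, ← Finset.sum_fiberwise_of_maps_to (g := α) (t := J.image α)
      (fun j hj => Finset.mem_image_of_mem _ hj)]
    refine Finset.sum_congr rfl fun β _ => ?_
    have h1 : mulTest (fun x => ∑ j ∈ J with α j = β, a j x) (hb β) φ =
        ∑ j ∈ J with α j = β, mulTest (a j) (ha j) φ :=
      DFunLike.ext _ _ fun x => by simp [Finset.sum_mul]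
    refine (congrArg (fun ψ => (-1 : ℂ) ^ (∑ i, β i) • multiPow (testPartial V) β ψ) h1).trans ?_
    rw [map_sum, Finset.smul_sum]
    exact Finset.sum_congr rfl fun j hj => by rw [(Finset.mem_filter.1 hj).2]

theorem congr {P P' : DiffOpGerm n} {τ τ' : 𝓓(V, ℂ) → 𝓓(V, ℂ)} (h : Represents V P τ)
    (hP : P = P') (hτ : ∀ φ, τ φ = τ' φ) : Represents V P' τ' := by
  obtain ⟨h0, Q, h1, h2⟩ := h
  exact ⟨h0, Q, h1.trans hP, fun φ => (h2 φ).trans (hτ φ)⟩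

theorem one (h0 : (0 : Fin n → ℝ) ∈ V) : Represents V 1 id := by
  refine (of_sum h0 ({()} : Finset Unit) (fun _ => 0) (fun _ _ => 1)
    (fun _ _ _ => analyticAt_const)).congr ?_ fun φ => ?_
  · rw [Finset.sum_singleton, multiPow_zero, mul_one]
    exact DiffOpGerm.ext_act fun b => one_mul b
  · rw [Finset.sum_singleton, multiPow_zero]
    refine DFunLike.ext _ _ fun x => ?_
    simp only [Pi.zero_apply, Finset.sum_const_zero, pow_zero, one_smul, Module.End.one_apply]
    exact one_mul _

theorem add {P P' : DiffOpGerm n} {τ τ' : 𝓓(V, ℂ) → 𝓓(V, ℂ)} (h : Represents V P τ)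
    (h' : Represents V P' τ') : Represents V (P + P') (fun φ => τ φ + τ' φ) := by
  obtain ⟨h0, Q, rfl, h2⟩ := h
  obtain ⟨-, Q', rfl, h2'⟩ := h'
  refine (of_sum h0 (Q.support.disjSum Q'.support) (Sum.elim id id) (Sum.elim Q.coeff Q'.coeff)
    (by rintro (α | α); exacts [Q.analytic α, Q'.analytic α])).congr ?_ fun φ => ?_
  · rw [Finset.sum_disjSum]; rfl
  · rw [Finset.sum_disjSum, ← h2, ← h2']; rfl

theorem zero (h0 : (0 : Fin n → ℝ) ∈ V) : Represents V 0 (fun _ => 0) :=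
  (of_sum h0 (∅ : Finset Unit) (fun _ => 0) (fun _ _ => 1)
    (fun _ _ _ => analyticAt_const)).congr rfl fun _ => rfl

theorem sum (h0 : (0 : Fin n → ℝ) ∈ V) {ι : Type*} (J : Finset ι) {P : ι → DiffOpGerm n}
    {τ : ι → 𝓓(V, ℂ) → 𝓓(V, ℂ)} (h : ∀ j ∈ J, Represents V (P j) (τ j)) :
    Represents V (∑ j ∈ J, P j) (fun φ => ∑ j ∈ J, τ j φ) := by
  classical
  induction J using Finset.induction_on with
  | empty => simpa using zero h0
  | insert i J hi ih =>
    simp only [Finset.sum_insert hi]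
    exact (h i (Finset.mem_insert_self _ _)).add
      (ih fun j hj => h j (Finset.mem_insert_of_mem hj))

theorem ofFun_mul (h0 : (0 : Fin n → ℝ) ∈ V) {P : DiffOpGerm n} {τ : 𝓓(V, ℂ) → 𝓓(V, ℂ)}
    (h : Represents V P τ) {a : (Fin n → ℝ) → ℂ} (ha : AnalyticOnNhd ℝ a V) :
    Represents V (DiffOpGerm.ofFun a (ha 0 h0) * P) (fun φ => τ (mulTest a ha φ)) := by
  obtain ⟨-, Q, rfl, h2⟩ := h
  refine (of_sum h0 Q.support id (fun α x => Q.coeff α x * a x)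
    (fun α => (Q.analytic α).mul ha)).congr ?_ fun φ => ?_
  · rw [DiffOp.germ, Finset.mul_sum]
    refine Finset.sum_congr rfl fun α _ => ?_
    rw [← mul_assoc]
    congr 1
    rw [ofFun_mul_ofFun]
    simp only [mul_comm (a _)]
  · rw [← h2, DiffOp.transpose]
    refine Finset.sum_congr rfl fun α _ => ?_
    rw [mulTest_mulTest]
    rfl

theorem neg {P : DiffOpGerm n} {τ : 𝓓(V, ℂ) → 𝓓(V, ℂ)} (h : Represents V P τ) :
    Represents V (-P) (fun φ => -τ φ) := by
  obtain ⟨h0, Q, rfl, h2⟩ := h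
  refine (ofFun_mul h0 ⟨h0, Q, rfl, h2⟩ (a := fun _ => -1) analyticOnNhd_const).congr ?_
    fun φ => ?_
  · refine DiffOpGerm.ext_act fun b => ?_
    change (-1) * dact (Q.germ h0) b = -dact (Q.germ h0) b
    rw [neg_one_mul]
  · rw [← h2, ← h2, DiffOp.transpose, DiffOp.transpose, ← Finset.sum_neg_distrib]
    refine Finset.sum_congr rfl fun α _ => ?_
    rw [← smul_neg, ← map_neg]
    congr 2
    refine DFunLike.ext _ _ fun x => ?_
    change Q.coeff α x * (-1 * φ x) = -(Q.coeff α x * φ x)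
    ring

theorem partialD_mul (i : Fin n) {P : DiffOpGerm n} {τ : 𝓓(V, ℂ) → 𝓓(V, ℂ)}
    (h : Represents V P τ) :
    Represents V (DiffOpGerm.partialD i * P) (fun φ => τ (-testPartial V i φ)) := by
  obtain ⟨h0, Q, rfl, h2⟩ := h
  have h3 := (of_sum h0 Q.support (fun α => α + Pi.single i 1) Q.coeff Q.analytic).add
    (of_sum h0 Q.support id (fun α => partialFun i (Q.coeff α))
      fun α => analyticOnNhd_partialFun (Q.analytic α) i)
  refine h3.congr ?_ fun φ => ?_
  · rw [DiffOp.germ, Finset.mul_sum, ← Finset.sum_add_distrib]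
    refine Finset.sum_congr rfl fun α _ => ?_
    rw [multiPow_add_single _ partialD_comm, ← mul_assoc, ← mul_assoc, partialD_mul_ofFun i, add_mul]
    rfl
  · rw [← h2, DiffOp.transpose, ← Finset.sum_add_distrib]
    refine Finset.sum_congr rfl fun α _ => ?_
    rw [multiPow_add_single _ testPartial_comm, mulTest_neg, map_neg,
      (commute_multiPow (testPartial_comm i) α).eq, Module.End.mul_apply]
    rw [testPartial_mulTest, map_add]
    have : ∑ l, (α + Pi.single i 1 : Fin n → ℕ) l = (∑ l, α l) + 1 := by
      simp [Finset.sum_add_distrib]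
    rw [this, pow_succ]
    simp only [id, mul_neg, mul_one, neg_smul, smul_add, smul_neg]
    abel

theorem ofFun (h0 : (0 : Fin n → ℝ) ∈ V) {a : (Fin n → ℝ) → ℂ} (ha : AnalyticOnNhd ℝ a V) :
    Represents V (DiffOpGerm.ofFun a (ha 0 h0)) (mulTest a ha) :=
  (ofFun_mul h0 (one h0) ha).congr (mul_one _) fun _ => rfl

theorem linear {P : DiffOpGerm n} {τ : 𝓓(V, ℂ) → 𝓓(V, ℂ)} (h : Represents V P τ) (φ ψ : 𝓓(V, ℂ)) :
    τ (φ + ψ) = τ φ + τ ψ := by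
  obtain ⟨h0, Q, rfl, h2⟩ := h
  rw [← h2, ← h2, ← h2, DiffOp.transpose, DiffOp.transpose, DiffOp.transpose,
    ← Finset.sum_add_distrib]
  exact Finset.sum_congr rfl fun α _ => by rw [mulTest_add, map_add, smul_add]

theorem restrict (h0 : (0 : Fin n → ℝ) ∈ V') (hV : V' ≤ V) {P : DiffOpGerm n}
    {τ : 𝓓(V, ℂ) → 𝓓(V, ℂ)} (h : Represents V P τ) :
    ∃ τ' : 𝓓(V', ℂ) → 𝓓(V', ℂ), Represents V' P τ' ∧ ∀ φ, extTest hV (τ' φ) = τ (extTest hV φ) := by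
  obtain ⟨-, Q, rfl, h2⟩ := h
  let Q' : DiffOp V' := ⟨Q.support, Q.coeff, fun α => (Q.analytic α).mono hV⟩
  refine ⟨Q'.transpose, ⟨h0, Q', rfl, fun _ => rfl⟩, fun φ => ?_⟩
  rw [← h2, DiffOp.transpose, DiffOp.transpose, map_sum]
  refine Finset.sum_congr rfl fun α _ => ?_
  rw [map_smul, map_multiPow (extTest hV) (extTest_testPartial hV), ← extTest_mulTest]

end Represents

/-! ### The coefficients of a differential operator are determined by its germ -/

/-- The exponential function `x ↦ exp (∑ ξᵢ xᵢ)`. -/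
def expFun (ξ : Fin n → ℂ) (x : Fin n → ℝ) : ℂ := Complex.exp (∑ i, ξ i * x i)

theorem expFun_analyticAt (ξ : Fin n → ℂ) (x : Fin n → ℝ) : AnalyticAt ℝ (expFun ξ) x := by
  have h1 : AnalyticAt ℝ (fun x : Fin n → ℝ => ∑ i, ξ i * (x i : ℂ)) x :=
    Finset.analyticAt_fun_sum _ fun i _ =>
      analyticAt_const.mul (GermChart.coordFun_analyticAt i x)
  exact AnalyticAt.comp (g := Complex.exp) (analyticAt_cexp.restrictScalars (𝕜 := ℝ)) h1

theorem partialFun_expFun (ξ : Fin n → ℂ) (i : Fin n) (x : Fin n → ℝ) :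
    partialFun i (expFun ξ) x = ξ i * expFun ξ x := by
  have h1 : HasFDerivAt (fun x : Fin n → ℝ => ∑ j, ξ j * (x j : ℂ))
      (∑ j, ξ j • Complex.ofRealCLM.comp
        (ContinuousLinearMap.proj (R := ℝ) (φ := fun _ : Fin n => ℝ) j)) x := by
    refine HasFDerivAt.fun_sum fun j _ => ?_
    exact (Complex.ofRealCLM.comp
      (ContinuousLinearMap.proj (R := ℝ) (φ := fun _ : Fin n => ℝ) j)).hasFDerivAt.const_mul (ξ j)
  have h2 := h1.cexp
  rw [partialFun]
  change fderiv ℝ (fun x : Fin n → ℝ => Complex.exp (∑ i, ξ i * x i)) x _ = _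
  rw [h2.fderiv]
  have h3 : ∑ j, ξ j * ((if j = i then 1 else 0 : ℝ) : ℂ) = ξ i := by
    simp [apply_ite ((↑) : ℝ → ℂ)]
  simp [sum_apply, Pi.single_apply, expFun, h3, mul_comm (ξ i)]

/-- Constants as germs. -/
def constGerm (n : ℕ) : ℂ →+* AnalyticGerm n where
  toFun c := AnalyticGerm.mk (fun _ => c) analyticAt_const
  map_one' := rfl
  map_zero' := rfl
  map_add' _ _ := rfl
  map_mul' _ _ := rfl

/-- A common eigenvector of the `D i` is an eigenvector of each of their monomials. -/
theorem dact_multiPow_of_eigen {d : ℕ} (D : Fin d → DiffOpGerm n) (ξ : Fin d → ℂ)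
    (E : AnalyticGerm n) (h1 : ∀ i, dact (D i) E = constGerm n (ξ i) * E)
    (h2 : ∀ i c a, dact (D i) (constGerm n c * a) = constGerm n c * dact (D i) a) (α : Fin d → ℕ) :
    dact (multiPow D α) E = constGerm n (∏ i, ξ i ^ α i) * E := by
  induction d with
  | zero => simp [multiPow]
  | succ d ih =>
    have h3 : ∀ (k : ℕ) c, dact (D 0 ^ k) (constGerm n c * E) =
        constGerm n (ξ 0 ^ k * c) * E := by
      intro k
      induction k with
      | zero => simp
      | succ k ihk =>
        intro c
        rw [pow_succ', dact_mul, ihk, h2, h1, ← mul_assoc, ← map_mul]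
        congr 2
        ring
    rw [multiPow_succ, dact_mul, ih _ (fun i => ξ i.succ) (fun i => h1 i.succ) (fun i => h2 i.succ),
      h3, Fin.prod_univ_succ]

theorem dact_multiPow_expFun (ξ : Fin n → ℂ) (α : Fin n → ℕ) :
    dact (multiPow DiffOpGerm.partialD α) (AnalyticGerm.mk (expFun ξ) (expFun_analyticAt ξ 0)) =
      constGerm n (∏ i, ξ i ^ α i) * AnalyticGerm.mk (expFun ξ) (expFun_analyticAt ξ 0) := by
  refine dact_multiPow_of_eigen _ _ _ (fun i => ?_) (fun i c a => ?_) α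
  · rw [dact_partialD]
    exact AnalyticGerm.mk_eq_iff (hk := analyticAt_const.mul (expFun_analyticAt ξ 0)).2
      (Eventually.of_forall fun x => partialFun_expFun ξ i x)
  · have h3 := congrArg (fun P => dact P a) (partialD_mul_ofFun i
      (analyticAt_const : AnalyticAt ℝ (fun _ : Fin n → ℝ => c) 0))
    have h4 : DiffOpGerm.ofFun (partialFun i fun _ : Fin n → ℝ => c)
        (partialFun_analyticAt i analyticAt_const) = 0 := by
      rw [DiffOpGerm.ofFun_eq, ← map_zero (DiffOpGerm.ofGerm n)]
      congr 1
      exact AnalyticGerm.mk_eq_iff (hk := analyticAt_const).2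
        (Eventually.of_forall fun x => by simp [partialFun])
    rw [h4, add_zero] at h3
    exact h3

/-- A polynomial function vanishing on a large enough grid has zero coefficients. -/
theorem coeff_eq_zero_of_grid (s : Finset (Fin n → ℕ)) {d : ℕ} (hd : ∀ α ∈ s, ∀ i, α i ≤ d)
    (b : (Fin n → ℕ) → ℂ)
    (h : ∀ ξ : Fin n → Fin (d + 1), ∑ α ∈ s, b α * ∏ i, ((ξ i : ℕ) : ℂ) ^ α i = 0) :
    ∀ α ∈ s, b α = 0 := by
  classical
  set p : MvPolynomial (Fin n) ℂ :=
    ∑ α ∈ s, MvPolynomial.monomial (Finsupp.equivFunOnFinite.symm α) (b α) with hp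
  have hp0 : p = 0 := by
    refine MvPolynomial.eq_zero_of_eval_zero_at_prod_finset p
      (fun _ => (Finset.univ : Finset (Fin (d + 1))).image fun j : Fin (d + 1) => ((j : ℕ) : ℂ)) (fun i => ?_)
      fun x hx => ?_
    · rw [Finset.card_image_of_injective, Finset.card_univ, Fintype.card_fin, Nat.lt_succ_iff]
      · refine (MvPolynomial.degreeOf_sum_le i s _).trans (Finset.sup_le fun α hα => ?_)
        by_cases hb : b α = 0
        · simp [hb]
        · rw [MvPolynomial.degreeOf_monomial_eq _ _ hb]
          exact hd α hα i
      · intro j k hjk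
        exact Fin.ext (Nat.cast_injective (R := ℂ) hjk)
    · simp only [Finset.mem_image, Finset.mem_univ, true_and] at hx
      choose ξ hξ using hx
      rw [hp, map_sum, ← h ξ]
      refine Finset.sum_congr rfl fun α _ => ?_
      rw [MvPolynomial.eval_monomial, Finsupp.prod_fintype _ _ (by simp)]
      simp [hξ]
  intro α hα
  have h1 := congrArg (MvPolynomial.coeff (Finsupp.equivFunOnFinite.symm α)) hp0
  rw [hp, MvPolynomial.coeff_sum, MvPolynomial.coeff_zero] at h1
  simp only [MvPolynomial.coeff_monomial, EmbeddingLike.apply_eq_iff_eq] at h1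
  rw [Finset.sum_ite_eq' s α, if_pos hα] at h1
  exact h1

/-- The coefficients of a differential operator with zero germ vanish near `0`. -/
theorem eventually_coeff_eq_zero (s : Finset (Fin n → ℕ)) (b : (Fin n → ℕ) → (Fin n → ℝ) → ℂ)
    (hb : ∀ α, AnalyticAt ℝ (b α) 0)
    (h : ∑ α ∈ s, DiffOpGerm.ofFun (b α) (hb α) * multiPow DiffOpGerm.partialD α = 0) :
    ∀ᶠ x in 𝓝 0, ∀ α ∈ s, b α x = 0 := by
  have h1 : ∀ ξ : Fin n → ℂ, ∀ᶠ x in 𝓝 0, ∑ α ∈ s, b α x * ∏ i, ξ i ^ α i = 0 := by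
    intro ξ
    have h2 := congrArg (fun P => dact P (AnalyticGerm.mk (expFun ξ) (expFun_analyticAt ξ 0))) h
    simp only [dact_zero, dact_sum, dact_mul, dact_multiPow_expFun, DiffOpGerm.ofFun_eq,
      dact_ofGerm, ← mul_assoc] at h2
    rw [← Finset.sum_mul] at h2
    have h3 : IsUnit (AnalyticGerm.mk (expFun ξ) (expFun_analyticAt ξ 0)) :=
      AnalyticGerm.isUnit_of_eval0_ne_zero (by
        rw [AnalyticGerm.eval0_mk]; exact Complex.exp_ne_zero _)
    rw [h3.mul_left_eq_zero] at h2
    have h4 : ∑ α ∈ s, AnalyticGerm.mk (b α) (hb α) * constGerm n (∏ i, ξ i ^ α i) =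
        AnalyticGerm.mk (fun x => ∑ α ∈ s, b α x * ∏ i, ξ i ^ α i)
          (Finset.analyticAt_fun_sum _ fun α _ => (hb α).mul analyticAt_const) := by
      rw [← AnalyticGerm.mk_sum s (fun α x => b α x * ∏ i, ξ i ^ α i)
        fun α => (hb α).mul analyticAt_const]
      rfl
    rw [h4] at h2
    exact (AnalyticGerm.mk_eq_iff (hk := analyticAt_const)).1 h2
  obtain ⟨d, hd⟩ : ∃ d, ∀ α ∈ s, ∀ i, α i ≤ d := by
    refine ⟨s.sup fun α => Finset.univ.sup α, fun α hα i => ?_⟩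
    exact (Finset.le_sup (f := α) (Finset.mem_univ i)).trans
      (Finset.le_sup (f := fun α => Finset.univ.sup α) hα)
  have h5 := eventually_all.2 fun ξ : Fin n → Fin (d + 1) => h1 fun i => ((ξ i : ℕ) : ℂ)
  filter_upwards [h5] with x hx
  exact coeff_eq_zero_of_grid s hd (fun α => b α x) hx

/-- Two transposes of the same germ agree on a small neighbourhood of `0`. -/
theorem Represents.unique {P : DiffOpGerm n} {τ τ' : 𝓓(V, ℂ) → 𝓓(V, ℂ)} (h : Represents V P τ)
    (h' : Represents V P τ') : ∃ (V' : Opens (Fin n → ℝ)) (hV : V' ≤ V), (0 : Fin n → ℝ) ∈ V' ∧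
      ∀ φ : 𝓓(V', ℂ), τ (extTest hV φ) = τ' (extTest hV φ) := by
  obtain ⟨h0, Q, hQ, hτ⟩ := (h'.neg.add h).congr (neg_add_cancel P) fun φ => rfl
  have h1 := eventually_coeff_eq_zero Q.support Q.coeff (fun α => Q.analytic α 0 h0) hQ
  obtain ⟨W, hW, hWo, hW0⟩ := eventually_nhds_iff.1 h1
  refine ⟨⟨W, hWo⟩ ⊓ V, inf_le_right, ⟨hW0, h0⟩, fun φ => ?_⟩
  have h2 := hτ (extTest inf_le_right φ)
  rw [DiffOp.transpose, Finset.sum_eq_zero] at h2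
  · exact (neg_add_eq_zero.1 h2.symm).symm
  · intro α hα
    have : mulTest (Q.coeff α) (Q.analytic α) (extTest inf_le_right φ) = 0 := by
      refine DFunLike.ext _ _ fun x => ?_
      rw [mulTest_apply, extTest_apply]
      by_cases hx : x ∈ W
      · rw [hW x hx α hα, zero_mul]; rfl
      · rw [testFunction_eq_zero φ (fun h => hx h.1), mul_zero]; rfl
    rw [this, map_zero, smul_zero]

/-! ### Annihilators -/

theorem mem_annihilator {u : Distr V} {P : DiffOpGerm n} : P ∈ annihilator u ↔
    ∃ (V' : Opens (Fin n → ℝ)) (hV : V' ≤ V) (τ : 𝓓(V', ℂ) → 𝓓(V', ℂ)), Represents V' P τ ∧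
      ∀ φ, u (extTest hV (τ φ)) = 0 := by
  constructor
  · rintro ⟨V', h0, hV, Q, hQ, h⟩
    exact ⟨V', hV, Q.transpose, ⟨h0, Q, hQ, fun _ => rfl⟩, h⟩
  · rintro ⟨V', hV, τ, ⟨h0, Q, hQ, hτ⟩, h⟩
    exact ⟨V', h0, hV, Q, hQ, fun φ => by rw [restrict_apply, hτ, h]⟩

theorem Represents.zero_mem {P : DiffOpGerm n} {τ : 𝓓(V, ℂ) → 𝓓(V, ℂ)} (h : Represents V P τ) :
    (0 : Fin n → ℝ) ∈ V := h.1

/-- The annihilator, tested with a given representation of the operator. -/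
theorem exists_of_mem_annihilator {u : Distr V} {P : DiffOpGerm n} (hP : P ∈ annihilator u)
    (hV : V' ≤ V) {τ : 𝓓(V', ℂ) → 𝓓(V', ℂ)} (h : Represents V' P τ) :
    ∃ (W : Opens (Fin n → ℝ)) (hW : W ≤ V'), (0 : Fin n → ℝ) ∈ W ∧
      ∀ φ : 𝓓(W, ℂ), u (extTest hV (τ (extTest hW φ))) = 0 := by
  obtain ⟨V₁, hV₁, τ₁, h₁, hu⟩ := mem_annihilator.1 hP
  have h0 : (0 : Fin n → ℝ) ∈ V' ⊓ V₁ := ⟨h.zero_mem, h₁.zero_mem⟩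
  obtain ⟨σ, hσ, hσ'⟩ := h.restrict h0 inf_le_left
  obtain ⟨σ₁, hσ₁, hσ₁'⟩ := h₁.restrict h0 inf_le_right
  obtain ⟨W, hW, hW0, hWσ⟩ := hσ.unique hσ₁
  refine ⟨W, hW.trans inf_le_left, hW0, fun φ => ?_⟩
  rw [← extTest_extTest inf_le_left hW, ← hσ', hWσ, extTest_extTest,
    ← extTest_extTest hV₁ inf_le_right, hσ₁']
  exact hu _

theorem add_mem_annihilator {u : Distr V} {P Q : DiffOpGerm n} (hP : P ∈ annihilator u)
    (hQ : Q ∈ annihilator u) : P + Q ∈ annihilator u := by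
  obtain ⟨V₁, hV₁, τ₁, h₁, hu⟩ := mem_annihilator.1 hP
  obtain ⟨V₂, hV₂, τ₂, h₂, hu₂⟩ := mem_annihilator.1 hQ
  have h0 : (0 : Fin n → ℝ) ∈ V₁ ⊓ V₂ := ⟨h₁.zero_mem, h₂.zero_mem⟩
  obtain ⟨σ₁, hσ₁, hσ₁'⟩ := h₁.restrict h0 inf_le_left
  obtain ⟨σ₂, hσ₂, hσ₂'⟩ := h₂.restrict h0 inf_le_right
  refine mem_annihilator.2 ⟨V₁ ⊓ V₂, inf_le_left.trans hV₁, _, hσ₁.add hσ₂, fun φ => ?_⟩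
  rw [map_add, map_add, ← extTest_extTest hV₁ inf_le_left, hσ₁', hu, zero_add]
  have : extTest (inf_le_left.trans hV₁) (σ₂ φ) = extTest hV₂ (extTest inf_le_right (σ₂ φ)) := by
    rw [extTest_extTest]
  rw [this, hσ₂', hu₂]

/-- The annihilator of a distribution on a neighbourhood of `0`, as a left ideal. -/
def annIdeal (h0 : (0 : Fin n → ℝ) ∈ V) (u : Distr V) : Ideal (DiffOpGerm n) :=
  let S : AddSubgroup (DiffOpGerm n) :=
    { carrier := annihilator u
      add_mem' := add_mem_annihilator
      zero_mem' := mem_annihilator.2 ⟨V, le_rfl, _, Represents.zero h0, fun φ => by simp⟩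
      neg_mem' := by
        intro P hP
        obtain ⟨V₁, hV₁, τ₁, h₁, hu⟩ := mem_annihilator.1 hP
        exact mem_annihilator.2 ⟨V₁, hV₁, _, h₁.neg, fun φ => by rw [map_neg, map_neg, hu, neg_zero]⟩ }
  { carrier := annihilator u
    add_mem' := add_mem_annihilator
    zero_mem' := S.zero_mem
    smul_mem' := by
      refine mul_mem_of_closed S (fun a ha P hP => ?_) (fun i P hP => ?_)
      · obtain ⟨V₁, hV₁, τ₁, h₁, hu⟩ := mem_annihilator.1 hP
        obtain ⟨W, hW, hWo, hW0⟩ := eventually_nhds_iff.1 ha.eventually_analyticAt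
        have h0' : (0 : Fin n → ℝ) ∈ V₁ ⊓ ⟨W, hWo⟩ := ⟨h₁.zero_mem, hW0⟩
        obtain ⟨σ₁, hσ₁, hσ₁'⟩ := h₁.restrict h0' inf_le_left
        refine mem_annihilator.2 ⟨_, inf_le_left.trans hV₁, _,
          Represents.ofFun_mul h0' hσ₁ (a := a) (fun x hx => hW x hx.2), fun φ => ?_⟩
        rw [← extTest_extTest hV₁ inf_le_left, hσ₁', hu]
      · obtain ⟨V₁, hV₁, τ₁, h₁, hu⟩ := mem_annihilator.1 hP
        exact mem_annihilator.2 ⟨V₁, hV₁, _, h₁.partialD_mul i, fun φ => hu _⟩ }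

/-- Every germ `P` has a representation, and composing it with one of `B` gives one of `P * B`. -/
theorem exists_represents_mul {B : DiffOpGerm n} {σ : 𝓓(V, ℂ) → 𝓓(V, ℂ)} (hB : Represents V B σ)
    (P : DiffOpGerm n) : ∃ (V' : Opens (Fin n → ℝ)) (hV : V' ≤ V) (τ τ' : 𝓓(V', ℂ) → 𝓓(V', ℂ)),
      Represents V' P τ ∧ Represents V' (P * B) τ' ∧
        ∀ φ, extTest hV (τ' φ) = σ (extTest hV (τ φ)) := by
  let S : AddSubgroup (DiffOpGerm n) :=
    { carrier := {P | ∃ (V' : Opens (Fin n → ℝ)) (hV : V' ≤ V) (τ τ' : 𝓓(V', ℂ) → 𝓓(V', ℂ)),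
        Represents V' P τ ∧ Represents V' (P * B) τ' ∧
          ∀ φ, extTest hV (τ' φ) = σ (extTest hV (τ φ))}
      add_mem' := by
        rintro P Q ⟨V₁, hV₁, τ₁, τ₁', h₁, h₁', hu₁⟩ ⟨V₂, hV₂, τ₂, τ₂', h₂, h₂', hu₂⟩
        have h0 : (0 : Fin n → ℝ) ∈ V₁ ⊓ V₂ := ⟨h₁.zero_mem, h₂.zero_mem⟩
        obtain ⟨σ₁, hσ₁, e₁⟩ := h₁.restrict h0 inf_le_left
        obtain ⟨σ₂, hσ₂, e₂⟩ := h₂.restrict h0 inf_le_right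
        obtain ⟨σ₁', hσ₁', e₁'⟩ := h₁'.restrict h0 inf_le_left
        obtain ⟨σ₂', hσ₂', e₂'⟩ := h₂'.restrict h0 inf_le_right
        refine ⟨V₁ ⊓ V₂, inf_le_left.trans hV₁, _, _, hσ₁.add hσ₂,
          (hσ₁'.add hσ₂').congr (add_mul _ _ _).symm fun _ => rfl, fun φ => ?_⟩
        rw [map_add, map_add, hB.linear]
        congr 1
        · rw [← extTest_extTest hV₁ inf_le_left, e₁', hu₁, ← extTest_extTest hV₁ inf_le_left, e₁]
        · have : ∀ ψ : 𝓓(V₁ ⊓ V₂, ℂ), extTest (inf_le_left.trans hV₁) ψ =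
              extTest hV₂ (extTest inf_le_right ψ) := fun ψ => by rw [extTest_extTest]
          rw [this, this, e₂', hu₂, e₂]
      zero_mem' := by
        refine ⟨V, le_rfl, _, _, Represents.zero hB.zero_mem,
          (Represents.zero hB.zero_mem).congr (zero_mul _).symm fun _ => rfl, fun φ => ?_⟩
        have := hB.linear 0 0
        rw [add_zero, left_eq_add] at this
        simp [this]
      neg_mem' := by
        rintro P ⟨V₁, hV₁, τ₁, τ₁', h₁, h₁', hu₁⟩
        refine ⟨V₁, hV₁, _, _, h₁.neg, h₁'.neg.congr (neg_mul _ _).symm fun _ => rfl, fun φ => ?_⟩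
        have h2 := hB.linear (extTest hV₁ (τ₁ φ)) (-extTest hV₁ (τ₁ φ))
        have h3 := hB.linear 0 0
        rw [add_zero, left_eq_add] at h3
        rw [add_neg_cancel, h3] at h2
        rw [map_neg, map_neg, hu₁]
        exact neg_eq_of_add_eq_zero_right h2.symm }
  refine diffOpGerm_induction S ?_ ?_ ?_ P
  · refine ⟨V, le_rfl, id, σ, Represents.one hB.zero_mem, hB.congr (one_mul _).symm fun _ => rfl,
      fun φ => ?_⟩
    have : ∀ φ : 𝓓(V, ℂ), extTest le_rfl φ = φ := fun φ => DFunLike.ext _ _ fun x => by simp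
    rw [this, this]
    rfl
  · rintro a ha P ⟨V₁, hV₁, τ₁, τ₁', h₁, h₁', hu₁⟩
    obtain ⟨W, hW, hWo, hW0⟩ := eventually_nhds_iff.1 ha.eventually_analyticAt
    have h0 : (0 : Fin n → ℝ) ∈ V₁ ⊓ ⟨W, hWo⟩ := ⟨h₁.zero_mem, hW0⟩
    obtain ⟨σ₁, hσ₁, e₁⟩ := h₁.restrict h0 inf_le_left
    obtain ⟨σ₁', hσ₁', e₁'⟩ := h₁'.restrict h0 inf_le_left
    have ha' : AnalyticOnNhd ℝ a (V₁ ⊓ ⟨W, hWo⟩ : Opens (Fin n → ℝ)) := fun x hx => hW x hx.2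
    refine ⟨_, inf_le_left.trans hV₁, _, _, Represents.ofFun_mul h0 hσ₁ ha',
      (Represents.ofFun_mul h0 hσ₁' ha').congr (mul_assoc _ _ _).symm fun _ => rfl, fun φ => ?_⟩
    rw [← extTest_extTest hV₁ inf_le_left, e₁', hu₁, ← extTest_extTest hV₁ inf_le_left, e₁]
  · rintro i P ⟨V₁, hV₁, τ₁, τ₁', h₁, h₁', hu₁⟩
    exact ⟨V₁, hV₁, _, _, h₁.partialD_mul i,
      (h₁'.partialD_mul i).congr (mul_assoc _ _ _).symm fun _ => rfl, fun φ => hu₁ _⟩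

/-- If `u = B u'`, then an operator `P` such that `P B` annihilates `u'` annihilates `u`. -/
theorem mem_annihilator_of_mul_mem {u u' : Distr V} {B : DiffOpGerm n} {σ : 𝓓(V, ℂ) → 𝓓(V, ℂ)}
    (hB : Represents V B σ) (hu : ∀ φ, u' (σ φ) = u φ) {P : DiffOpGerm n}
    (hP : P * B ∈ annihilator u') : P ∈ annihilator u := by
  obtain ⟨V₁, hV₁, τ, τ', h, h', e⟩ := exists_represents_mul hB P
  obtain ⟨W, hW, hW0, h1⟩ := exists_of_mem_annihilator hP hV₁ h'
  obtain ⟨τW, hτW, eW⟩ := h.restrict hW0 hW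
  refine mem_annihilator.2 ⟨W, hW.trans hV₁, τW, hτW, fun φ => ?_⟩
  rw [← extTest_extTest hV₁ hW, eW, ← hu, ← e, h1]

end

section

/-! ### The function `t₊ˢ` -/

/-- `t₊ˢ`, so that `plusPow f s x = ppow (f x) s`. -/
def ppow (t : ℝ) (s : ℂ) : ℂ := if 0 < t then (t : ℂ) ^ s else 0

theorem ppow_of_pos {t : ℝ} (ht : 0 < t) (s : ℂ) : ppow t s = (t : ℂ) ^ s := if_pos ht

theorem ppow_of_nonpos {t : ℝ} (ht : t ≤ 0) (s : ℂ) : ppow t s = 0 := if_neg ht.not_gt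

theorem ppow_mul_self (t : ℝ) (s : ℂ) : ppow t s * t = ppow t (s + 1) := by
  rcases lt_or_ge 0 t with ht | ht
  · rw [ppow_of_pos ht, ppow_of_pos ht, Complex.cpow_add _ _ (by exact_mod_cast ht.ne'),
      Complex.cpow_one]
  · rw [ppow_of_nonpos ht, ppow_of_nonpos ht, zero_mul]

theorem measurable_ppow (s : ℂ) : Measurable fun t : ℝ => ppow t s :=
  Measurable.ite measurableSet_Ioi (Complex.measurable_ofReal.pow_const s) measurable_const

theorem continuous_ppow {s : ℂ} (hs : 0 < s.re) : Continuous fun t : ℝ => ppow t s := by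
  have h1 : (fun t : ℝ => ppow t s) = fun t => ((max t 0 : ℝ) : ℂ) ^ s := by
    funext t
    rcases lt_or_ge 0 t with ht | ht
    · rw [ppow_of_pos ht, max_eq_left ht.le]
    · rw [ppow_of_nonpos ht, max_eq_right ht, Complex.ofReal_zero, Complex.zero_cpow]
      rintro rfl
      simp at hs
  rw [h1]
  exact (Complex.continuous_ofReal_cpow_const hs).comp (continuous_id.max continuous_const)

theorem hasDerivAt_ppow {s : ℂ} (hs : 1 < s.re) (t : ℝ) :
    HasDerivAt (fun t : ℝ => ppow t s) (s * ppow t (s - 1)) t := by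
  have hs0 : s ≠ 0 := by rintro rfl; simp at hs; linarith
  rcases lt_trichotomy 0 t with ht | rfl | ht
  · have h1 : HasDerivAt (fun y : ℝ => (y : ℂ) ^ s) (s * (t : ℂ) ^ (s - 1)) t :=
      hasDerivAt_ofReal_cpow_const ht.ne' hs0
    rw [ppow_of_pos ht]
    refine h1.congr_of_eventuallyEq ?_
    filter_upwards [lt_mem_nhds ht] with y hy
    exact ppow_of_pos hy s
  · rw [ppow_of_nonpos le_rfl, mul_zero, hasDerivAt_iff_tendsto_slope_zero]
    have h1 : Tendsto (fun t : ℝ => ppow t (s - 1)) (𝓝[≠] 0) (𝓝 0) := by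
      have := (continuous_ppow (s := s - 1) (by simpa using hs)).tendsto 0
      rw [ppow_of_nonpos le_rfl] at this
      exact this.mono_left nhdsWithin_le_nhds
    refine h1.congr' ?_
    filter_upwards [self_mem_nhdsWithin] with t ht
    rw [zero_add, ppow_of_nonpos le_rfl s, sub_zero, ← sub_add_cancel s 1, ← ppow_mul_self,
      add_sub_cancel_right, Complex.real_smul]
    have : (t : ℂ) ≠ 0 := by exact_mod_cast ht
    push_cast
    field_simp
  · rw [ppow_of_nonpos ht.le, mul_zero]
    refine (hasDerivAt_const t (0 : ℂ)).congr_of_eventuallyEq ?_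
    filter_upwards [gt_mem_nhds ht] with y hy
    exact ppow_of_nonpos (le_of_lt hy) s

theorem contDiff_ppow {s : ℂ} (hs : 1 < s.re) : ContDiff ℝ 1 fun t : ℝ => ppow t s := by
  rw [contDiff_one_iff_deriv]
  refine ⟨fun t => (hasDerivAt_ppow hs t).differentiableAt, ?_⟩
  rw [show deriv (fun t : ℝ => ppow t s) = fun t => s * ppow t (s - 1) from
    funext fun t => (hasDerivAt_ppow hs t).deriv]
  exact continuous_const.mul (continuous_ppow (by simpa using hs))

theorem norm_ppow_le {t : ℝ} {s : ℂ} {B R : ℝ} (hB : 1 ≤ B) (ht : t ≤ B) (hs : 0 ≤ s.re)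
    (hR : s.re ≤ R) : ‖ppow t s‖ ≤ B ^ R := by
  have hB0 : 0 < B := by linarith
  rcases lt_or_ge 0 t with h | h
  · rw [ppow_of_pos h, Complex.norm_cpow_eq_rpow_re_of_pos h]
    exact (Real.rpow_le_rpow h.le ht hs).trans (Real.rpow_le_rpow_of_exponent_le hB hR)
  · rw [ppow_of_nonpos h, norm_zero]
    exact Real.rpow_nonneg hB0.le R

theorem norm_ppow_mul_log_le {t : ℝ} {s : ℂ} {B R ε : ℝ} (hB : 1 ≤ B) (ht : t ≤ B) (hε : 0 < ε)
    (hs : ε ≤ s.re) (hR : s.re ≤ R) : ‖ppow t s * (Real.log t : ℂ)‖ ≤ 1 / ε + B ^ R * B := by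
  have hB0 : 0 < B := by linarith
  have hBR : 0 < B ^ R := Real.rpow_pos_of_pos hB0 R
  rcases lt_or_ge 0 t with h | h
  · rw [ppow_of_pos h, norm_mul, Complex.norm_cpow_eq_rpow_re_of_pos h, Complex.norm_real,
      Real.norm_eq_abs]
    rcases le_total t 1 with h1 | h1
    · have h2 := Real.abs_log_mul_self_rpow_lt t ε h h1 hε
      rw [abs_mul, abs_of_pos (Real.rpow_pos_of_pos h ε)] at h2
      have h3 : t ^ s.re ≤ t ^ ε := Real.rpow_le_rpow_of_exponent_ge h h1 hs
      have h4 : t ^ s.re * |Real.log t| ≤ t ^ ε * |Real.log t| := by gcongr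
      have h5 : 0 < B ^ R * B := by positivity
      linarith [mul_comm (|Real.log t|) (t ^ ε)]
    · have h2 : |Real.log t| ≤ B := by
        rw [abs_of_nonneg (Real.log_nonneg h1)]
        linarith [Real.log_le_sub_one_of_pos h]
      have h3 : t ^ s.re ≤ B ^ R :=
        (Real.rpow_le_rpow h.le ht (hε.le.trans hs)).trans (Real.rpow_le_rpow_of_exponent_le hB hR)
      have h4 : t ^ s.re * |Real.log t| ≤ B ^ R * B := by gcongr
      have : 0 < 1 / ε := by positivity
      linarith
  · rw [ppow_of_nonpos h, zero_mul, norm_zero]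
    positivity

theorem hasDerivAt_ppow_exponent (t : ℝ) (s : ℂ) :
    HasDerivAt (fun s => ppow t s) (ppow t s * (Real.log t : ℂ)) s := by
  rcases lt_or_ge 0 t with h | h
  · have h0 : (t : ℂ) ≠ 0 := by exact_mod_cast h.ne'
    have h1 : (fun s => ppow t s) = fun s => (t : ℂ) ^ s := funext fun s => ppow_of_pos h s
    rw [h1, ppow_of_pos h, Complex.ofReal_log h.le]
    simpa using (hasDerivAt_id s).const_cpow (c := (t : ℂ)) (Or.inl h0)
  · have h1 : (fun s => ppow t s) = fun _ => 0 := funext fun s => ppow_of_nonpos h s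
    rw [h1, ppow_of_nonpos h, zero_mul]
    exact hasDerivAt_const _ _

section Holomorphy

variable {X : Type*} [MeasurableSpace X] {μ : Measure X}

theorem integrable_ppow_mul {f : X → ℝ} (hf : Measurable f) {ψ : X → ℂ} (hψ : Integrable ψ μ)
    {B : ℝ} (hB : ∀ x, ψ x ≠ 0 → f x ≤ B) {s : ℂ} (hs : 0 ≤ s.re) :
    Integrable (fun x => ppow (f x) s * ψ x) μ := by
  refine Integrable.mono' (hψ.norm.const_mul ((max B 1) ^ s.re))
    (((measurable_ppow s).comp hf).aestronglyMeasurable.mul hψ.aestronglyMeasurable)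
    (Eventually.of_forall fun x => ?_)
  rw [norm_mul]
  by_cases hx : ψ x = 0
  · simp [hx]
  · gcongr
    exact norm_ppow_le (le_max_right _ _) ((hB x hx).trans (le_max_left _ _)) hs le_rfl

/-- Integrals of `f₊ˢ` are holomorphic in `s` for `Re s > 0`. -/
theorem differentiableAt_integral_ppow {f : X → ℝ} (hf : Measurable f) {ψ : X → ℂ}
    (hψ : Integrable ψ μ) {B : ℝ} (hB : ∀ x, ψ x ≠ 0 → f x ≤ B) {s : ℂ} (hs : 0 < s.re) :
    DifferentiableAt ℂ (fun s => ∫ x, ppow (f x) s * ψ x ∂μ) s := by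
  set C : ℝ := 1 / (s.re / 2) + (max B 1) ^ (2 * s.re) * max B 1 with hC
  have hC0 : 0 ≤ C := by positivity
  refine (hasDerivAt_integral_of_dominated_loc_of_deriv_le
    (F := fun s x => ppow (f x) s * ψ x) (F' := fun s x => ppow (f x) s * (Real.log (f x) : ℂ) * ψ x)
    (bound := fun x => C * ‖ψ x‖) (s := {z : ℂ | s.re / 2 < z.re ∧ z.re < 2 * s.re}) (x₀ := s)
    ?_ ?_ ?_ ?_ ?_ ?_ ?_).2.differentiableAt
  · refine (IsOpen.inter (isOpen_lt continuous_const Complex.continuous_re)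
      (isOpen_lt Complex.continuous_re continuous_const)).mem_nhds ⟨?_, ?_⟩
    · change s.re / 2 < s.re
      linarith
    · change s.re < 2 * s.re
      linarith
  · exact Eventually.of_forall fun z =>
      ((measurable_ppow z).comp hf).aestronglyMeasurable.mul hψ.aestronglyMeasurable
  · exact integrable_ppow_mul hf hψ hB hs.le
  · exact ((((measurable_ppow s).comp hf).mul (Complex.measurable_ofReal.comp
      (Real.measurable_log.comp hf))).aestronglyMeasurable).mul hψ.aestronglyMeasurable
  · refine Eventually.of_forall fun x z hz => ?_
    rw [norm_mul]
    by_cases hx : ψ x = 0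
    · simp [hx]
    · gcongr
      exact norm_ppow_mul_log_le (le_max_right _ _) ((hB x hx).trans (le_max_left _ _))
        (by linarith) hz.1.le hz.2.le
  · exact hψ.norm.const_mul C
  · exact Eventually.of_forall fun x z _ => (hasDerivAt_ppow_exponent (f x) z).mul_const (ψ x)

end Holomorphy

/-! ### Meromorphic functions and Laurent coefficients at `-1` -/

/-- Meromorphic functions on the plane that agree on a half plane agree near every point. -/
theorem eventually_eq_of_meromorphic {g h : ℂ → ℂ} (hg : MeromorphicOn g Set.univ)
    (hh : MeromorphicOn h Set.univ) {c : ℝ} (hgh : ∀ s : ℂ, c < s.re → g s = h s) (s₀ : ℂ) :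
    ∀ᶠ s in 𝓝[≠] s₀, g s = h s := by
  have h1 : MeromorphicOn (g - h) Set.univ := hg.sub hh
  have h2 : meromorphicOrderAt (g - h) ((c + 1 : ℝ) : ℂ) = ⊤ := by
    rw [meromorphicOrderAt_eq_top_iff]
    refine Filter.Eventually.filter_mono nhdsWithin_le_nhds ?_
    have : {z : ℂ | c < z.re} ∈ 𝓝 ((c + 1 : ℝ) : ℂ) :=
      (isOpen_lt continuous_const Complex.continuous_re).mem_nhds (by
        change c < ((c + 1 : ℝ) : ℂ).re
        rw [Complex.ofReal_re]
        linarith)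
    filter_upwards [this] with z hz
    simp [hgh z hz]
  have h3 : meromorphicOrderAt (g - h) s₀ = ⊤ := by
    by_contra h4
    exact ((meromorphicOn_univ.1 h1).exists_meromorphicOrderAt_ne_top_iff_forall.1 ⟨s₀, h4⟩ _) h2
  filter_upwards [meromorphicOrderAt_eq_top_iff.1 h3] with z hz
  exact sub_eq_zero.1 hz

/-- Near `-1`, but not necessarily at `-1`, `g` is given by the power series
`∑ aⱼ (s + 1) ^ j`. -/
def HasExp (g : ℂ → ℂ) (a : ℕ → ℂ) : Prop :=
  ∀ᶠ s in 𝓝[≠] (-1 : ℂ), HasSum (fun j => (s + 1) ^ j * a j) (g s)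

namespace HasExp

variable {g h : ℂ → ℂ} {a b : ℕ → ℂ}

theorem congr (hg : HasExp g a) (hgh : ∀ᶠ s in 𝓝[≠] (-1 : ℂ), g s = h s) : HasExp h a := by
  filter_upwards [hg, hgh] with s h1 h2
  rwa [← h2]

theorem hasFPowerSeriesAt (hg : HasExp g a) : HasFPowerSeriesAt (Function.update g (-1) (a 0))
    (FormalMultilinearSeries.ofScalars ℂ a) (-1) := by
  rw [hasFPowerSeriesAt_iff']
  rw [HasExp, eventually_nhdsWithin_iff] at hg
  filter_upwards [hg] with s hs
  by_cases h : s = -1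
  · subst h
    simp only [Function.update_self, sub_self, FormalMultilinearSeries.coeff_ofScalars]
    have h0 := hasSum_single (f := fun j : ℕ => (0 : ℂ) ^ j • a j) 0 fun j hj => by simp [hj]
    rwa [pow_zero, one_smul] at h0
  · rw [Function.update_of_ne h]
    simpa only [FormalMultilinearSeries.coeff_ofScalars, sub_neg_eq_add, smul_eq_mul] using hs h

theorem unique (hg : HasExp g a) (hg' : HasExp g b) : a = b := by
  have h1 := hg.hasFPowerSeriesAt
  have h2 := hg'.hasFPowerSeriesAt
  have h3 : a 0 = b 0 := by
    have h4 : ∀ {a : ℕ → ℂ}, HasExp g a → Tendsto g (𝓝[≠] (-1)) (𝓝 (a 0)) := by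
      intro a ha
      have h5 := ha.hasFPowerSeriesAt.continuousAt
      rw [continuousAt_update_same] at h5
      exact h5
    exact tendsto_nhds_unique (h4 hg) (h4 hg')
  rw [h3] at h1
  have h6 := h1.eq_formalMultilinearSeries h2
  funext j
  have := congrArg (fun p => FormalMultilinearSeries.coeff p j) h6
  simpa using this

theorem pow_mul (hg : HasExp g a) (k : ℕ) :
    HasExp (fun s => (s + 1) ^ k * g s) (fun j => if j < k then 0 else a (j - k)) := by
  filter_upwards [hg] with s hs
  have h1 := hs.mul_left ((s + 1) ^ k)
  have h2 : (fun j => (s + 1) ^ k * ((s + 1) ^ j * a j)) =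
      fun j => (s + 1) ^ (j + k) * (if j + k < k then 0 else a (j + k - k)) := by
    funext j
    rw [if_neg (by omega), Nat.add_sub_cancel, pow_add]
    ring
  rw [h2] at h1
  have h3 := (hasSum_nat_add_iff (f := fun j => (s + 1) ^ j * (if j < k then 0 else a (j - k))) k).1 h1
  rw [Finset.sum_eq_zero, add_zero] at h3
  · exact h3
  · intro j hj
    rw [if_pos (Finset.mem_range.1 hj), mul_zero]

end HasExp

theorem exists_hasExp {g : ℂ → ℂ} (hg : AnalyticAt ℂ g (-1)) : ∃ a, HasExp g a ∧ a 0 = g (-1) := by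
  obtain ⟨p, hp⟩ := hg
  refine ⟨fun j => p.coeff j, ?_, ?_⟩
  · have := hasFPowerSeriesAt_iff'.1 hp
    filter_upwards [this.filter_mono nhdsWithin_le_nhds] with s hs
    simpa only [sub_neg_eq_add, smul_eq_mul] using hs
  · exact hp.coeff_zero _

end

section

variable {n : ℕ} {V V' : Opens (Fin n → ℝ)}

/-! ### Integration by parts along a vector field -/

/-- Although `g` need not be continuous outside `V`, its product with a test function on `V` is
continuous everywhere. -/
theorem continuous_mul_test {g : (Fin n → ℝ) → ℂ} (hg : ContinuousOn g V) (φ : 𝓓(V, ℂ)) :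
    Continuous fun x => g x * φ x := by
  rw [continuous_iff_continuousAt]
  intro x
  by_cases hx : x ∈ tsupport φ
  · exact (hg.continuousAt (V.isOpen.mem_nhds (φ.tsupport_subset hx))).mul
      φ.continuous.continuousAt
  · have h0 : (fun y => g y * φ y) =ᶠ[𝓝 x] fun _ => (0 : ℂ) := by
      filter_upwards [(isClosed_tsupport (φ : (Fin n → ℝ) → ℂ)).isOpen_compl.mem_nhds hx] with y hy
      rw [image_eq_zero_of_notMem_tsupport hy, mul_zero]
    exact continuousAt_const.congr h0.symm

theorem integrable_mul_test {g : (Fin n → ℝ) → ℂ} (hg : ContinuousOn g V) (φ : 𝓓(V, ℂ)) :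
    Integrable fun x => g x * φ x :=
  (continuous_mul_test hg φ).integrable_of_hasCompactSupport φ.hasCompactSupport.mul_left

/-- The components of a real vector field. -/
theorem comp_analyticOnNhd {X : (Fin n → ℝ) → (Fin n → ℝ)} {s : Set (Fin n → ℝ)}
    (hX : AnalyticOnNhd ℝ X s) (l : Fin n) : AnalyticOnNhd ℝ (fun x => (X x l : ℂ)) s :=
  fun x hx => (Complex.ofRealCLM.analyticAt _).comp
    (((ContinuousLinearMap.proj (R := ℝ) (φ := fun _ : Fin n => ℝ) l).analyticAt _).comp (hX x hx))

/-- The transpose of a vector field. -/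
def transField (X : (Fin n → ℝ) → (Fin n → ℝ)) (hX : AnalyticOnNhd ℝ X V) (φ : 𝓓(V, ℂ)) :
    𝓓(V, ℂ) := ∑ l, -testPartial V l (mulTest _ (comp_analyticOnNhd hX l) φ)

theorem represents_transField (h0 : (0 : Fin n → ℝ) ∈ V) {X : (Fin n → ℝ) → (Fin n → ℝ)}
    (hX : AnalyticOnNhd ℝ X V) :
    Represents V (DiffOpGerm.ofVectorField X (hX 0 h0)) (transField X hX) := by
  refine (Represents.sum h0 Finset.univ fun l _ => Represents.ofFun_mul h0
    (((Represents.one h0).partialD_mul l).congr (mul_one _) fun _ => rfl)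
    (comp_analyticOnNhd hX l)).congr ?_ fun φ => ?_
  · rfl
  · rfl

/-- Integration by parts. -/
theorem integral_mul_transField {X : (Fin n → ℝ) → (Fin n → ℝ)} (hX : AnalyticOnNhd ℝ X V)
    {g : (Fin n → ℝ) → ℂ} (hg : ContDiffOn ℝ 1 g V) (φ : 𝓓(V, ℂ)) :
    ∫ x, g x * transField X hX φ x = ∫ x, fderiv ℝ g x (X x) * φ x := by
  have hg' : ∀ l : Fin n, ContinuousOn (fun x => fderiv ℝ g x (Pi.single l 1)) V := fun l =>
    (hg.continuousOn_fderiv_of_isOpen V.isOpen le_rfl).clm_apply continuousOn_const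
  have hc : ∀ l : Fin n, ContinuousOn (fun x => (X x l : ℂ)) V := fun l x hx =>
    (comp_analyticOnNhd hX l x hx).continuousAt.continuousWithinAt
  have h1 : ∀ l : Fin n, ∫ x, g x * testPartial V l (mulTest _ (comp_analyticOnNhd hX l) φ) x =
      -∫ x, fderiv ℝ g x (Pi.single l 1) * ((X x l : ℂ) * φ x) := by
    intro l
    have h2 := integral_mul_fderiv_eq_neg_fderiv_mul_of_integrable (μ := volume)
      (f := g) (g := mulTest _ (comp_analyticOnNhd hX l) φ) (v := Pi.single l 1)
      (integrable_mul_test (hg' l) _) ?_ (integrable_mul_test hg.continuousOn _) (fun x hx => ?_)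
      (fun x _ => testFunction_differentiableAt _ x)
    · simp only [testPartial_apply]
      exact h2
    · simp only [← testPartial_apply]
      exact integrable_mul_test hg.continuousOn _
    · exact (hg.contDiffAt (V.isOpen.mem_nhds (TestFunction.tsupport_subset _ hx))).differentiableAt
        one_ne_zero
  have h3 : ∀ x, g x * transField X hX φ x =
      ∑ l, -(g x * testPartial V l (mulTest _ (comp_analyticOnNhd hX l) φ) x) := by
    intro x
    simp only [transField, sum_apply, neg_apply, Finset.mul_sum, mul_neg]
  have h4 : ∀ x, fderiv ℝ g x (X x) * φ x =
      ∑ l, fderiv ℝ g x (Pi.single l 1) * ((X x l : ℂ) * φ x) := by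
    intro x
    conv_lhs => rw [GermChart.pi_eq_sum (X x)]
    simp only [map_sum, map_smul, Complex.real_smul, Finset.sum_mul]
    exact Finset.sum_congr rfl fun l _ => by ring
  simp only [h3, h4]
  have h5 : ∀ l ∈ Finset.univ, Integrable fun x =>
      -(g x * testPartial V l (mulTest _ (comp_analyticOnNhd hX l) φ) x) :=
    fun l _ => (integrable_mul_test hg.continuousOn _).neg
  have h6 : ∀ l ∈ Finset.univ, Integrable fun x =>
      fderiv ℝ g x (Pi.single l 1) * ((X x l : ℂ) * φ x) :=
    fun l _ => integrable_mul_test (hg' l) (mulTest _ (comp_analyticOnNhd hX l) φ)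
  rw [integral_finsetSum _ h5, integral_finsetSum _ h6]
  refine Finset.sum_congr rfl fun l _ => ?_
  rw [integral_neg, h1, neg_neg]

namespace DualFrame

variable {m : ℕ} (D : DualFrame n m)

/-! ### The distributions `f₊ˢ` for `Re s > 0` -/

/-- The product of the functions `f j`, `j ∈ A`. -/
def fprod (A : Finset (Fin m)) (x : Fin n → ℝ) : ℝ := ∏ j ∈ A, D.f j x

theorem fprod_analyticAt (A : Finset (Fin m)) {x : Fin n → ℝ} (hx : x ∈ D.U) :
    AnalyticAt ℝ (D.fprod A) x := Finset.analyticAt_fun_prod A fun j _ => D.hf j x hx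

theorem fprodC_analyticOnNhd (hV : V ≤ D.U) (A : Finset (Fin m)) :
    AnalyticOnNhd ℝ (fun x => (D.fprod A x : ℂ)) V := fun _ hx =>
  (Complex.ofRealCLM.analyticAt _).comp (D.fprod_analyticAt A (hV hx))

/-- Multiplication by the product of the functions `f j`, `j ∈ A`. -/
def mulF (hV : V ≤ D.U) (A : Finset (Fin m)) (φ : 𝓓(V, ℂ)) : 𝓓(V, ℂ) :=
  mulTest _ (D.fprodC_analyticOnNhd hV A) φ

/-- The transpose of `v i`. -/
def tv (hV : V ≤ D.U) (i : Fin n) (φ : 𝓓(V, ℂ)) : 𝓓(V, ℂ) :=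
  transField (D.v i) ((D.hv i).mono hV) φ

/-- The integral `∫ f₊ˢ φ`. -/
def powInt (s : ℂ) (φ : 𝓓(V, ℂ)) : ℂ := ∫ x, ppow (D.fprod Finset.univ x) s * φ x

theorem fderiv_fprod (A : Finset (Fin m)) {x : Fin n → ℝ} (hx : x ∈ D.U) (i : Fin n) :
    fderiv ℝ (D.fprod A) x (D.v i x) =
      ∑ j ∈ A, if (i : ℕ) = j then D.fprod (A.erase j) x else 0 := by
  have h1 : HasFDerivAt (D.fprod A) (∑ j ∈ A, (∏ l ∈ A.erase j, D.f l x) • fderiv ℝ (D.f j) x) x :=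
    HasFDerivAt.finsetProd fun j _ => (D.hf j x hx).differentiableAt.hasFDerivAt
  rw [h1.fderiv, sum_apply]
  refine Finset.sum_congr rfl fun j _ => ?_
  rw [smul_apply, D.hvf i j x hx]
  split_ifs <;> simp [fprod]

theorem fderiv_fprod_self {A : Finset (Fin m)} {i : Fin m} (hi : i ∈ A) {x : Fin n → ℝ}
    (hx : x ∈ D.U) :
    fderiv ℝ (D.fprod A) x (D.v (Fin.castLE D.hmn i) x) = D.fprod (A.erase i) x := by
  rw [D.fderiv_fprod A hx, Finset.sum_eq_single i]
  · simp
  · intro j _ hj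
    rw [if_neg]
    simpa [Fin.ext_iff, eq_comm] using hj
  · exact fun h => absurd hi h

theorem fderiv_fprod_of_le (A : Finset (Fin m)) {j : Fin n} (hj : m ≤ (j : ℕ)) {x : Fin n → ℝ}
    (hx : x ∈ D.U) : fderiv ℝ (D.fprod A) x (D.v j x) = 0 := by
  rw [D.fderiv_fprod A hx]
  refine Finset.sum_eq_zero fun i _ => if_neg ?_
  have := i.2
  omega

theorem mul_fprod_erase {A : Finset (Fin m)} {i : Fin m} (hi : i ∈ A) (x : Fin n → ℝ) :
    D.f i x * D.fprod (A.erase i) x = D.fprod A x := Finset.mul_prod_erase A (fun j => D.f j x) hi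

theorem contDiffOn_ppow_mul (hV : V ≤ D.U) {s : ℂ} (hs : 1 < s.re) (A : Finset (Fin m)) :
    ContDiffOn ℝ 1 (fun x => ppow (D.fprod Finset.univ x) s * (D.fprod A x : ℂ)) V := by
  intro x hx
  refine ContDiffAt.contDiffWithinAt (ContDiffAt.mul ?_ ?_)
  · exact (contDiff_ppow hs).contDiffAt.comp x (D.fprod_analyticAt _ (hV hx)).contDiffAt
  · exact (D.fprodC_analyticOnNhd hV A x hx).contDiffAt

theorem fderiv_ppow_mul {s : ℂ} (hs : 1 < s.re) (A : Finset (Fin m)) {x : Fin n → ℝ}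
    (hx : x ∈ D.U) (u : Fin n → ℝ) :
    fderiv ℝ (fun x => ppow (D.fprod Finset.univ x) s * (D.fprod A x : ℂ)) x u =
      s * ppow (D.fprod Finset.univ x) (s - 1) * (fderiv ℝ (D.fprod Finset.univ) x u : ℂ) *
        (D.fprod A x : ℂ) +
      ppow (D.fprod Finset.univ x) s * (fderiv ℝ (D.fprod A) x u : ℂ) := by
  have h1 := (hasDerivAt_ppow hs (D.fprod Finset.univ x)).hasFDerivAt.comp x
    (D.fprod_analyticAt Finset.univ hx).differentiableAt.hasFDerivAt
  have h2 := Complex.ofRealCLM.hasFDerivAt.comp x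
    (D.fprod_analyticAt A hx).differentiableAt.hasFDerivAt
  have h3 := h1.mul h2
  have h4 : (fun x => ppow (D.fprod Finset.univ x) s * (D.fprod A x : ℂ)) =
    ((fun t => ppow t s) ∘ D.fprod Finset.univ) * (Complex.ofRealCLM ∘ D.fprod A) := rfl
  rw [h4, h3.fderiv]
  simp
  ring

theorem powInt_mulF (hV : V ≤ D.U) (A : Finset (Fin m)) (s : ℂ) (φ : 𝓓(V, ℂ)) :
    D.powInt s (D.mulF hV A φ) =
      ∫ x, (ppow (D.fprod Finset.univ x) s * (D.fprod A x : ℂ)) * φ x := by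
  simp only [powInt, mulF, mulTest_apply, mul_assoc]

theorem powInt_mulF_univ (hV : V ≤ D.U) (s : ℂ) (φ : 𝓓(V, ℂ)) :
    D.powInt s (D.mulF hV Finset.univ φ) = D.powInt (s + 1) φ := by
  rw [powInt_mulF]
  simp only [ppow_mul_self]
  rfl

theorem integral_congr_test {g h : (Fin n → ℝ) → ℂ} (φ : 𝓓(V, ℂ)) (H : ∀ x ∈ V, g x = h x) :
    ∫ x, g x * φ x = ∫ x, h x * φ x := by
  refine integral_congr_ae (Eventually.of_forall fun x => ?_)
  by_cases hx : x ∈ V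
  · change g x * φ x = h x * φ x
    rw [H x hx]
  · change g x * φ x = h x * φ x
    rw [testFunction_eq_zero φ hx, mul_zero, mul_zero]

/-- The case `1 < re s` of `powInt_tv`, in which the integrand is continuously differentiable. -/
theorem powInt_tv_aux (hV : V ≤ D.U) {A : Finset (Fin m)} {i : Fin m} (hi : i ∈ A) {s : ℂ}
    (hs : 1 < s.re) (φ : 𝓓(V, ℂ)) :
    D.powInt s (D.mulF hV A (D.tv hV (Fin.castLE D.hmn i) φ)) =
      (s + 1) * D.powInt s (D.mulF hV (A.erase i) φ) := by
  rw [powInt_mulF, powInt_mulF, ← integral_const_mul]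
  refine (integral_mul_transField _ (D.contDiffOn_ppow_mul hV hs A) φ).trans ?_
  have : ∀ x, (s + 1) * (ppow (D.fprod Finset.univ x) s * (D.fprod (A.erase i) x : ℂ) * φ x) =
      ((s + 1) * (ppow (D.fprod Finset.univ x) s * (D.fprod (A.erase i) x : ℂ))) * φ x :=
    fun x => (mul_assoc _ _ _).symm
  simp only [this]
  refine integral_congr_test φ fun x hx => ?_
  rw [D.fderiv_ppow_mul hs A (hV hx), D.fderiv_fprod_self (Finset.mem_univ i) (hV hx),
    D.fderiv_fprod_self hi (hV hx), ← D.mul_fprod_erase hi]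
  have h1 : ppow (D.fprod Finset.univ x) (s - 1) * (D.fprod Finset.univ x : ℂ) =
      ppow (D.fprod Finset.univ x) s := by rw [ppow_mul_self, sub_add_cancel]
  rw [← D.mul_fprod_erase (Finset.mem_univ i) x] at h1 ⊢
  push_cast at h1 ⊢
  linear_combination (s * (D.fprod (A.erase i) x : ℂ)) * h1

theorem powInt_tv_of_le_aux (hV : V ≤ D.U) {j : Fin n} (hj : m ≤ (j : ℕ)) {s : ℂ}
    (hs : 1 < s.re) (φ : 𝓓(V, ℂ)) : D.powInt s (D.tv hV j φ) = 0 := by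
  have h1 : D.powInt s (D.tv hV j φ) = D.powInt s (D.mulF hV ∅ (D.tv hV j φ)) := by
    rw [powInt_mulF]
    simp [powInt, fprod]
  rw [h1, powInt_mulF]
  refine (integral_mul_transField _ (D.contDiffOn_ppow_mul hV hs ∅) φ).trans ?_
  rw [integral_congr_test φ (h := fun _ => 0)]
  · simp
  · intro x hx
    rw [D.fderiv_ppow_mul hs ∅ (hV hx), D.fderiv_fprod_of_le _ hj (hV hx),
      D.fderiv_fprod_of_le _ hj (hV hx)]
    simp

theorem differentiableAt_powInt (hV : V ≤ D.U) (φ : 𝓓(V, ℂ)) {s : ℂ} (hs : 0 < s.re) :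
    DifferentiableAt ℂ (fun s => D.powInt s φ) s := by
  classical
  -- The functions need not be measurable outside the support of the test function.
  set g : (Fin n → ℝ) → ℝ := (tsupport φ).piecewise (D.fprod Finset.univ) 0 with hg
  have hc : ContinuousOn (D.fprod Finset.univ) (tsupport φ) := fun x hx =>
    (D.fprod_analyticAt _ (hV (φ.tsupport_subset hx))).continuousAt.continuousWithinAt
  have hgm : Measurable g := hc.measurable_piecewise continuousOn_const
    (isClosed_tsupport _).measurableSet
  obtain ⟨B, hB⟩ := φ.hasCompactSupport.isCompact.bddAbove_image hc
  have h1 : (fun s => D.powInt s φ) = fun s => ∫ x, ppow (g x) s * φ x := by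
    funext s
    refine integral_congr_ae (Eventually.of_forall fun x => ?_)
    by_cases hx : x ∈ tsupport φ
    · simp [hg, hx]
    · simp [image_eq_zero_of_notMem_tsupport hx]
  rw [h1]
  refine differentiableAt_integral_ppow hgm
    (φ.continuous.integrable_of_hasCompactSupport φ.hasCompactSupport) (B := B) (fun x hx => ?_) hs
  have hx' : x ∈ tsupport φ := subset_tsupport _ hx
  simp only [hg, hx', Set.piecewise_eq_of_mem]
  exact hB ⟨x, hx', rfl⟩

theorem analyticOnNhd_powInt (hV : V ≤ D.U) (φ : 𝓓(V, ℂ)) :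
    AnalyticOnNhd ℂ (fun s => D.powInt s φ) {s : ℂ | 0 < s.re} :=
  DifferentiableOn.analyticOnNhd (fun _ hs => (D.differentiableAt_powInt hV φ hs).differentiableWithinAt)
    (isOpen_lt continuous_const Complex.continuous_re)

/-- The relation `v i (f₊ˢ f_A) = (s + 1) f₊ˢ f_{A \ i}`. -/
theorem powInt_tv (hV : V ≤ D.U) {A : Finset (Fin m)} {i : Fin m} (hi : i ∈ A) {s : ℂ}
    (hs : 0 < s.re) (φ : 𝓓(V, ℂ)) :
    D.powInt s (D.mulF hV A (D.tv hV (Fin.castLE D.hmn i) φ)) =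
      (s + 1) * D.powInt s (D.mulF hV (A.erase i) φ) := by
  have h1 : AnalyticOnNhd ℂ (fun s => (s + 1) * D.powInt s (D.mulF hV (A.erase i) φ))
      {s : ℂ | 0 < s.re} := fun s hs =>
    (analyticAt_id.add analyticAt_const).mul (D.analyticOnNhd_powInt hV _ s hs)
  have h2 : (fun s => D.powInt s (D.mulF hV A (D.tv hV (Fin.castLE D.hmn i) φ))) =ᶠ[𝓝 2]
      fun s => (s + 1) * D.powInt s (D.mulF hV (A.erase i) φ) := by
    filter_upwards [(isOpen_lt continuous_const Complex.continuous_re).mem_nhds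
      (show (1 : ℝ) < (2 : ℂ).re by norm_num)] with s hs
    exact D.powInt_tv_aux hV hi hs φ
  exact (D.analyticOnNhd_powInt hV _).eqOn_of_preconnected_of_eventuallyEq h1
    (convex_halfSpace_re_gt 0).isPreconnected (show (0 : ℝ) < (2 : ℂ).re by norm_num) h2 hs

/-- The composition of the transposes of the `v i`, over a list of indices. -/
def tvList (hV : V ≤ D.U) (l : List (Fin m)) (φ : 𝓓(V, ℂ)) : 𝓓(V, ℂ) :=
  l.foldr (fun i ψ => D.tv hV (Fin.castLE D.hmn i) ψ) φ

theorem powInt_tvList (hV : V ≤ D.U) {s : ℂ} (hs : 0 < s.re) (φ : 𝓓(V, ℂ)) (l : List (Fin m))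
    (hl : l.Nodup) : D.powInt s (D.mulF hV l.toFinset (D.tvList hV l φ)) =
      (s + 1) ^ l.length * D.powInt s φ := by
  induction l with
  | nil =>
    rw [powInt_mulF]
    simp [powInt, fprod, tvList]
  | cons i l ih =>
    rw [List.nodup_cons] at hl
    have h1 : D.tvList hV (i :: l) φ = D.tv hV (Fin.castLE D.hmn i) (D.tvList hV l φ) := rfl
    rw [h1, D.powInt_tv hV (by simp) hs, List.toFinset_cons, Finset.erase_insert (by simpa using hl.1),
      ih hl.2, List.length_cons]
    ring

/-- The transpose of `v₁ ⋯ vₘ`. -/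
def tL (hV : V ≤ D.U) (φ : 𝓓(V, ℂ)) : 𝓓(V, ℂ) := D.tvList hV (List.finRange m) φ

/-- The functional equation `v₁ ⋯ vₘ f₊ˢ⁺¹ = (s + 1)ᵐ f₊ˢ`. -/
theorem powInt_tL (hV : V ≤ D.U) {s : ℂ} (hs : 0 < s.re) (φ : 𝓓(V, ℂ)) :
    D.powInt (s + 1) (D.tL hV φ) = (s + 1) ^ m * D.powInt s φ := by
  have := D.powInt_tvList hV hs φ (List.finRange m) (List.nodup_finRange m)
  rw [List.length_finRange] at this
  rw [← this, ← D.powInt_mulF_univ hV, tL]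
  congr 2
  ext
  simp

end DualFrame

end

section

variable {n : ℕ} {V V' : Opens (Fin n → ℝ)}

theorem Represents.ofVectorField_mul {P : DiffOpGerm n} {τ : 𝓓(V, ℂ) → 𝓓(V, ℂ)}
    (h : Represents V P τ) {X : (Fin n → ℝ) → (Fin n → ℝ)} (hX : AnalyticOnNhd ℝ X V) :
    Represents V (DiffOpGerm.ofVectorField X (hX 0 h.zero_mem) * P)
      (fun φ => τ (transField X hX φ)) := by
  refine (Represents.sum h.zero_mem Finset.univ fun l _ => Represents.ofFun_mul h.zero_mem
    (h.partialD_mul l) (comp_analyticOnNhd hX l)).congr ?_ fun φ => ?_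
  · rw [DiffOpGerm.ofVectorField, Finset.sum_mul]
    exact Finset.sum_congr rfl fun l _ => (mul_assoc _ _ _).symm
  · exact (map_sum (AddMonoidHom.mk' τ h.linear) _ _).symm

/-- The Leibniz rule for the transpose of a vector field. -/
theorem transField_mulTest {X : (Fin n → ℝ) → (Fin n → ℝ)} (hX : AnalyticOnNhd ℝ X V)
    {a : (Fin n → ℝ) → ℂ} (ha : AnalyticOnNhd ℝ a V) (hXa : ∀ x ∈ V, fderiv ℝ a x (X x) = 1)
    (φ : 𝓓(V, ℂ)) : transField X hX (mulTest a ha φ) = mulTest a ha (transField X hX φ) - φ := by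
  refine testFunction_ext_of_mem fun x hx => ?_
  have h1 : ∀ l, testPartial V l (mulTest _ (comp_analyticOnNhd hX l) (mulTest a ha φ)) x =
      fderiv ℝ a x (Pi.single l 1) * ((X x l : ℂ) * φ x) +
        a x * testPartial V l (mulTest _ (comp_analyticOnNhd hX l) φ) x := by
    intro l
    have h2 : mulTest _ (comp_analyticOnNhd hX l) (mulTest a ha φ) =
        mulTest a ha (mulTest _ (comp_analyticOnNhd hX l) φ) :=
      DFunLike.ext _ _ fun y => by simp only [mulTest_apply]; ring
    rw [h2, testPartial_mulTest, add_apply]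
    rfl
  have h3 : ∑ l, fderiv ℝ a x (Pi.single l 1) * ((X x l : ℂ) * φ x) = φ x := by
    have h4 := hXa x hx
    rw [GermChart.pi_eq_sum (X x)] at h4
    simp only [map_sum, map_smul, Complex.real_smul] at h4
    calc _ = (∑ l, (X x l : ℂ) * fderiv ℝ a x (Pi.single l 1)) * φ x := by
          rw [Finset.sum_mul]
          exact Finset.sum_congr rfl fun l _ => by ring
      _ = φ x := by rw [h4, one_mul]
  rw [sub_apply, mulTest_apply]
  simp only [transField, sum_apply, neg_apply, h1]
  rw [Finset.mul_sum, Finset.sum_congr rfl fun l _ => neg_add _ _, Finset.sum_add_distrib,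
    Finset.sum_neg_distrib, h3]
  simp only [mul_neg]
  ring

namespace DualFrame

variable {m : ℕ} (D : DualFrame n m)

/-! ### Relations between the coefficients of a Laurent expansion -/

section Coefficients

variable {D} {hV : V ≤ D.U} {T : ℂ → Distr V}
  (hT : IsComplexPower V (fun x => ∏ j, D.f j x) T)

include hT

theorem eq_powInt {s : ℂ} (hs : 0 < s.re) (φ : 𝓓(V, ℂ)) : T s φ = D.powInt s φ := hT.2 s hs φ

theorem eventually_mulF_tv (hV : V ≤ D.U) {A : Finset (Fin m)} {i : Fin m} (hi : i ∈ A)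
    (φ : 𝓓(V, ℂ)) : ∀ᶠ s in 𝓝[≠] (-1 : ℂ),
      T s (D.mulF hV A (D.tv hV (Fin.castLE D.hmn i) φ)) =
        (s + 1) * T s (D.mulF hV (A.erase i) φ) := by
  refine eventually_eq_of_meromorphic (hT.1 _) (MeromorphicOn.mul ?_ (hT.1 _)) (c := 0)
    (fun s hs => ?_) _
  · exact fun s _ => (analyticAt_id.add analyticAt_const).meromorphicAt
  · rw [eq_powInt hT hs, D.powInt_tv hV hi hs]
    exact congrArg _ (eq_powInt hT hs _).symm

theorem eventually_tv_of_le (hV : V ≤ D.U) {j : Fin n} (hj : m ≤ (j : ℕ)) (φ : 𝓓(V, ℂ)) :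
    ∀ᶠ s in 𝓝[≠] (-1 : ℂ), T s (D.tv hV j φ) = 0 := by
  refine eventually_eq_of_meromorphic (hT.1 _) (h := fun _ => 0)
    (fun s _ => analyticAt_const.meromorphicAt) (c := 1) (fun s hs => ?_) _
  rw [eq_powInt hT (by linarith), D.powInt_tv_of_le_aux hV hj hs]

/-- Since `f * f₊ˢ = f₊ˢ⁺¹`, the product of `f` and `f₊ˢ` has no pole at `-1`: the functional
equation gives its continuation with the denominator `(s + 2)ᵐ`. -/
theorem exists_analyticAt_mulF_univ (hV : V ≤ D.U) (φ : 𝓓(V, ℂ)) :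
    ∃ h : ℂ → ℂ, AnalyticAt ℂ h (-1) ∧
      ∀ᶠ s in 𝓝[≠] (-1 : ℂ), T s (D.mulF hV Finset.univ φ) = h s := by
  have h0 : AnalyticAt ℂ (fun s : ℂ => s + 2) (-1) := analyticAt_id.add analyticAt_const
  refine ⟨fun s => ((s + 2) ^ m)⁻¹ * D.powInt (s + 2) (D.tL hV φ), ?_, ?_⟩
  · refine ((h0.pow m).inv ?_).mul (AnalyticAt.comp (g := fun s => D.powInt s (D.tL hV φ))
      (f := fun s => s + 2) (D.analyticOnNhd_powInt hV _ _ ?_) h0)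
    · norm_num
    · change 0 < ((-1 : ℂ) + 2).re
      norm_num
  · have h1 : MeromorphicOn (fun s => ((s + 2) ^ m)⁻¹ * T (s + 2) (D.tL hV φ)) Set.univ := by
      intro s _
      have h2 : AnalyticAt ℂ (fun s : ℂ => s + 2) s := analyticAt_id.add analyticAt_const
      refine ((h2.pow m).meromorphicAt.inv).mul ?_
      exact MeromorphicAt.comp_analyticAt (f := fun s => T s (D.tL hV φ)) (g := fun s => s + 2)
        (hT.1 (D.tL hV φ) (s + 2) (Set.mem_univ _)) h2
    have h2 := eventually_eq_of_meromorphic (hT.1 (D.mulF hV Finset.univ φ)) h1 (c := 0)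
      (fun s hs => ?_) (-1)
    · have h3 : ∀ᶠ s in 𝓝[≠] (-1 : ℂ), 0 < (s + 2).re := by
        refine Filter.Eventually.filter_mono nhdsWithin_le_nhds ?_
        refine (isOpen_lt continuous_const (Complex.continuous_re.comp
          (continuous_id.add continuous_const))).mem_nhds ?_
        change 0 < ((-1 : ℂ) + 2).re
        norm_num
      filter_upwards [h2, h3] with s h4 h5
      rw [h4, eq_powInt hT h5]
    · have h3 : (0 : ℝ) < (s + 1).re := by simp; linarith
      have h4 : (0 : ℝ) < (s + 2).re := by simp; linarith
      have h5 : s + 2 ≠ 0 := fun h => by rw [h] at h4; simp at h4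
      have h6 : s + 2 = (s + 1) + 1 := by ring
      rw [eq_powInt hT hs, eq_powInt hT h4, D.powInt_mulF_univ hV]
      have h7 := D.powInt_tL hV h3 φ
      rw [← h6] at h7
      rw [h7, ← mul_assoc, inv_mul_cancel₀ (pow_ne_zero _ h5), one_mul]

end Coefficients

/-- The coefficients of a Laurent expansion, numbered from `0`. -/
theorem exists_hasExp_of_isLaurentExpansion {f : (Fin n → ℝ) → ℝ} {u : ℤ → Distr V} {m : ℕ}
    (hu : IsLaurentExpansion V f (-1) m u) : ∃ T : ℂ → Distr V, IsComplexPower V f T ∧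
      ∀ φ, HasExp (fun s => (s + 1) ^ m * T s φ) (fun j => u ((j : ℤ) - m) φ) := by
  obtain ⟨T, hT, W, hW, h⟩ := hu
  refine ⟨T, hT, fun φ => ?_⟩
  rw [HasExp, eventually_nhdsWithin_iff]
  filter_upwards [hW] with s hs hs1
  have h1 := (h s hs hs1 φ).mul_left ((s + 1) ^ m)
  have h2 : s + 1 ≠ 0 := fun h => hs1 (eq_neg_of_add_eq_zero_left h)
  have h3 : (fun j : ℕ => (s + 1) ^ m * ((s - -1) ^ ((j : ℤ) - m) * u ((j : ℤ) - m) φ)) =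
      fun j : ℕ => (s + 1) ^ j * u ((j : ℤ) - m) φ := by
    funext j
    rw [sub_neg_eq_add, ← mul_assoc, ← zpow_natCast, ← zpow_add₀ h2, add_sub_cancel, zpow_natCast]
  rwa [h3] at h1

variable {D} {hV : V ≤ D.U} {u : ℤ → Distr V}
  (hu : IsLaurentExpansion V (fun x => ∏ j, D.f j x) (-1) m u)

include hu

theorem coeff_mulF_tv (hV : V ≤ D.U) {A : Finset (Fin m)} {i : Fin m} (hi : i ∈ A) (φ : 𝓓(V, ℂ))
    (j : ℕ) : u ((j : ℤ) - m) (D.mulF hV A (D.tv hV (Fin.castLE D.hmn i) φ)) =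
      if j < 1 then 0 else u (((j - 1 : ℕ) : ℤ) - m) (D.mulF hV (A.erase i) φ) := by
  obtain ⟨T, hT, h⟩ := exists_hasExp_of_isLaurentExpansion hu
  have h1 := (h (D.mulF hV (A.erase i) φ)).pow_mul 1
  have h2 := (h (D.mulF hV A (D.tv hV (Fin.castLE D.hmn i) φ))).congr
    (h := fun s => (s + 1) ^ 1 * ((s + 1) ^ m * T s (D.mulF hV (A.erase i) φ)))
    ((eventually_mulF_tv hT hV hi φ).mono fun s hs => by
      rw [hs]; ring)
  exact congrFun (h2.unique h1) j

theorem coeff_tv_of_le (hV : V ≤ D.U) {l : Fin n} (hl : m ≤ (l : ℕ)) (φ : 𝓓(V, ℂ)) (j : ℕ) :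
    u ((j : ℤ) - m) (D.tv hV l φ) = 0 := by
  obtain ⟨T, hT, h⟩ := exists_hasExp_of_isLaurentExpansion hu
  have h1 : HasExp (fun _ => 0) (fun _ => 0) := Eventually.of_forall fun s => by
    simp
  have h2 := (h (D.tv hV l φ)).congr
    ((eventually_tv_of_le hT hV hl φ).mono fun s hs => by rw [hs, mul_zero])
  exact congrFun (h2.unique h1) j

/-- The polar part of the Laurent expansion is annihilated by `f₁ ⋯ fₘ`. -/
theorem coeff_mulF_univ (hV : V ≤ D.U) (φ : 𝓓(V, ℂ)) {j : ℕ} (hj : j < m) :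
    u ((j : ℤ) - m) (D.mulF hV Finset.univ φ) = 0 := by
  obtain ⟨T, hT, h⟩ := exists_hasExp_of_isLaurentExpansion hu
  obtain ⟨g, hg, hTg⟩ := exists_analyticAt_mulF_univ hT hV φ
  obtain ⟨a, ha, -⟩ := exists_hasExp hg
  have h2 := (h (D.mulF hV Finset.univ φ)).congr (hTg.mono fun s hs => by rw [hs])
  have := congrFun (h2.unique (ha.pow_mul m)) j
  rwa [if_pos hj] at this

/-- The coefficient of index `j - m` is annihilated by the products of more than `j` of the
functions: applying `v i` to the product over `insert i A` and the next coefficient gives the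
product over `A`. -/
theorem coeff_mulF (hV : V ≤ D.U) (A : Finset (Fin m)) {j : ℕ} (hj : j + Aᶜ.card < m)
    (φ : 𝓓(V, ℂ)) : u ((j : ℤ) - m) (D.mulF hV A φ) = 0 := by
  induction hc : Aᶜ.card generalizing A j φ with
  | zero =>
    rw [Finset.card_eq_zero, Finset.compl_eq_empty_iff] at hc
    subst hc
    exact coeff_mulF_univ hu hV φ (by omega)
  | succ k ih =>
    obtain ⟨i, hi⟩ : Aᶜ.Nonempty := by rw [← Finset.card_pos]; omega
    have hi' : i ∉ A := Finset.mem_compl.1 hi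
    have h1 := coeff_mulF_tv hu hV (Finset.mem_insert_self i A) φ (j + 1)
    rw [if_neg (by omega), Nat.add_sub_cancel, Finset.erase_insert hi'] at h1
    have h2 : (insert i A)ᶜ.card = k := by
      rw [Finset.compl_insert, Finset.card_erase_of_mem hi, hc, Nat.add_sub_cancel]
    rw [← h1]
    exact ih _ (by omega) _ h2

theorem coeff_mulF_singleton_tv (hV : V ≤ D.U) (i : Fin m) (φ : 𝓓(V, ℂ)) (j : ℕ) :
    u (((j + 1 : ℕ) : ℤ) - m) (D.mulF hV {i} (D.tv hV (Fin.castLE D.hmn i) φ)) =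
      u ((j : ℤ) - m) φ := by
  rw [coeff_mulF_tv hu hV (Finset.mem_singleton_self i), if_neg (by omega), Nat.add_sub_cancel]
  congr 1
  exact DFunLike.ext _ _ fun x => by simp [mulF, fprod]

/-- The operator `f i * v i` sends each coefficient to the difference of the preceding coefficient
and itself, whatever `i` is. -/
theorem coeff_tv_mulF_singleton (hV : V ≤ D.U) (i : Fin m) (φ : 𝓓(V, ℂ)) (j : ℕ) :
    u ((j : ℤ) - m) (D.tv hV (Fin.castLE D.hmn i) (D.mulF hV {i} φ)) =
      (if j < 1 then 0 else u (((j - 1 : ℕ) : ℤ) - m) φ) - u ((j : ℤ) - m) φ := by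
  have h1 : D.tv hV (Fin.castLE D.hmn i) (D.mulF hV {i} φ) =
      D.mulF hV {i} (D.tv hV (Fin.castLE D.hmn i) φ) - φ := by
    refine transField_mulTest _ _ (fun x hx => ?_) φ
    have h2 := Complex.ofRealCLM.hasFDerivAt.comp x
      (D.fprod_analyticAt {i} (hV hx)).differentiableAt.hasFDerivAt
    have h3 : (fun x => (D.fprod {i} x : ℂ)) = Complex.ofRealCLM ∘ D.fprod {i} := rfl
    rw [h3, h2.fderiv]
    change ((fderiv ℝ (D.fprod {i}) x _ : ℝ) : ℂ) = 1
    rw [D.fderiv_fprod_self (Finset.mem_singleton_self i) (hV hx)]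
    simp [fprod]
  have h2 : D.mulF hV (Finset.erase {i} i) φ = φ :=
    DFunLike.ext _ _ fun x => by simp [mulF, fprod]
  rw [h1, map_sub, coeff_mulF_tv hu hV (Finset.mem_singleton_self i), h2]

/-- The generators of the ideal annihilate the coefficients. -/
theorem I_le_annIdeal (hV : V ≤ D.U) (h0 : (0 : Fin n → ℝ) ∈ V) (o : Fin m) (ho : (o : ℕ) = 0)
    {k : ℕ} (hk : k < m) :
    (D.chart.frame D.hmn).I o k ≤ annIdeal h0 (u ((k : ℤ) - m)) := by
  have hrep : ∀ i : Fin n, Represents V (D.V i) (D.tv hV i) := fun i =>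
    represents_transField h0 ((D.hv i).mono hV)
  rw [← D.span_generators_eq o ho k]
  refine Ideal.span_le.2 ?_
  rintro P ((⟨J, hJ, rfl⟩ | ⟨i₁, i, hi₁, hi, rfl⟩) | ⟨j, hj, rfl⟩)
  · refine mem_annihilator.2 ⟨V, le_rfl, D.mulF hV J,
      Represents.ofFun h0 (D.fprodC_analyticOnNhd hV J), fun φ => ?_⟩
    have h1 : extTest le_rfl (D.mulF hV J φ) = D.mulF hV J φ := DFunLike.ext _ _ fun x => by simp
    rw [h1]
    refine coeff_mulF hu hV J ?_ φ
    rw [Finset.card_compl, Fintype.card_fin]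
    omega
  · have hrep2 : ∀ i : Fin m, Represents V (DiffOpGerm.ofRealFun (D.f i) (D.hf i 0 D.h0) *
        D.V (Fin.castLE D.hmn i)) (fun φ => D.tv hV (Fin.castLE D.hmn i) (D.mulF hV {i} φ)) := by
      intro i
      have h1 : AnalyticOnNhd ℝ (fun x => (D.f i x : ℂ)) V := fun x hx =>
        (Complex.ofRealCLM.analyticAt _).comp (D.hf i x (hV hx))
      refine (Represents.ofFun_mul h0 (hrep (Fin.castLE D.hmn i)) h1).congr rfl fun φ => ?_
      congr 1
      exact DFunLike.ext _ _ fun x => by simp [mulF, fprod]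
    refine mem_annihilator.2 ⟨V, le_rfl, _, ((hrep2 i₁).add (hrep2 i).neg).congr
      (sub_eq_add_neg _ _).symm fun φ => rfl, fun φ => ?_⟩
    have h1 : ∀ ψ : 𝓓(V, ℂ), extTest le_rfl ψ = ψ := fun ψ => DFunLike.ext _ _ fun x => by simp
    rw [h1, map_add, map_neg, coeff_tv_mulF_singleton hu hV, coeff_tv_mulF_singleton hu hV,
      add_neg_cancel]
  · refine mem_annihilator.2 ⟨V, le_rfl, _, hrep j, fun φ => ?_⟩
    have h1 : ∀ ψ : 𝓓(V, ℂ), extTest le_rfl ψ = ψ := fun ψ => DFunLike.ext _ _ fun x => by simp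
    rw [h1]
    exact coeff_tv_of_le hu hV hj φ k

/-- Descent from one coefficient to the preceding one. -/
theorem mem_annIdeal_of_mul_eul_mem (hV : V ≤ D.U) (h0 : (0 : Fin n → ℝ) ∈ V) (o : Fin m)
    (ho : (o : ℕ) = 0) {k : ℕ} (hk : k + 1 < m) {P : DiffOpGerm n}
    (hP : P * (D.chart.frame D.hmn).eul o ∈ annIdeal h0 (u (((k + 1 : ℕ) : ℤ) - m))) :
    P ∈ annIdeal h0 (u ((k : ℤ) - m)) := by
  set L := D.chart.frame D.hmn with hL
  have hB : Represents V (D.V (Fin.castLE D.hmn o) * L.ι (L.x o))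
      (fun φ => D.mulF hV {o} (D.tv hV (Fin.castLE D.hmn o) φ)) := by
    have h1 : AnalyticOnNhd ℝ (fun x => (D.f o x : ℂ)) V := fun x hx =>
      (Complex.ofRealCLM.analyticAt _).comp (D.hf o x (hV hx))
    refine ((Represents.ofFun h0 h1).ofVectorField_mul ((D.hv (Fin.castLE D.hmn o)).mono hV)).congr
      ?_ fun φ => ?_
    · change D.V _ * DiffOpGerm.ofRealFun (D.f o) (D.hf o 0 D.h0) = _
      rw [D.ofRealFun_f]
      rfl
    · exact DFunLike.ext _ _ fun x => by simp [mulF, fprod, tv]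
  refine mem_annihilator_of_mul_mem hB (u' := u (((k + 1 : ℕ) : ℤ) - m))
    (fun φ => coeff_mulF_singleton_tv hu hV o φ k) ?_
  have h1 : D.V (Fin.castLE D.hmn o) * L.ι (L.x o) - L.eul o ∈ L.I o (k + 1) := by
    rw [D.V_eq, if_pos (by simp), add_mul]
    change L.eul o + _ - L.eul o ∈ _
    rw [add_sub_cancel_left, Finset.sum_mul]
    refine Ideal.sum_mem _ fun l _ => ?_
    have h2 : D.chart.dop l * L.ι (L.x o) = L.ι (L.x o) * L.y l := (L.commute_y_x l o).eq
    rw [mul_assoc, h2]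
    exact Ideal.mul_mem_left _ _ (Ideal.mul_mem_left _ _ (Ideal.subset_span (Or.inr ⟨l, rfl⟩)))
  have h2 := Ideal.add_mem _ hP (Ideal.mul_mem_left _ P (I_le_annIdeal hu hV h0 o ho hk h1))
  rwa [← mul_add, add_sub_cancel] at h2

end DualFrame

end

section

/-! ### Integrals of complex powers against products of functions of one variable -/

section EntireIntegral

variable {X : Type*} [MeasurableSpace X] {μ : Measure X}

theorem ppow_mul_inv_pow (t : ℝ) (s : ℂ) (N : ℕ) :
    ppow t s = ppow t (s + N) * ((t : ℂ) ^ N)⁻¹ := by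
  rcases lt_or_ge 0 t with ht | ht
  · have h0 : (t : ℂ) ≠ 0 := by exact_mod_cast ht.ne'
    rw [ppow_of_pos ht, ppow_of_pos ht, Complex.cpow_add _ _ h0, Complex.cpow_natCast,
      mul_inv_cancel_right₀ (pow_ne_zero _ h0)]
  · rw [ppow_of_nonpos ht, ppow_of_nonpos ht, zero_mul]

/-- Integrals of `f₊ˢ` over a set where `f` is bounded away from `0` are entire in `s`. -/
theorem differentiable_integral_ppow {f : X → ℝ} (hf : Measurable f) {ψ : X → ℂ}
    (hψ : Integrable ψ μ) {a B : ℝ} (ha : 0 < a) (hB : ∀ x, ψ x ≠ 0 → a ≤ f x ∧ f x ≤ B) :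
    Differentiable ℂ (fun s => ∫ x, ppow (f x) s * ψ x ∂μ) := by
  intro s
  obtain ⟨N, hN⟩ := exists_nat_gt (-s.re)
  have h1 : Integrable (fun x => ((f x : ℂ) ^ N)⁻¹ * ψ x) μ := by
    refine Integrable.mono' (hψ.norm.const_mul ((a ^ N)⁻¹))
      (((Complex.measurable_ofReal.comp hf).pow_const N).inv.aestronglyMeasurable.mul
        hψ.aestronglyMeasurable) (Eventually.of_forall fun x => ?_)
    by_cases hx : ψ x = 0
    · simp [hx]
    · have := (hB x hx).1
      rw [norm_mul, norm_inv, norm_pow, Complex.norm_real, Real.norm_of_nonneg (ha.le.trans this)]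
      gcongr
  have h2 : (fun s => ∫ x, ppow (f x) s * ψ x ∂μ) =
      (fun s => ∫ x, ppow (f x) s * (((f x : ℂ) ^ N)⁻¹ * ψ x) ∂μ) ∘ fun s => s + N := by
    funext s
    refine integral_congr_ae (Eventually.of_forall fun x => ?_)
    change ppow (f x) s * ψ x = ppow (f x) (s + N) * (((f x : ℂ) ^ N)⁻¹ * ψ x)
    rw [ppow_mul_inv_pow _ s N, mul_assoc]
  rw [h2]
  refine DifferentiableAt.comp s (differentiableAt_integral_ppow hf h1 (B := B) (fun x hx => ?_) ?_)
    (differentiableAt_id.add_const _)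
  · exact (hB x (right_ne_zero_of_mul hx)).2
  · rw [Complex.add_re, Complex.natCast_re]
    linarith

end EntireIntegral

/-- The odd function `sgn(t) |t|ˢ`. -/
def spow (t : ℝ) (s : ℂ) : ℂ := ppow t s - ppow (-t) s

theorem spow_neg (t : ℝ) (s : ℂ) : spow (-t) s = -spow t s := by
  rw [spow, spow, neg_neg, neg_sub]

theorem ppow_eq (t : ℝ) (s : ℂ) : ppow t s = (1 / 2) * ppow |t| s + (1 / 2) * spow t s := by
  rcases lt_or_ge 0 t with h | h
  · rw [spow, abs_of_pos h, ppow_of_nonpos (t := -t) (by linarith)]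
    ring
  · rw [spow, abs_of_nonpos h, ppow_of_nonpos h]
    ring

theorem ppow_mul {a b : ℝ} (ha : 0 ≤ a) (hb : 0 ≤ b) (s : ℂ) :
    ppow (a * b) s = ppow a s * ppow b s := by
  rcases ha.eq_or_lt with rfl | ha
  · simp [ppow_of_nonpos]
  rcases hb.eq_or_lt with rfl | hb
  · simp [ppow_of_nonpos]
  rw [ppow_of_pos ha, ppow_of_pos hb, ppow_of_pos (mul_pos ha hb), Complex.ofReal_mul,
    Complex.mul_cpow_ofReal_nonneg ha.le hb.le]

theorem spow_mul (a b : ℝ) (s : ℂ) : spow (a * b) s = spow a s * spow b s := by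
  have hpos : ∀ {a b : ℝ}, 0 ≤ a → 0 ≤ b → spow (a * b) s = spow a s * spow b s := by
    intro a b ha hb
    rw [spow, spow, spow, ppow_mul ha hb, ppow_of_nonpos (neg_nonpos.2 ha),
      ppow_of_nonpos (neg_nonpos.2 hb), ppow_of_nonpos (neg_nonpos.2 (mul_nonneg ha hb))]
    ring
  rcases le_total 0 a with ha | ha <;> rcases le_total 0 b with hb | hb
  · exact hpos ha hb
  · rw [← neg_neg b, spow_neg, mul_neg, spow_neg, hpos ha (neg_nonneg.2 hb), mul_neg]
  · rw [← neg_neg a, spow_neg, neg_mul, spow_neg, hpos (neg_nonneg.2 ha) hb, neg_mul]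
  · rw [← neg_neg a, ← neg_neg b, spow_neg, spow_neg (-b), neg_mul_neg,
      hpos (neg_nonneg.2 ha) (neg_nonneg.2 hb), neg_mul_neg]

theorem ppow_one (s : ℂ) : ppow 1 s = 1 := by
  rw [ppow_of_pos one_pos, Complex.ofReal_one, Complex.one_cpow]

theorem spow_one (s : ℂ) : spow 1 s = 1 := by
  rw [spow, ppow_one, ppow_of_nonpos (by norm_num), sub_zero]

theorem ppow_abs_prod {ι : Type*} (A : Finset ι) (y : ι → ℝ) (s : ℂ) :
    ppow |∏ i ∈ A, y i| s = ∏ i ∈ A, ppow |y i| s := by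
  classical
  induction A using Finset.induction_on with
  | empty => simp [ppow_one]
  | insert i A hi ih =>
    rw [Finset.prod_insert hi, Finset.prod_insert hi, abs_mul, ppow_mul (abs_nonneg _) (abs_nonneg _),
      ih]

theorem spow_prod {ι : Type*} (A : Finset ι) (y : ι → ℝ) (s : ℂ) :
    spow (∏ i ∈ A, y i) s = ∏ i ∈ A, spow (y i) s := by
  classical
  induction A using Finset.induction_on with
  | empty => simp [spow_one]
  | insert i A hi ih => rw [Finset.prod_insert hi, Finset.prod_insert hi, spow_mul, ih]

theorem integral_eq_zero_of_odd {g : ℝ → ℂ} (hg : ∀ t, g (-t) = -g t) : ∫ t, g t = 0 := by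
  have h1 := integral_neg_eq_self g volume
  simp only [hg, integral_neg] at h1
  exact self_eq_neg.1 h1.symm

theorem integrable_ppow_abs_mul {η : ℝ → ℂ} (hη : Continuous η) (hc : HasCompactSupport η) {s : ℂ}
    (hs : 0 < s.re) : Integrable fun t => ppow |t| s * η t :=
  (((continuous_ppow hs).comp continuous_abs).mul hη).integrable_of_hasCompactSupport hc.mul_left

theorem integrable_spow_mul {η : ℝ → ℂ} (hη : Continuous η) (hc : HasCompactSupport η) {s : ℂ}
    (hs : 0 < s.re) : Integrable fun t => spow t s * η t :=
  (((continuous_ppow hs).sub ((continuous_ppow hs).comp continuous_neg)).mul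
    hη).integrable_of_hasCompactSupport hc.mul_left

/-- Fubini for `(∏ i ∈ A, yᵢ)₊ˢ`: the part of the power that is odd in each variable contributes
nothing, as soon as one of the factors is even. -/
theorem integral_ppow_prod {ι : Type*} [Fintype ι] [DecidableEq ι] (A : Finset ι) {η : ι → ℝ → ℂ}
    (hη : ∀ i, Continuous (η i)) (hc : ∀ i, HasCompactSupport (η i)) {i₀ : ι} (hi₀ : i₀ ∈ A)
    (heven : ∀ t, η i₀ (-t) = η i₀ t) {s : ℂ} (hs : 0 < s.re) :
    ∫ y : ι → ℝ, ppow (∏ i ∈ A, y i) s * ∏ i, η i (y i) =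
      (1 / 2) * ((∏ i ∈ A, ∫ t, ppow |t| s * η i t) * ∏ i ∈ Aᶜ, ∫ t, η i t) := by
  set p : ι → ℝ → ℂ := fun i t => (if i ∈ A then ppow |t| s else 1) * η i t with hp
  set q : ι → ℝ → ℂ := fun i t => (if i ∈ A then spow t s else 1) * η i t with hq
  have hpi : ∀ i, Integrable (p i) := by
    intro i
    by_cases hi : i ∈ A
    · simp only [hp, hi, if_true]
      exact integrable_ppow_abs_mul (hη i) (hc i) hs
    · simp only [hp, hi, if_false, one_mul]
      exact (hη i).integrable_of_hasCompactSupport (hc i)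
  have hqi : ∀ i, Integrable (q i) := by
    intro i
    by_cases hi : i ∈ A
    · simp only [hq, hi, if_true]
      exact integrable_spow_mul (hη i) (hc i) hs
    · simp only [hq, hi, if_false, one_mul]
      exact (hη i).integrable_of_hasCompactSupport (hc i)
  have h1 : ∀ y : ι → ℝ, ppow (∏ i ∈ A, y i) s * ∏ i, η i (y i) =
      (1 / 2) * ∏ i, p i (y i) + (1 / 2) * ∏ i, q i (y i) := by
    intro y
    rw [ppow_eq, ppow_abs_prod, spow_prod]
    simp only [hp, hq, Finset.prod_mul_distrib, Finset.prod_ite_mem, Finset.univ_inter]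
    ring
  simp only [h1]
  have hpi' : Integrable fun y : ι → ℝ => ∏ i, p i (y i) := Integrable.fintype_prod hpi
  have hqi' : Integrable fun y : ι → ℝ => ∏ i, q i (y i) := Integrable.fintype_prod hqi
  rw [integral_add (hpi'.const_mul _) (hqi'.const_mul _), integral_const_mul, integral_const_mul,
    integral_fintype_prod_volume_eq_prod, integral_fintype_prod_volume_eq_prod,
    Finset.prod_eq_zero (Finset.mem_univ i₀) (f := fun i => ∫ t, q i t), mul_zero, add_zero]
  · congr 1
    rw [← Finset.prod_mul_prod_compl A]
    congr 1
    · exact Finset.prod_congr rfl fun i hi => by simp [hp, hi]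
    · exact Finset.prod_congr rfl fun i hi => by simp [hp, Finset.mem_compl.1 hi]
  · refine integral_eq_zero_of_odd fun t => ?_
    simp only [hq, hi₀, if_true, heven, spow_neg, neg_mul]

/-! ### Mellin transforms of bump functions near `-1` -/

section Bump

variable (h : ContDiffBump (0 : ℝ))

theorem continuous_bump_sub (c : ℝ) : Continuous fun t => (h (t - c) : ℂ) :=
  Complex.continuous_ofReal.comp (h.continuous.comp (continuous_id.sub continuous_const))

theorem bump_sub_eq_zero {c t : ℝ} (ht : h.rOut ≤ |t - c|) : (h (t - c) : ℂ) = 0 := by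
  rw [h.zero_of_le_dist (by simpa [Real.dist_eq] using ht), Complex.ofReal_zero]

theorem hasCompactSupport_bump_sub (c : ℝ) : HasCompactSupport fun t => (h (t - c) : ℂ) := by
  refine HasCompactSupport.intro (isCompact_closedBall c h.rOut) fun t ht => bump_sub_eq_zero h ?_
  rw [Metric.mem_closedBall, Real.dist_eq, not_le] at ht
  exact ht.le

/-- The Mellin transform of an even bump function at `0` has a simple pole at `-1`. -/
theorem exists_entire_integral_bump : ∃ N : ℂ → ℂ, Differentiable ℂ N ∧ N (-1) = 2 ∧
    ∀ s : ℂ, 0 < s.re → (s + 1) * ∫ t, ppow |t| s * (h t : ℂ) = N s := by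
  have ha := h.rIn_pos
  set ψ : ℝ → ℂ := (Set.Icc (-h.rIn) h.rIn)ᶜ.indicator fun t => (h t : ℂ) with hψ
  have hci : Integrable fun t => (h t : ℂ) := by
    simpa using (continuous_bump_sub h 0).integrable_of_hasCompactSupport
      (hasCompactSupport_bump_sub h 0)
  have h0 : ∀ t, h.rOut ≤ |t| → (h t : ℂ) = 0 := fun t ht => by
    have := bump_sub_eq_zero h (c := 0) (t := t) (by simpa using ht)
    simpa using this
  have hψi : Integrable ψ := hci.indicator measurableSet_Icc.compl
  have hd : Differentiable ℂ fun s => ∫ t, ppow |t| s * ψ t := by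
    refine differentiable_integral_ppow (f := fun t => |t|) measurable_norm hψi ha (B := h.rOut)
      fun t ht => ?_
    by_cases h1 : t ∈ (Set.Icc (-h.rIn) h.rIn)ᶜ
    · rw [hψ, Set.indicator_of_mem h1] at ht
      have h2 : h.rIn < |t| := by
        by_contra h3
        exact h1 (abs_le.1 (not_lt.1 h3))
      refine ⟨h2.le, ?_⟩
      by_contra h3
      exact ht (h0 t (not_le.1 h3).le)
    · rw [hψ, Set.indicator_of_notMem h1] at ht
      exact absurd rfl ht
  have hr : (h.rIn : ℂ) ≠ 0 := by exact_mod_cast ha.ne'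
  refine ⟨fun s => 2 * (h.rIn : ℂ) ^ (s + 1) + (s + 1) * ∫ t, ppow |t| s * ψ t, ?_, ?_, ?_⟩
  · intro s
    refine DifferentiableAt.add (DifferentiableAt.const_mul ?_ _)
      ((differentiableAt_id.add_const _).mul (hd s))
    exact (differentiableAt_id.add_const _).const_cpow (Or.inl hr)
  · simp
  · intro s hs
    have hs1 : s + 1 ≠ 0 := fun h => by
      have := congrArg Complex.re h
      simp at this
      linarith
    have h2 : ∀ t, ppow |t| s * (h t : ℂ) =
        (Set.Icc (-h.rIn) h.rIn).indicator (fun t => ppow |t| s) t + ppow |t| s * ψ t := by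
      intro t
      by_cases ht : t ∈ Set.Icc (-h.rIn) h.rIn
      · have h3 : (h t : ℂ) = 1 := by
          rw [h.one_of_mem_closedBall (by simpa [Real.dist_eq] using abs_le.2 ht),
            Complex.ofReal_one]
        rw [hψ, Set.indicator_of_mem ht, Set.indicator_of_notMem (by simpa using ht), h3]
        ring
      · rw [hψ, Set.indicator_of_notMem ht, Set.indicator_of_mem (by simpa using ht), zero_add]
    have hcont : Continuous fun t : ℝ => ppow |t| s := (continuous_ppow hs).comp continuous_abs
    have h3 : ∫ t in (0 : ℝ)..h.rIn, ppow |t| s = (h.rIn : ℂ) ^ (s + 1) / (s + 1) := by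
      rw [intervalIntegral.integral_congr_ae (g := fun t : ℝ => (t : ℂ) ^ s), integral_cpow]
      · simp [Complex.zero_cpow hs1]
      · exact Or.inl (by linarith)
      · refine Eventually.of_forall fun t ht => ?_
        rw [Set.uIoc_of_le ha.le] at ht
        rw [abs_of_pos ht.1, ppow_of_pos ht.1]
    have h4 : ∫ t in (-h.rIn)..(0 : ℝ), ppow |t| s = (h.rIn : ℂ) ^ (s + 1) / (s + 1) := by
      have h5 := intervalIntegral.integral_comp_neg (a := 0) (b := h.rIn) fun t => ppow |t| s
      simp only [abs_neg, neg_zero] at h5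
      rw [← h5, h3]
    simp only [h2]
    rw [integral_add ((hcont.integrableOn_Icc).integrable_indicator measurableSet_Icc),
      integral_indicator measurableSet_Icc, integral_Icc_eq_integral_Ioc,
      ← intervalIntegral.integral_of_le (by linarith),
      ← intervalIntegral.integral_add_adjacent_intervals (b := 0)
        (hcont.intervalIntegrable _ _) (hcont.intervalIntegrable _ _), h3, h4]
    · field_simp
      ring
    · exact integrable_ppow_mul (f := fun t : ℝ => |t|) measurable_norm hψi (B := h.rOut)
        (fun t ht => by
          by_contra h3
          refine ht ?_
          rw [hψ, Set.indicator_apply_eq_zero]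
          exact fun _ => h0 t (not_le.1 h3).le) hs.le

/-- A factor `t₊ˢ`, integrated away from `t = 0`, contributes no pole. -/
theorem differentiable_integral_bump {c : ℝ} (hc : h.rOut < |c|) :
    Differentiable ℂ (fun s => ∫ t, ppow |t| s * ((t : ℂ) * (h (t - c) : ℂ))) := by
  have h1 : Continuous fun t : ℝ => (t : ℂ) * (h (t - c) : ℂ) :=
    Complex.continuous_ofReal.mul (continuous_bump_sub h c)
  refine differentiable_integral_ppow (f := fun t => |t|) measurable_norm
    (h1.integrable_of_hasCompactSupport (hasCompactSupport_bump_sub h c).mul_left)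
    (sub_pos.2 hc) (B := |c| + h.rOut) fun t ht => ?_
  have h2 : |t - c| < h.rOut := by
    by_contra h3
    exact right_ne_zero_of_mul ht (bump_sub_eq_zero h (not_lt.1 h3))
  have h3 := abs_sub_abs_le_abs_sub c t
  have h4 := abs_sub_abs_le_abs_sub t c
  rw [abs_sub_comm] at h3
  constructor <;> linarith

theorem integral_bump_sub_ne_zero (c : ℝ) : ∫ t, (h (t - c) : ℂ) ≠ 0 := by
  rw [integral_sub_right_eq_self (fun t => (h t : ℂ)) c, integral_complex_ofReal]
  exact_mod_cast (h.integral_pos (μ := volume)).ne'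

/-- The support of the bump function lies on one side of `0`, where `|t|⁻¹ * t` is constant. -/
theorem integral_bump_ne_zero {c : ℝ} (hc : h.rOut < |c|) :
    ∫ t, ppow |t| (-1) * ((t : ℂ) * (h (t - c) : ℂ)) ≠ 0 := by
  have hc0 : c ≠ 0 := fun h0 => by
    rw [h0, abs_zero] at hc
    exact absurd hc h.rOut_pos.le.not_gt
  have h1 : ∀ t : ℝ, ppow |t| (-1) * ((t : ℂ) * (h (t - c) : ℂ)) =
      ((c / |c| : ℝ) : ℂ) * (h (t - c) : ℂ) := by
    intro t
    by_cases ht : h.rOut ≤ |t - c|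
    · rw [bump_sub_eq_zero h ht]
      simp
    · rw [not_le] at ht
      have h2 : t / |t| = c / |c| := by
        rw [abs_lt] at ht
        rcases lt_or_gt_of_ne hc0 with h3 | h3
        · rw [abs_of_neg h3] at hc ⊢
          have h4 : t < 0 := by linarith
          rw [abs_of_neg h4, div_neg, div_neg, div_self h4.ne, div_self h3.ne]
        · rw [abs_of_pos h3] at hc ⊢
          have h4 : 0 < t := by linarith
          rw [abs_of_pos h4, div_self h4.ne', div_self h3.ne']
      have h3 : 0 < |t| := abs_pos.2 fun h0 => by
        rw [h0, zero_sub, abs_neg] at ht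
        linarith
      rw [ppow_of_pos h3, Complex.cpow_neg_one, ← h2]
      push_cast
      ring
  simp only [h1]
  rw [integral_const_mul]
  exact mul_ne_zero (by exact_mod_cast div_ne_zero hc0 (abs_pos.2 hc0).ne')
    (integral_bump_sub_ne_zero h c)

end Bump

end

section

/-! ### Supports of the coefficients of a Laurent expansion -/

namespace DualFrame

variable {n m : ℕ} {V : Opens (Fin n → ℝ)} (D : DualFrame n m)

/-- A function of the coordinates, with compact support in the image of `S`, as a test function. -/
theorem exists_testFunction_comp {S : Opens (Fin n → ℝ)}
    (hS : (S : Set (Fin n → ℝ)) ⊆ D.homeo.source) {χ : (Fin n → ℝ) → ℂ} (hχ : ContDiff ℝ (⊤ : ℕ∞) χ)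
    {B : Set (Fin n → ℝ)} (hB : IsCompact B) (hBS : B ⊆ D.F '' S) (hχB : ∀ y, y ∉ B → χ y = 0) :
    ∃ ψ : 𝓓(S, ℂ), ∀ x ∈ S, ψ x = χ (D.F x) := by
  classical
  set K := D.homeo.symm '' B with hK
  have hsymm : ∀ x ∈ S, D.homeo.symm (D.F x) = x := fun x hx => by
    rw [← D.coe_homeo]
    exact D.homeo.left_inv (hS hx)
  have hBt : B ⊆ D.homeo.target := by
    intro y hy
    obtain ⟨x, hx, rfl⟩ := hBS hy
    rw [← D.coe_homeo]
    exact D.homeo.map_source (hS hx)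
  have hKc : IsCompact K := hB.image_of_continuousOn (D.homeo.continuousOn_symm.mono hBt)
  have hKS : K ⊆ S := by
    rintro _ ⟨y, hy, rfl⟩
    obtain ⟨x, hx, rfl⟩ := hBS hy
    rwa [hsymm x hx]
  set g : (Fin n → ℝ) → ℂ := (S : Set (Fin n → ℝ)).indicator (χ ∘ D.F) with hg
  have hgK : ∀ x, x ∉ K → g x = 0 := by
    intro x hx
    by_cases hxS : x ∈ (S : Set (Fin n → ℝ))
    · rw [hg, Set.indicator_of_mem hxS]
      refine hχB _ fun h => hx ⟨_, h, hsymm x hxS⟩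
    · rw [hg, Set.indicator_of_notMem hxS]
  have hgs : ContDiff ℝ (⊤ : ℕ∞) g := by
    rw [contDiff_iff_contDiffAt]
    intro x
    by_cases hxS : x ∈ (S : Set (Fin n → ℝ))
    · have h1 : ContDiffAt ℝ (⊤ : ℕ∞) (χ ∘ D.F) x :=
        hχ.contDiffAt.comp x (D.F_analyticAt (D.source_subset (hS hxS))).contDiffAt
      refine h1.congr_of_eventuallyEq ?_
      filter_upwards [S.isOpen.mem_nhds hxS] with y hy
      rw [hg, Set.indicator_of_mem hy]
    · refine contDiffAt_const (c := (0 : ℂ)) |>.congr_of_eventuallyEq ?_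
      filter_upwards [hKc.isClosed.isOpen_compl.mem_nhds fun h => hxS (hKS h)] with y hy
      exact hgK y hy
  refine ⟨⟨g, hgs, HasCompactSupport.intro hKc hgK, ?_⟩, fun x hx => ?_⟩
  · exact (closure_minimal (Function.support_subset_iff'.2 hgK) hKc.isClosed).trans hKS
  · exact Set.indicator_of_mem (s := (S : Set (Fin n → ℝ))) hx _

/-- Change of variables. -/
theorem integral_comp_F {S : Set (Fin n → ℝ)} (hSo : IsOpen S) (hS : S ⊆ D.homeo.source)
    {g ψ : (Fin n → ℝ) → ℂ} (hψ : ∀ x ∈ S, ψ x = |(fderiv ℝ D.F x).det| • g (D.F x))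
    (hψ0 : ∀ x, x ∉ S → ψ x = 0) (hg : ∀ y, y ∉ D.F '' S → g y = 0) :
    ∫ x, ψ x = ∫ y, g y := by
  have h1 := integral_image_eq_integral_abs_det_fderiv_smul volume hSo.measurableSet
    (f := D.F) (f' := fun x => fderiv ℝ D.F x)
    (fun x hx => (D.F_analyticAt
      (D.source_subset (hS hx))).differentiableAt.hasFDerivAt.hasFDerivWithinAt)
    (by rw [← D.coe_homeo]; exact D.homeo.injOn.mono hS) g
  rw [setIntegral_eq_integral_of_forall_compl_eq_zero hg] at h1
  rw [h1, ← setIntegral_eq_integral_of_forall_compl_eq_zero hψ0]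
  exact setIntegral_congr_fun hSo.measurableSet hψ

/-- Near a point where exactly `m - k` of the `f j` vanish there is a test function against which
`f₊ˢ` has a pole of order exactly `m - k` at `-1`. -/
theorem exists_test_powInt {S : Opens (Fin n → ℝ)} (hS : S ≤ V) {p : Fin n → ℝ} (hpS : p ∈ S)
    (hp : p ∈ D.homeo.source) {J : Finset (Fin m)} (hJ : J.card < m)
    (hpJ : ∀ j ∈ J, D.f j p ≠ 0) (hpJc : ∀ j ∉ J, D.f j p = 0) :
    ∃ (ψ : 𝓓(S, ℂ)) (H : ℂ → ℂ), Differentiable ℂ H ∧ H (-1) ≠ 0 ∧ ∀ s : ℂ, 0 < s.re →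
      (s + 1) ^ (m - J.card) * D.powInt s (extTest hS ψ) = H s := by
  classical
  set q := D.F p with hq
  have hdc : ContinuousAt (fun x => (fderiv ℝ D.F x).det) p :=
    (analyticAt_det_fderiv (D.F_analyticAt (D.source_subset hp))).continuousAt
  have hd : ∀ᶠ x in 𝓝 p, 0 < (fderiv ℝ D.F x).det * (fderiv ℝ D.F p).det :=
    (hdc.mul continuousAt_const).eventually (lt_mem_nhds (mul_self_pos.2 (D.det_ne_zero hp)))
  obtain ⟨S₁, hS₁, hS₁o, hpS₁⟩ := eventually_nhds_iff.1
    ((hd.and (D.homeo.open_source.mem_nhds hp)).and (S.isOpen.mem_nhds hpS))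
  set S' : Opens (Fin n → ℝ) := ⟨S₁, hS₁o⟩ with hS'
  have hS'S : S' ≤ S := fun x hx => (hS₁ x hx).2
  have hS's : (S' : Set (Fin n → ℝ)) ⊆ D.homeo.source := fun x hx => (hS₁ x hx).1.2
  have hFo : IsOpen (D.F '' S') := by
    rw [← D.coe_homeo]
    exact D.homeo.isOpen_image_of_subset_source hS₁o hS's
  obtain ⟨ε, hε, hεF⟩ := Metric.nhds_basis_closedBall.mem_iff.1
    (hFo.mem_nhds (Set.mem_image_of_mem _ hpS₁ : q ∈ D.F '' S'))
  -- Within the radius `r` the coordinates that do not vanish at `p` keep their sign.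
  obtain ⟨r, ⟨hrε, hrJ⟩, hr⟩ : ∃ r : ℝ, (r ≤ ε ∧ ∀ j ∈ J, r < |D.f j p|) ∧ 0 < r := by
    have h1 : ∀ᶠ r in 𝓝 (0 : ℝ), r ≤ ε ∧ ∀ j ∈ J, r < |D.f j p| := by
      refine (eventually_le_nhds hε).and ((Filter.eventually_all_finset J).2 fun j hj => ?_)
      exact gt_mem_nhds (abs_pos.2 (hpJ j hj))
    exact ((h1.filter_mono nhdsWithin_le_nhds).and self_mem_nhdsWithin).exists (f := 𝓝[>] (0 : ℝ))
  let h : ContDiffBump (0 : ℝ) := ⟨r / 2, r, by linarith, by linarith⟩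
  set A : Finset (Fin n) := Finset.univ.map (Fin.castLEEmb D.hmn) with hA
  set JJ : Finset (Fin n) := J.map (Fin.castLEEmb D.hmn) with hJJ
  have hJA : JJ ⊆ A := Finset.map_subset_map.2 (Finset.subset_univ J)
  -- The factor `t` makes the Mellin transform in a coordinate that does not vanish at `p` equal to
  -- a nonzero integral at `s = -1`.
  set η : Fin n → ℝ → ℂ := fun i t => (if i ∈ JJ then (t : ℂ) else 1) * (h (t - q i) : ℂ) with hη
  have hηs : ∀ i, ContDiff ℝ (⊤ : ℕ∞) (η i) := by
    intro i
    refine ContDiff.mul ?_ (Complex.ofRealCLM.contDiff.comp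
      (h.contDiff.comp (contDiff_id.sub contDiff_const)))
    split_ifs
    · exact Complex.ofRealCLM.contDiff
    · exact contDiff_const
  have hηc : ∀ i, HasCompactSupport (η i) := fun i => (hasCompactSupport_bump_sub h (q i)).mul_left
  set χ : (Fin n → ℝ) → ℂ := fun y => ∏ i, η i (y i) with hχ
  have hχs : ContDiff ℝ (⊤ : ℕ∞) χ :=
    contDiff_prod fun i _ => (hηs i).comp (contDiff_apply ℝ ℝ i)
  have hχ0 : ∀ y, y ∉ Metric.closedBall q r → χ y = 0 := by
    intro y hy
    rw [closedBall_pi _ hr.le, Set.mem_univ_pi, not_forall] at hy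
    obtain ⟨i, hi⟩ := hy
    rw [Metric.mem_closedBall, Real.dist_eq, not_le] at hi
    refine Finset.prod_eq_zero (Finset.mem_univ i) ?_
    exact mul_eq_zero_of_right _ (bump_sub_eq_zero h hi.le)
  have hBF : Metric.closedBall q r ⊆ D.F '' S' := (Metric.closedBall_subset_closedBall hrε).trans hεF
  obtain ⟨ψ₀, hψ₀⟩ := D.exists_testFunction_comp hS's hχs (isCompact_closedBall q r) hBF hχ0
  -- Near `p`, the factor `c * det` is the absolute value of the Jacobian, and it is analytic.
  set c : ℝ := |(fderiv ℝ D.F p).det| / (fderiv ℝ D.F p).det with hc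
  have hca : AnalyticOnNhd ℝ (fun x => ((c * (fderiv ℝ D.F x).det : ℝ) : ℂ)) S' := fun x hx =>
    (Complex.ofRealCLM.analyticAt _).comp (analyticAt_const.mul
      (analyticAt_det_fderiv (D.F_analyticAt (D.source_subset (hS's hx)))))
  have hcd : ∀ x ∈ S', c * (fderiv ℝ D.F x).det = |(fderiv ℝ D.F x).det| := by
    intro x hx
    have h1 := (hS₁ x hx).1.1
    rcases lt_or_gt_of_ne (D.det_ne_zero hp) with h2 | h2
    · rw [hc, abs_of_neg h2, abs_of_neg (neg_of_mul_pos_left h1 h2.le), neg_div, div_self h2.ne]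
      ring
    · rw [hc, abs_of_pos h2, abs_of_pos (pos_of_mul_pos_left h1 h2.le), div_self h2.ne', one_mul]
  have hpow : ∀ s, D.powInt s (extTest hS (extTest hS'S (mulTest _ hca ψ₀))) =
      ∫ y : Fin n → ℝ, ppow (∏ i ∈ A, y i) s * ∏ i, η i (y i) := by
    intro s
    refine D.integral_comp_F (S := S') hS₁o hS's (fun x hx => ?_) (fun x hx => ?_) fun y hy => ?_
    · rw [extTest_apply, extTest_apply, mulTest_apply, hψ₀ x hx, hcd x hx, hA, Finset.prod_map,
        Complex.real_smul]
      have h1 : ∏ j : Fin m, D.F x (Fin.castLEEmb D.hmn j) = D.fprod Finset.univ x :=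
        Finset.prod_congr rfl fun j _ => D.F_castLE x j
      rw [h1]
      ring
    · rw [extTest_apply, extTest_apply, testFunction_eq_zero _ hx, mul_zero]
    · have h1 : χ y = 0 := hχ0 y fun h => hy (hBF h)
      rw [show ∏ i, η i (y i) = 0 from h1, mul_zero]
  obtain ⟨i₀, hi₀⟩ : ∃ i₀, i₀ ∉ J := by
    by_contra! h1
    rw [Finset.eq_univ_of_forall h1, Finset.card_fin] at hJ
    exact lt_irrefl _ hJ
  have hqc : ∀ j : Fin m, q (Fin.castLEEmb D.hmn j) = D.f j p := fun j => D.F_castLE p j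
  have hη0 : ∀ i ∈ A \ JJ, η i = fun t => (h t : ℂ) := by
    intro i hi
    obtain ⟨h1, h2⟩ := Finset.mem_sdiff.1 hi
    obtain ⟨j, -, rfl⟩ := Finset.mem_map.1 h1
    have h3 : j ∉ J := fun h => h2 (Finset.mem_map_of_mem _ h)
    funext t
    simp only [hη, h2, if_false, hqc, hpJc j h3, sub_zero, one_mul]
  have hη1 : ∀ i ∈ JJ, h.rOut < |q i| ∧ η i = fun t : ℝ => (t : ℂ) * (h (t - q i) : ℂ) := by
    intro i hi
    refine ⟨?_, ?_⟩
    · obtain ⟨j, hj, rfl⟩ := Finset.mem_map.1 hi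
      rw [hqc]
      exact hrJ j hj
    · funext t
      simp only [hη, hi, if_true]
  have hi₀A : Fin.castLEEmb D.hmn i₀ ∈ A \ JJ := by
    rw [Finset.mem_sdiff]
    refine ⟨Finset.mem_map_of_mem _ (Finset.mem_univ _), fun h1 => hi₀ ?_⟩
    rwa [hJJ, Finset.mem_map'] at h1
  have hcard : (A \ JJ).card = m - J.card := by
    rw [Finset.card_sdiff_of_subset hJA, hA, hJJ, Finset.card_map, Finset.card_map, Finset.card_fin]
  obtain ⟨N, hN, hN1, hN2⟩ := exists_entire_integral_bump h
  refine ⟨extTest hS'S (mulTest _ hca ψ₀), fun s => (1 / 2) *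
    ((N s ^ (m - J.card) * ∏ i ∈ JJ, ∫ t, ppow |t| s * η i t) * ∏ i ∈ Aᶜ, ∫ t, η i t), ?_, ?_,
    fun s hs => ?_⟩
  · refine Differentiable.const_mul (((hN.pow _).mul ?_).mul_const _) _
    intro s
    refine DifferentiableAt.fun_finsetProd fun i hi => ?_
    obtain ⟨h1, h2⟩ := hη1 i hi
    rw [h2]
    exact differentiable_integral_bump h h1 s
  · refine mul_ne_zero (by norm_num) (mul_ne_zero (mul_ne_zero ?_ ?_) ?_)
    · rw [hN1]
      exact pow_ne_zero _ two_ne_zero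
    · refine Finset.prod_ne_zero_iff.2 fun i hi => ?_
      obtain ⟨h1, h2⟩ := hη1 i hi
      rw [h2]
      exact integral_bump_ne_zero h h1
    · refine Finset.prod_ne_zero_iff.2 fun i hi => ?_
      have h1 : i ∉ JJ := fun h => Finset.mem_compl.1 hi (hJA h)
      simp only [hη, h1, if_false, one_mul]
      exact integral_bump_sub_ne_zero h (q i)
  · have heven : ∀ t, η (Fin.castLEEmb D.hmn i₀) (-t) = η (Fin.castLEEmb D.hmn i₀) t := fun t => by
      rw [hη0 _ hi₀A]
      exact congrArg _ (h.neg t)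
    rw [hpow, integral_ppow_prod A (fun i => (hηs i).continuous) hηc (Finset.mem_sdiff.1 hi₀A).1
      heven hs, ← Finset.prod_sdiff hJA, Finset.prod_congr rfl fun i hi => by rw [hη0 i hi],
      Finset.prod_const, hcard]
    simp only [← hN2 s hs, mul_pow]
    ring

variable {D} {hV : V ≤ D.U} {u : ℤ → Distr V}
  (hu : IsLaurentExpansion V (fun x => ∏ j, D.f j x) (-1) m u)

include hu

/-- The support of `u_{k-m}` contains the points where exactly `m - k` of the `f j` vanish. -/
theorem exists_coeff_ne_zero {S : Opens (Fin n → ℝ)} (hS : S ≤ V) {p : Fin n → ℝ} (hpS : p ∈ S)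
    (hp : p ∈ D.homeo.source) {J : Finset (Fin m)} (hJ : J.card < m)
    (hpJ : ∀ j ∈ J, D.f j p ≠ 0) (hpJc : ∀ j ∉ J, D.f j p = 0) :
    ∃ ψ : 𝓓(S, ℂ), u ((J.card : ℤ) - m) (extTest hS ψ) ≠ 0 := by
  obtain ⟨ψ, H, hH, hH1, hH2⟩ := D.exists_test_powInt hS hpS hp hJ hpJ hpJc
  refine ⟨ψ, ?_⟩
  obtain ⟨T, hT, h⟩ := exists_hasExp_of_isLaurentExpansion hu
  obtain ⟨a, ha, ha0⟩ := exists_hasExp (hH.analyticAt (-1))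
  have hlin : ∀ s : ℂ, AnalyticAt ℂ (fun s : ℂ => s + 1) s := fun s =>
    analyticAt_id.add analyticAt_const
  have h1 := eventually_eq_of_meromorphic
    (g := fun s => (s + 1) ^ (m - J.card) * T s (extTest hS ψ)) (h := H)
    (fun s _ => ((hlin s).pow _).meromorphicAt.mul (hT.1 _ s (Set.mem_univ _)))
    (fun s _ => (hH.analyticAt s).meromorphicAt) (c := 0)
    (fun s hs => by rw [eq_powInt hT hs, hH2 s hs]) (-1)
  have h2 := (h (extTest hS ψ)).congr (h := fun s => (s + 1) ^ J.card * H s)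
    (h1.mono fun s hs => by
      rw [← hs, ← mul_assoc, ← pow_add, Nat.add_sub_cancel' hJ.le])
  have h3 := congrFun (h2.unique (ha.pow_mul J.card)) J.card
  rw [if_neg (lt_irrefl _), Nat.sub_self, ha0] at h3
  exact h3 ▸ hH1

/-- A function that annihilates `u_{k-m}` vanishes where exactly `m - k` of the `f j` vanish. -/
theorem vanishesOn_of_mem_annIdeal (h0 : (0 : Fin n → ℝ) ∈ V) {J : Finset (Fin m)}
    (hJ : J.card < m) {a : AnalyticGerm n}
    (ha : DiffOpGerm.ofGerm n (a * ∏ j ∈ J, D.chart.coord (Fin.castLE D.hmn j)) ∈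
      annIdeal h0 (u ((J.card : ℤ) - m))) : D.chart.VanishesOn D.hmn Jᶜ a := by
  have hZ := D.chart.isVanishing_vanishesOn D.hmn
  have hdiv : ∀ J' : Finset (Fin m), J' ⊆ J →
      D.chart.VanishesOn D.hmn Jᶜ (a * ∏ j ∈ J', D.chart.coord (Fin.castLE D.hmn j)) →
      D.chart.VanishesOn D.hmn Jᶜ a := by
    intro J'
    induction J' using Finset.induction_on with
    | empty => intro _ h; simpa using h
    | insert i J' hi ih =>
      intro hsub h
      refine ih ((Finset.subset_insert _ _).trans hsub) (hZ.div _ i _ ?_ ?_)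
      · simpa using hsub (Finset.mem_insert_self i J')
      · rw [Finset.prod_insert hi] at h
        have h1 : (D.chart.frame D.hmn).x i = D.chart.coord (Fin.castLE D.hmn i) := rfl
        rw [h1]
        convert h using 1
        ring
  refine hdiv J subset_rfl ?_
  obtain ⟨k, hk, rfl⟩ := D.chart.exists_mkF a
  have hka : AnalyticAt ℝ (fun x => k (D.F x) * (D.fprod J x : ℂ)) 0 :=
    (hk.comp D.chart.hF).mul ((Complex.ofRealCLM.analyticAt _).comp (D.fprod_analyticAt J D.h0))
  have hprod : D.chart.mkF k hk * ∏ j ∈ J, D.chart.coord (Fin.castLE D.hmn j) =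
      AnalyticGerm.mk (fun x => k (D.F x) * (D.fprod J x : ℂ)) hka := by
    simp only [coord_chart]
    rw [AnalyticGerm.mk_prod]
    refine (AnalyticGerm.mk_eq_iff (hh := (hk.comp D.chart.hF).mul
      (Finset.analyticAt_fun_prod J fun j _ => D.f_analyticAt j))).2
      (Eventually.of_forall fun x => ?_)
    simp [fprod, chart]
  rw [hprod] at ha ⊢
  rw [D.chart.mk_eq_mkF hka, GermChart.vanishesOn_mkF]
  set V' : Opens (Fin n → ℝ) :=
    V ⊓ ⟨{x | AnalyticAt ℝ (fun x => k (D.F x) * (D.fprod J x : ℂ)) x}, isOpen_analyticAt ℝ _⟩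
    with hV'
  have ha' : AnalyticOnNhd ℝ (fun x => k (D.F x) * (D.fprod J x : ℂ)) V' := fun x hx => hx.2
  obtain ⟨W, hW, hW0, hWu⟩ := exists_of_mem_annihilator ha inf_le_left
    (Represents.ofFun (V := V') ⟨h0, hka⟩ ha')
  have hnear : ∀ᶠ y in 𝓝 (D.chart.F 0), D.chart.G y ∈ W ∧ D.chart.G y ∈ D.homeo.source ∧
      D.chart.F (D.chart.G y) = y :=
    (D.chart.tendsto_G.eventually (W.isOpen.mem_nhds hW0)).and
      ((D.chart.tendsto_G.eventually (D.homeo.open_source.mem_nhds D.zero_mem_source)).and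
        D.chart.hFG)
  filter_upwards [hnear] with y ⟨hyW, hys, hy⟩ hyK
  by_contra hne
  set p := D.chart.G y with hp
  have hFp : ∀ j, D.f j p = y (Fin.castLE D.hmn j) := fun j => by
    rw [← D.F_castLE]
    exact congrFun hy _
  have hpJ : ∀ j ∈ J, D.f j p ≠ 0 := fun j hj => by
    have h1 := right_ne_zero_of_mul hne
    exact Finset.prod_ne_zero_iff.1 (Complex.ofReal_ne_zero.1 h1) j hj
  have hpJc : ∀ j ∉ J, D.f j p = 0 := fun j hj => by
    rw [hFp]
    exact hyK j (Finset.mem_compl.2 hj)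
  -- On a neighbourhood of `p` the annihilating function is invertible, so `u_{k-m}` vanishes.
  obtain ⟨S₁, hS₁, hS₁o, hpS₁⟩ := eventually_nhds_iff.1
    ((((ha' p (hW hyW)).continuousAt.eventually_ne hne)).and (W.isOpen.mem_nhds hyW))
  set S : Opens (Fin n → ℝ) := ⟨S₁, hS₁o⟩ with hSdef
  have hSW : S ≤ W := fun x hx => (hS₁ x hx).2
  have hinv : AnalyticOnNhd ℝ (fun x => (k (D.F x) * (D.fprod J x : ℂ))⁻¹) S := fun x hx =>
    (ha' x (hW (hSW hx))).inv (hS₁ x hx).1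
  obtain ⟨ψ, hψ⟩ := exists_coeff_ne_zero hu ((hSW.trans hW).trans inf_le_left) (S := S) hpS₁ hys hJ
    hpJ hpJc
  refine hψ ?_
  rw [← hWu (extTest hSW (mulTest _ hinv ψ))]
  congr 1
  refine DFunLike.ext _ _ fun x => ?_
  simp only [extTest_apply, mulTest_apply]
  by_cases hx : x ∈ S
  · rw [← mul_assoc, mul_inv_cancel₀ (hS₁ x hx).1, one_mul]
  · rw [testFunction_eq_zero ψ hx]
    simp

end DualFrame

end

section

/-! ### Continuity of operators on test functions -/

section Continuity

variable {n : ℕ} {V : Opens (Fin n → ℝ)}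

/-- A smooth function on `V` agrees on a given compact subset of `V` with a globally defined one. -/
theorem exists_contDiff_eqOn {a : (Fin n → ℝ) → ℂ} (ha : AnalyticOnNhd ℝ a V)
    {K : Set (Fin n → ℝ)} (hK : IsCompact K) (hKV : K ⊆ V) :
    ∃ g : (Fin n → ℝ) → ℂ, ContDiff ℝ (⊤ : ℕ∞) g ∧ ∀ x ∈ K, g x = a x := by
  obtain ⟨χ, h0, h1, -⟩ := exists_contMDiffMap_zero_one_nhds_of_isClosed
    (modelWithCornersSelf ℝ (Fin n → ℝ)) (n := (⊤ : ℕ∞)) (s := (V : Set (Fin n → ℝ))ᶜ) (t := K)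
    V.isOpen.isClosed_compl hK.isClosed
    (Set.disjoint_left.2 fun x hx hxK => hx (hKV hxK))
  have hχ : ContDiff ℝ (⊤ : ℕ∞) χ := χ.contMDiff.contDiff
  refine ⟨fun x => (χ x : ℂ) * a x, ?_, fun x hx => ?_⟩
  · rw [contDiff_iff_contDiffAt]
    intro x
    by_cases hx : x ∈ V
    · exact (Complex.ofRealCLM.contDiff.comp hχ).contDiffAt.mul (ha x hx).contDiffAt
    · refine (contDiffAt_const (c := (0 : ℂ))).congr_of_eventuallyEq ?_
      have h2 := (eventually_nhdsSet_iff_forall.1 h0) x hx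
      filter_upwards [h2] with y hy
      rw [hy, Complex.ofReal_zero, zero_mul]
  · have h2 := ((eventually_nhdsSet_iff_forall.1 h1) x hx).self_of_nhds
    simp [h2]

theorem continuous_mulTest {a : (Fin n → ℝ) → ℂ} (ha : AnalyticOnNhd ℝ a V) :
    Continuous (mulTest a ha) := by
  have h : ∀ (K : Compacts (Fin n → ℝ)) (hK : (K : Set (Fin n → ℝ)) ⊆ V),
      Continuous (mulTest a ha ∘ TestFunction.ofSupportedIn hK) := by
    intro K hK
    obtain ⟨g, hg, hga⟩ := exists_contDiff_eqOn ha K.isCompact hK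
    have h1 : mulTest a ha ∘ TestFunction.ofSupportedIn hK =
        (TestFunction.ofSupportedIn hK) ∘
          (ContDiffMapSupportedIn.bilinLeftCLM (ContinuousLinearMap.mul ℂ ℂ) hg) := by
      funext φ
      refine DFunLike.ext _ _ fun x => ?_
      change a x * φ x = φ x * g x
      by_cases hx : x ∈ K
      · rw [hga x hx, mul_comm]
      · rw [φ.zero_on_compl hx, Pi.zero_apply, mul_zero, zero_mul]
    rw [h1]
    exact (TestFunction.continuous_ofSupportedIn hK).comp (ContinuousLinearMap.continuous _)
  exact (TestFunction.mkCLM ℂ (mulTest a ha) (mulTest_add ha) (mulTest_smul ha) h).continuous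

/-- `mulTest` as a continuous linear map. -/
def mulTestCLM (a : (Fin n → ℝ) → ℂ) (ha : AnalyticOnNhd ℝ a V) : 𝓓(V, ℂ) →L[ℂ] 𝓓(V, ℂ) where
  toFun := mulTest a ha
  map_add' := mulTest_add ha
  map_smul' := mulTest_smul ha
  cont := continuous_mulTest ha

/-- `transField` as a continuous linear map. -/
def transFieldCLM (X : (Fin n → ℝ) → (Fin n → ℝ)) (hX : AnalyticOnNhd ℝ X V) :
    𝓓(V, ℂ) →L[ℂ] 𝓓(V, ℂ) :=
  ∑ l, -(TestFunction.lineDerivCLM ℂ (Pi.single l 1) : 𝓓(V, ℂ) →L[ℂ] 𝓓(V, ℂ)).comp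
    (mulTestCLM _ (comp_analyticOnNhd hX l))

theorem transFieldCLM_apply {X : (Fin n → ℝ) → (Fin n → ℝ)} (hX : AnalyticOnNhd ℝ X V)
    (φ : 𝓓(V, ℂ)) : transFieldCLM X hX φ = transField X hX φ := by
  rw [transFieldCLM, sum_apply]
  rfl

/-- A linear form on test functions is continuous when it is bounded by a multiple of the supremum
norm on the test functions with support in a given compact set. -/
theorem continuous_of_norm_le (A : 𝓓(V, ℂ) →ₗ[ℂ] ℂ)
    (h : ∀ K : Compacts (Fin n → ℝ), (K : Set (Fin n → ℝ)) ⊆ V → ∃ C : ℝ, 0 ≤ C ∧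
      ∀ (φ : 𝓓(V, ℂ)) (b : ℝ), (∀ x, ‖φ x‖ ≤ b) → (∀ x, x ∉ K → φ x = 0) → ‖A φ‖ ≤ C * b) :
    Continuous A := by
  rw [TestFunction.continuous_iff_continuous_comp]
  intro K hK
  obtain ⟨C, hC, h⟩ := h K hK
  refine (ContDiffMapSupportedIn.mkCLMtoNormedSpace ℂ (A ∘ TestFunction.ofSupportedIn hK)
    (fun φ ψ => map_add A (TestFunction.ofSupportedIn hK φ) (TestFunction.ofSupportedIn hK ψ))
    (fun c φ => map_smul A c (TestFunction.ofSupportedIn hK φ)) ⟨{0}, C, hC, fun φ => ?_⟩).continuous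
  rw [Finset.sup_singleton]
  exact h _ _ (fun x => ContDiffMapSupportedIn.norm_apply_le_seminorm ℂ)
    fun x hx => φ.zero_on_compl hx

end Continuity

namespace DualFrame

variable {n m : ℕ} {V : Opens (Fin n → ℝ)} (D : DualFrame n m)

/-- `tvList` as a continuous linear map. -/
def tvListCLM (hV : V ≤ D.U) (l : List (Fin m)) : 𝓓(V, ℂ) →L[ℂ] 𝓓(V, ℂ) :=
  l.foldr (fun i A => (transFieldCLM (D.v (Fin.castLE D.hmn i)) ((D.hv _).mono hV)).comp A)
    (ContinuousLinearMap.id ℂ _)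

theorem tvListCLM_apply (hV : V ≤ D.U) (l : List (Fin m)) (φ : 𝓓(V, ℂ)) :
    D.tvListCLM hV l φ = D.tvList hV l φ := by
  induction l with
  | nil => rfl
  | cons i l ih =>
    change transFieldCLM _ _ (D.tvListCLM hV l φ) = D.tv hV _ (D.tvList hV l φ)
    rw [ih, transFieldCLM_apply, tv]

/-- `tL` as a continuous linear map. -/
def tLCLM (hV : V ≤ D.U) : 𝓓(V, ℂ) →L[ℂ] 𝓓(V, ℂ) := D.tvListCLM hV (List.finRange m)

theorem tLCLM_apply (hV : V ≤ D.U) (φ : 𝓓(V, ℂ)) : D.tLCLM hV φ = D.tL hV φ :=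
  D.tvListCLM_apply hV _ φ

theorem locallyIntegrableOn_ppow (hV : V ≤ D.U) {s : ℂ} (hs : 0 < s.re) :
    LocallyIntegrableOn (fun x => ppow (D.fprod Finset.univ x) s) V := by
  refine ContinuousOn.locallyIntegrableOn (fun x hx => ?_) V.isOpen.measurableSet
  exact ((continuous_ppow hs).continuousAt.comp
    (D.fprod_analyticAt _ (hV hx)).continuousAt).continuousWithinAt

/-- The distribution `f₊ˢ`, for `Re s > 0`. -/
def powCLM (s : ℂ) : Distr V :=
  TestFunction.integralAgainstBilinCLM (ContinuousLinearMap.mul ℂ ℂ) volume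
    fun x => ppow (D.fprod Finset.univ x) s

theorem powCLM_apply (hV : V ≤ D.U) {s : ℂ} (hs : 0 < s.re) (φ : 𝓓(V, ℂ)) :
    D.powCLM s φ = D.powInt s φ := by
  rw [powCLM, TestFunction.integralAgainstBilinCLM_eq_integral (D.locallyIntegrableOn_ppow hV hs)]
  exact integral_congr_ae (Eventually.of_forall fun x => mul_comm _ _)

theorem powInt_add (hV : V ≤ D.U) {s : ℂ} (hs : 0 < s.re) (φ ψ : 𝓓(V, ℂ)) :
    D.powInt s (φ + ψ) = D.powInt s φ + D.powInt s ψ := by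
  rw [← D.powCLM_apply hV hs, ← D.powCLM_apply hV hs, ← D.powCLM_apply hV hs, map_add]

theorem powInt_smul (hV : V ≤ D.U) {s : ℂ} (hs : 0 < s.re) (c : ℂ) (φ : 𝓓(V, ℂ)) :
    D.powInt s (c • φ) = c * D.powInt s φ := by
  rw [← D.powCLM_apply hV hs, ← D.powCLM_apply hV hs, map_smul, smul_eq_mul]

/-- A bound for `f₊ˢ` on the test functions supported in a compact set, uniform in a bounded set
of exponents. -/
theorem exists_norm_powInt_le (hV : V ≤ D.U) {K : Compacts (Fin n → ℝ)}
    (hK : (K : Set (Fin n → ℝ)) ⊆ V) (R : ℝ) : ∃ C : ℝ, 0 ≤ C ∧ ∀ s : ℂ, 0 ≤ s.re → s.re ≤ R →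
      ∀ (φ : 𝓓(V, ℂ)) (b : ℝ), (∀ x, ‖φ x‖ ≤ b) → (∀ x, x ∉ K → φ x = 0) →
        ‖D.powInt s φ‖ ≤ C * b := by
  have hc : ContinuousOn (D.fprod Finset.univ) K := fun x hx =>
    (D.fprod_analyticAt _ (hV (hK hx))).continuousAt.continuousWithinAt
  obtain ⟨B, hB⟩ := K.isCompact.bddAbove_image hc
  refine ⟨(max B 1) ^ R * volume.real (K : Set (Fin n → ℝ)), by positivity,
    fun s hs hR φ b hb hφ => ?_⟩
  have h1 : D.powInt s φ = ∫ x in (K : Set (Fin n → ℝ)), ppow (D.fprod Finset.univ x) s * φ x :=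
    (setIntegral_eq_integral_of_forall_compl_eq_zero fun x hx => by rw [hφ x hx, mul_zero]).symm
  rw [h1]
  refine (norm_setIntegral_le_of_norm_le_const (C := (max B 1) ^ R * b) K.isCompact.measure_lt_top
    fun x hx => ?_).trans (le_of_eq (by ring))
  rw [norm_mul]
  have h2 : 0 ≤ b := (norm_nonneg _).trans (hb x)
  gcongr
  · exact norm_ppow_le (le_max_right _ _) ((hB ⟨x, hx, rfl⟩).trans (le_max_left _ _)) hs hR
  · exact hb x

end DualFrame

end

section

namespace DualFrame

variable {n m : ℕ} {V : Opens (Fin n → ℝ)} (D : DualFrame n m)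

/-! ### Meromorphic continuation of the complex power -/

/-- The continuation of `f₊ˢ` to `Re s > -N` by means of the functional equation. -/
def cont (hV : V ≤ D.U) (N : ℕ) (s : ℂ) : Distr V :=
  (∏ r ∈ Finset.range N, ((s + (r + 1 : ℕ)) ^ m)⁻¹) • (D.powCLM (s + N)).comp (D.tLCLM hV ^ N)

theorem cont_apply (hV : V ≤ D.U) {N : ℕ} {s : ℂ} (hs : 0 < s.re + N) (φ : 𝓓(V, ℂ)) :
    D.cont hV N s φ = (∏ r ∈ Finset.range N, ((s + (r + 1 : ℕ)) ^ m)⁻¹) *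
      D.powInt (s + N) ((D.tLCLM hV ^ N) φ) := by
  rw [cont, smul_apply, ContinuousLinearMap.comp_apply, D.powCLM_apply hV (by simpa using hs),
    smul_eq_mul]

theorem cont_succ (hV : V ≤ D.U) {N : ℕ} {s : ℂ} (hs : 0 < s.re + N) (φ : 𝓓(V, ℂ)) :
    D.cont hV (N + 1) s φ = D.cont hV N s φ := by
  have hs' : 0 < (s + N).re := by simpa using hs
  have h0 : s + ((N + 1 : ℕ) : ℂ) ≠ 0 := fun h => by
    have := congrArg Complex.re h
    simp at this
    linarith
  have h1 : (D.tLCLM hV ^ (N + 1)) φ = D.tL hV ((D.tLCLM hV ^ N) φ) := by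
    rw [pow_succ', ← tLCLM_apply]
    rfl
  have h2 : s + ((N + 1 : ℕ) : ℂ) = s + N + 1 := by push_cast; ring
  rw [D.cont_apply hV hs, D.cont_apply hV (by push_cast; linarith), h1, Finset.prod_range_succ, h2,
    D.powInt_tL hV hs', ← h2]
  field_simp

theorem cont_eq_of_le (hV : V ≤ D.U) {N N' : ℕ} {s : ℂ} (hs : 0 < s.re + N) (hN : N ≤ N')
    (φ : 𝓓(V, ℂ)) : D.cont hV N' s φ = D.cont hV N s φ := by
  induction N', hN using Nat.le_induction with
  | base => rfl
  | succ k hk ih =>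
    rw [D.cont_succ hV ?_, ih]
    have : (N : ℝ) ≤ k := by exact_mod_cast hk
    linarith

theorem cont_eq (hV : V ≤ D.U) {N N' : ℕ} {s : ℂ} (hs : 0 < s.re + N) (hs' : 0 < s.re + N')
    (φ : 𝓓(V, ℂ)) : D.cont hV N s φ = D.cont hV N' s φ :=
  (D.cont_eq_of_le hV hs (le_max_left N N') φ).symm.trans
    (D.cont_eq_of_le hV hs' (le_max_right N N') φ)

/-- The complex power `f₊ˢ`. -/
def complexPow (hV : V ≤ D.U) (s : ℂ) : Distr V := D.cont hV (⌊|s.re|⌋₊ + 1) s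

theorem complexPow_eq (hV : V ≤ D.U) {N : ℕ} {s : ℂ} (hs : 0 < s.re + N) (φ : 𝓓(V, ℂ)) :
    D.complexPow hV s φ = D.cont hV N s φ := by
  refine D.cont_eq hV ?_ hs φ
  have h1 := Nat.lt_floor_add_one |s.re|
  have h2 := neg_abs_le s.re
  push_cast
  linarith

theorem isComplexPower_complexPow (hV : V ≤ D.U) :
    IsComplexPower V (fun x => ∏ j, D.f j x) (D.complexPow hV) := by
  refine ⟨fun φ s _ => ?_, fun s hs φ => ?_⟩
  · obtain ⟨N, hN⟩ := exists_nat_gt (-s.re)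
    have hN' : 0 < s.re + N := by linarith
    have h1 : MeromorphicAt (fun s : ℂ => (∏ r ∈ Finset.range N, ((s + (r + 1 : ℕ)) ^ m)⁻¹) *
        D.powInt (s + N) ((D.tLCLM hV ^ N) φ)) s := by
      refine MeromorphicAt.mul ?_ (AnalyticAt.meromorphicAt ?_)
      · exact MeromorphicAt.fun_prod fun r _ =>
          ((analyticAt_id.add analyticAt_const).pow m).meromorphicAt.inv
      · exact AnalyticAt.comp (g := fun s => D.powInt s ((D.tLCLM hV ^ N) φ)) (f := fun s => s + N)
          (D.analyticOnNhd_powInt hV _ _ (by simpa using hN')) (analyticAt_id.add analyticAt_const)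
    refine h1.congr (Filter.Eventually.filter_mono nhdsWithin_le_nhds ?_)
    have h2 : {z : ℂ | 0 < z.re + N} ∈ 𝓝 s :=
      (isOpen_lt continuous_const (Complex.continuous_re.add continuous_const)).mem_nhds hN'
    filter_upwards [h2] with z hz
    rw [D.complexPow_eq hV hz, D.cont_apply hV hz]
  · rw [D.complexPow_eq hV (N := 0) (by simpa using hs), D.cont_apply hV (by simpa using hs)]
    simp only [Finset.range_zero, Finset.prod_empty, one_mul, pow_zero, Nat.cast_zero, add_zero]
    rfl

/-! ### The Laurent expansion at `-1` -/

/-- The function `(s + 1)ᵐ f₊ˢ`, near `-1`, against a test function of the form `ᵗL² φ`. -/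
def regular (s : ℂ) (φ : 𝓓(V, ℂ)) : ℂ := ((s + 2) ^ m)⁻¹ * D.powInt (s + 2) φ

theorem re_pos_of_mem_ball {s : ℂ} (hs : s ∈ Metric.ball (-1 : ℂ) 1) : 0 < (s + 2).re := by
  rw [Metric.mem_ball, dist_eq_norm] at hs
  have h1 := (Complex.abs_re_le_norm (s - -1)).trans_lt hs
  rw [abs_lt] at h1
  have h2 := h1.1
  simp at h2 ⊢
  linarith

theorem analyticAt_regular (hV : V ≤ D.U) (φ : 𝓓(V, ℂ)) {s : ℂ}
    (hs : s ∈ Metric.ball (-1 : ℂ) 1) : AnalyticAt ℂ (fun s => D.regular s φ) s := by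
  have h0 : AnalyticAt ℂ (fun s : ℂ => s + 2) s := analyticAt_id.add analyticAt_const
  have h1 := re_pos_of_mem_ball hs
  refine ((h0.pow m).inv (pow_ne_zero _ fun h => ?_)).mul
    (AnalyticAt.comp (g := fun s => D.powInt s φ) (f := fun s => s + 2)
      (D.analyticOnNhd_powInt hV _ _ h1) h0)
  change s + 2 = 0 at h
  rw [h] at h1
  simp at h1

theorem neg_one_mem_ball : (-1 : ℂ) ∈ Metric.ball (-1 : ℂ) 1 := Metric.mem_ball_self one_pos

theorem iteratedDeriv_regular_add (hV : V ≤ D.U) (j : ℕ) (φ ψ : 𝓓(V, ℂ)) :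
    iteratedDeriv j (fun s => D.regular s (φ + ψ)) (-1) =
      iteratedDeriv j (fun s => D.regular s φ) (-1) +
        iteratedDeriv j (fun s => D.regular s ψ) (-1) := by
  have h1 : (fun s => D.regular s (φ + ψ)) =ᶠ[𝓝 (-1)]
      (fun s => D.regular s φ) + fun s => D.regular s ψ := by
    filter_upwards [Metric.ball_mem_nhds (-1 : ℂ) one_pos] with s hs
    rw [Pi.add_apply, regular, D.powInt_add hV (re_pos_of_mem_ball hs), mul_add]
    rfl
  rw [h1.iteratedDeriv_eq, iteratedDeriv_add]
  · exact (D.analyticAt_regular hV φ neg_one_mem_ball).contDiffAt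
  · exact (D.analyticAt_regular hV ψ neg_one_mem_ball).contDiffAt

theorem iteratedDeriv_regular_smul (hV : V ≤ D.U) (j : ℕ) (c : ℂ) (φ : 𝓓(V, ℂ)) :
    iteratedDeriv j (fun s => D.regular s (c • φ)) (-1) =
      c * iteratedDeriv j (fun s => D.regular s φ) (-1) := by
  have h1 : (fun s => D.regular s (c • φ)) =ᶠ[𝓝 (-1)] fun s => c * D.regular s φ := by
    filter_upwards [Metric.ball_mem_nhds (-1 : ℂ) one_pos] with s hs
    rw [regular, D.powInt_smul hV (re_pos_of_mem_ball hs), regular]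
    ring
  rw [h1.iteratedDeriv_eq, iteratedDeriv_const_mul_field]

/-- Cauchy's estimate for the Taylor coefficients of `regular`. -/
theorem exists_norm_iteratedDeriv_regular_le (hV : V ≤ D.U) {K : Compacts (Fin n → ℝ)}
    (hK : (K : Set (Fin n → ℝ)) ⊆ V) (j : ℕ) : ∃ C : ℝ, 0 ≤ C ∧
      ∀ (φ : 𝓓(V, ℂ)) (b : ℝ), (∀ x, ‖φ x‖ ≤ b) → (∀ x, x ∉ K → φ x = 0) →
        ‖iteratedDeriv j (fun s => D.regular s φ) (-1)‖ ≤ C * b := by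
  obtain ⟨C, hC, h⟩ := D.exists_norm_powInt_le hV hK 2
  refine ⟨j.factorial * (2 ^ m * C) / (1 / 2) ^ j, by positivity, fun φ b hb hφ => ?_⟩
  have h1 := Complex.norm_iteratedDeriv_le_of_forall_mem_sphere_norm_le (c := -1) (R := 1 / 2)
    (C := 2 ^ m * C * b) (f := fun s => D.regular s φ) j (by norm_num) ?_ fun s hs => ?_
  · refine h1.trans (le_of_eq ?_)
    ring
  · refine DifferentiableOn.diffContOnCl fun s hs => ?_
    rw [closure_ball _ (by norm_num)] at hs
    exact (D.analyticAt_regular hV φ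
      (Metric.closedBall_subset_ball (by norm_num) hs)).differentiableAt.differentiableWithinAt
  · rw [mem_sphere_iff_norm] at hs
    have h2 := (abs_le.1 ((Complex.abs_re_le_norm (s - -1)).trans hs.le))
    have h3 : 1 / 2 ≤ (s + 2).re ∧ (s + 2).re ≤ 2 := by
      simp at h2 ⊢
      constructor <;> linarith
    have h4 : 1 / 2 ≤ ‖s + 2‖ := h3.1.trans ((le_abs_self _).trans (Complex.abs_re_le_norm _))
    rw [regular, norm_mul, norm_inv, norm_pow]
    have h5 : (‖s + 2‖ ^ m)⁻¹ ≤ 2 ^ m := by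
      rw [inv_le_comm₀ (by positivity) (by positivity), ← inv_pow]
      gcongr
      linarith
    calc _ ≤ 2 ^ m * (C * b) := by
          gcongr
          exact h _ (by linarith [h3.1]) h3.2 φ b hb hφ
      _ = 2 ^ m * C * b := by ring

/-- The Taylor coefficients of `regular` at `-1`, as linear forms. -/
def taylorCoeffLM (hV : V ≤ D.U) (j : ℕ) : 𝓓(V, ℂ) →ₗ[ℂ] ℂ where
  toFun φ := ((j.factorial : ℂ))⁻¹ * iteratedDeriv j (fun s => D.regular s φ) (-1)
  map_add' φ ψ := by rw [D.iteratedDeriv_regular_add hV, mul_add]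
  map_smul' c φ := by
    rw [D.iteratedDeriv_regular_smul hV, RingHom.id_apply, smul_eq_mul, mul_left_comm]

/-- The Taylor coefficients of `regular` at `-1`, as distributions. -/
def taylorCoeff (hV : V ≤ D.U) (j : ℕ) : Distr V where
  toLinearMap := D.taylorCoeffLM hV j
  cont := by
    refine continuous_of_norm_le (D.taylorCoeffLM hV j) fun K hK => ?_
    obtain ⟨C, hC, h⟩ := D.exists_norm_iteratedDeriv_regular_le hV hK j
    refine ⟨‖((j.factorial : ℂ))⁻¹‖ * C, by positivity, fun φ b hb hφ => ?_⟩
    refine (norm_mul_le _ _).trans ?_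
    rw [mul_assoc]
    exact mul_le_mul_of_nonneg_left (h φ b hb hφ) (norm_nonneg _)

theorem taylorCoeff_apply (hV : V ≤ D.U) (j : ℕ) (φ : 𝓓(V, ℂ)) : D.taylorCoeff hV j φ =
    ((j.factorial : ℂ))⁻¹ * iteratedDeriv j (fun s => D.regular s φ) (-1) := rfl

theorem hasSum_regular (hV : V ≤ D.U) (φ : 𝓓(V, ℂ)) {s : ℂ} (hs : s ∈ Metric.ball (-1 : ℂ) 1) :
    HasSum (fun j => (s + 1) ^ j * D.taylorCoeff hV j φ) (D.regular s φ) := by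
  have h1 := Complex.hasSum_taylorSeries_on_ball (f := fun s => D.regular s φ) (c := -1) (r := 1)
    (fun s hs => (D.analyticAt_regular hV φ hs).differentiableAt.differentiableWithinAt) hs
  have h2 : (fun j : ℕ => (s + 1) ^ j * D.taylorCoeff hV j φ) = fun j : ℕ =>
      ((j.factorial : ℂ))⁻¹ • (s - -1) ^ j • iteratedDeriv j (fun s => D.regular s φ) (-1) := by
    funext j
    rw [D.taylorCoeff_apply hV, sub_neg_eq_add, smul_eq_mul, smul_eq_mul]
    ring
  rwa [h2]

theorem exists_isLaurentExpansion (hV : V ≤ D.U) : ∃ u : ℤ → Distr V,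
    IsLaurentExpansion V (fun x => ∏ j, D.f j x) (-1) m u := by
  refine ⟨fun i => (D.taylorCoeff hV (i + m).toNat).comp (D.tLCLM hV ^ 2), D.complexPow hV,
    D.isComplexPower_complexPow hV, Metric.ball (-1) 1, Metric.ball_mem_nhds _ one_pos,
    fun s hs hs1 φ => ?_⟩
  have h0 : s + 1 ≠ 0 := fun h => hs1 (eq_neg_of_add_eq_zero_left h)
  have h1 : (0 : ℝ) < s.re + (2 : ℕ) := by simpa using re_pos_of_mem_ball hs
  have h2 : D.complexPow hV s φ = ((s + 1) ^ m)⁻¹ * D.regular s ((D.tLCLM hV ^ 2) φ) := by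
    rw [D.complexPow_eq hV h1, D.cont_apply hV h1, regular, Finset.prod_range_succ,
      Finset.prod_range_one]
    push_cast
    ring_nf
  rw [h2]
  refine (congrArg (fun g => HasSum g _) (funext fun j => ?_)).mpr
    ((D.hasSum_regular hV ((D.tLCLM hV ^ 2) φ) hs).mul_left ((s + 1) ^ m)⁻¹)
  have h3 : ((j : ℤ) - m + m).toNat = j := by rw [sub_add_cancel, Int.toNat_natCast]
  simp only [h3, sub_neg_eq_add, zpow_sub₀ h0, zpow_natCast, ContinuousLinearMap.comp_apply]
  ring

end DualFrame

end

end ComplexPower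

end

theorem mainTheorem2 {n m : ℕ} (hmn : m ≤ n) (U : Opens (Fin n → ℝ)) (h0 : (0 : Fin n → ℝ) ∈ U)
    (f : Fin m → (Fin n → ℝ) → ℝ) (hf : ∀ j, AnalyticOnNhd ℝ (f j) U)
    (hdf : ExteriorAlgebra.ιMulti ℝ m (fun j => fderiv ℝ (f j) 0) ≠ 0)
    (v : Fin n → (Fin n → ℝ) → (Fin n → ℝ)) (hv : ∀ i, AnalyticOnNhd ℝ (v i) U)
    (hvli : LinearIndependent ℝ (fun i => v i 0))
    (hvf : ∀ (i : Fin n) (j : Fin m), ∀ x ∈ U,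
      fderiv ℝ (f j) x (v i x) = if (i : ℕ) = (j : ℕ) then 1 else 0) :
    (∃ V : Opens (Fin n → ℝ), V ≤ U ∧ (0 : Fin n → ℝ) ∈ V ∧ ∃ u : ℤ → ComplexPower.Distr V,
      ComplexPower.IsLaurentExpansion V (fun x => ∏ j, f j x) (-1) m u) ∧
    ∀ V : Opens (Fin n → ℝ), V ≤ U → (0 : Fin n → ℝ) ∈ V → ∀ u : ℤ → ComplexPower.Distr V,
      ComplexPower.IsLaurentExpansion V (fun x => ∏ j, f j x) (-1) m u →
      ∀ k : ℕ, k < m →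
        ComplexPower.annihilator (u (-(m : ℤ) + k)) =
          (Ideal.span (ComplexPower.generators hmn f (fun j => hf j 0 h0) v
            (fun i => hv i 0 h0) k) : Set (ComplexPower.DiffOpGerm n)) := by
  let D : ComplexPower.DualFrame n m := ⟨hmn, U, h0, f, hf, v, hv, hvli, hvf⟩
  refine ⟨⟨U, le_rfl, h0, D.exists_isLaurentExpansion le_rfl⟩, fun V hV h0V u hu k hk => ?_⟩
  have hu' : ComplexPower.IsLaurentExpansion V (fun x => ∏ j, D.f j x) (-1) m u := hu
  have hcard : Fintype.card (Fin m) = m := Fintype.card_fin m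
  let o : Fin m := ⟨0, by omega⟩
  have h1 := ComplexPower.LogFrame.le_I (L := D.chart.frame D.hmn) (o := o)
    (Z := D.chart.VanishesOn D.hmn)
    (N := fun k => ComplexPower.annIdeal h0V (u ((k : ℤ) - m)))
    (D.chart.isVanishing_vanishesOn D.hmn)
    (fun k hk => ComplexPower.DualFrame.I_le_annIdeal hu' hV h0V o rfl (hk.trans_eq hcard))
    (fun k P hk hP =>
      ComplexPower.DualFrame.mem_annIdeal_of_mul_eul_mem hu' hV h0V o rfl (hk.trans_eq hcard) hP)
    (fun k hk J a hJ ha => by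
      subst hJ
      exact ComplexPower.DualFrame.vanishesOn_of_mem_annIdeal hu' h0V (hk.trans_eq hcard) ha)
    (hcard.symm ▸ hk)
  have h2 := le_antisymm h1 (ComplexPower.DualFrame.I_le_annIdeal hu' hV h0V o rfl hk)
  have h3 := D.span_generators_eq o rfl k
  rw [neg_add_eq_sub]
  exact congrArg (fun I : Ideal (ComplexPower.DiffOpGerm n) => (I : Set (ComplexPower.DiffOpGerm n)))
    (h2.trans h3.symm)
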